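/- Let $R$ (red) and $B$ (blue) be sets of at most $n$ points in $\mathbb{R}^2$ such that $R\cup B$ has at least three points and is in general position, i.e. no two points of $R\cup B$ share an $x$-coordinate or a $y$-coordinate and no three of them are collinear. A strip is the closed region $W$ between two distinct parallel lines. Its number of outliers is $k(W)=k_R(W)+k_B(W)$, where $k_R(W)=|R\cap\operatorname{int}(W)|$ and $k_B(W)=|B\cap\operatorname{int}(\mathbb{R}^2\setminus W)|$. Theorem. A strip that minimizes $k(W)$ over all strips $W$ can be computed in $O(n^2\log n)$ time in the worst case on a real RAM. That is, there are a single program and constants $C,K$ such that for all $n$, $R$ and $B$ as above, given the coordinates of the points of $R$ and of $B$ as two lists in any order, the program halts after at most $C\,n^2\log n$ steps and has output four real numbers $a,b,c_1,c_2$ with $(a,b)\neq(0,0)$ and $c_1<c_2$ for which $W=\{(x,y): c_1\le ax+by\le c_2\}$ is such an optimal strip. Here a real RAM performs exact arithmetic ($+,-,\cdot,/$) and comparisons on real numbers (without rounding), arithmetic and comparisons on words (natural numbers of size at most $n^K$), conversion of words to reals, and indirect memory access through words, in one step each. -/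

import Mathlib

/-! ## Strip separation of red and blue points -/

/-- No two points share an x-coordinate or a y-coordinate, and no three points are collinear. -/
def InGeneralPosition (S : Set (ℝ × ℝ)) : Prop :=
  (∀ p ∈ S, ∀ q ∈ S, p ≠ q → p.1 ≠ q.1 ∧ p.2 ≠ q.2) ∧
  (∀ p ∈ S, ∀ q ∈ S, ∀ r ∈ S, p ≠ q → p ≠ r → q ≠ r →
    ¬ Collinear ℝ ({p, q, r} : Set (ℝ × ℝ)))

/-- The closed region between the parallel lines `a * x + b * y = c₁` and `a * x + b * y = c₂`. -/
def stripRegion (a b c₁ c₂ : ℝ) : Set (ℝ × ℝ) :=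
  {p | c₁ ≤ a * p.1 + b * p.2 ∧ a * p.1 + b * p.2 ≤ c₂}

/-- A strip: the region bounded by two distinct parallel lines (of any direction, vertical
lines included). -/
def IsStrip (W : Set (ℝ × ℝ)) : Prop :=
  ∃ a b c₁ c₂ : ℝ, (a, b) ≠ (0, 0) ∧ c₁ < c₂ ∧ W = stripRegion a b c₁ c₂

/-- The total number `k = k_R + k_B` of outliers of the region `W` meant for the blue points:
`k_R` counts the red points in the interior of `W`, and `k_B` counts the blue points in the
interior of the complement of `W`. -/
noncomputable def numOutliers (R B : Set (ℝ × ℝ)) (W : Set (ℝ × ℝ)) : ℕ :=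
  (R ∩ interior W).ncard + (B ∩ interior Wᶜ).ncard

/-- `W` is a strip that minimizes the total number of outliers among all strips. -/
def IsOptimalStrip (R B : Set (ℝ × ℝ)) (W : Set (ℝ × ℝ)) : Prop :=
  IsStrip W ∧ ∀ W', IsStrip W' → numOutliers R B W ≤ numOutliers R B W'

/-! ## The real RAM

A random access machine whose memory consists of arrays of natural numbers (machine words) and
arrays of real numbers. A program is a fixed finite structured program; the arrays it uses are
named in its text by numbers, and the index into an array is computed at run time (indirect
addressing). Every arithmetic operation, memory access, comparison and assignment takes one time
step. There is no operation, apart from comparison, that leads from real numbers to natural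
numbers (no rounding), and the only constants are natural numbers. The natural numbers stored
in memory are bounded by a word size parameter. -/

namespace RealRAM

/-- The memory: `s.nat a i` and `s.real a i` are the entries with index `i` of the word array
and of the real array with name `a`. -/
structure Mem where
  nat : ℕ → ℕ → ℕ
  real : ℕ → ℕ → ℝ

/-- Word expressions. -/
inductive NExp where
  | lit (k : ℕ)
  | get (a : ℕ) (i : NExp)
  | add (e f : NExp)
  | sub (e f : NExp)
  | mul (e f : NExp)
  | div (e f : NExp)

/-- The value of a word expression: subtraction is truncated at `0`, division rounds down. -/
def NExp.eval (s : Mem) : NExp → ℕ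
  | lit k => k
  | get a i => s.nat a (i.eval s)
  | add e f => e.eval s + f.eval s
  | sub e f => e.eval s - f.eval s
  | mul e f => e.eval s * f.eval s
  | div e f => e.eval s / f.eval s

/-- The time to evaluate a word expression: one step for each operation in it. -/
def NExp.cost : NExp → ℕ
  | lit _ => 1
  | get _ i => i.cost + 1
  | add e f => e.cost + f.cost + 1
  | sub e f => e.cost + f.cost + 1
  | mul e f => e.cost + f.cost + 1
  | div e f => e.cost + f.cost + 1

/-- Real expressions. -/
inductive RExp where
  | ofNat (e : NExp)
  | get (a : ℕ) (i : NExp)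
  | add (e f : RExp)
  | sub (e f : RExp)
  | mul (e f : RExp)
  | div (e f : RExp)

/-- The value of a real expression, in exact real arithmetic (division by `0` gives `0`). -/
noncomputable def RExp.eval (s : Mem) : RExp → ℝ
  | ofNat e => (e.eval s : ℝ)
  | get a i => s.real a (i.eval s)
  | add e f => e.eval s + f.eval s
  | sub e f => e.eval s - f.eval s
  | mul e f => e.eval s * f.eval s
  | div e f => e.eval s / f.eval s

/-- The time to evaluate a real expression: one step for each operation in it. -/
def RExp.cost : RExp → ℕ
  | ofNat e => e.cost + 1
  | get _ i => i.cost + 1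
  | add e f => e.cost + f.cost + 1
  | sub e f => e.cost + f.cost + 1
  | mul e f => e.cost + f.cost + 1
  | div e f => e.cost + f.cost + 1

/-- Tests: comparisons of words, comparisons of reals, and their Boolean combinations. -/
inductive BExp where
  | nlt (e f : NExp)
  | rlt (e f : RExp)
  | neg (b : BExp)
  | conj (b c : BExp)

/-- The truth value of a test. -/
def BExp.Holds (s : Mem) : BExp → Prop
  | nlt e f => e.eval s < f.eval s
  | rlt e f => e.eval s < f.eval s
  | neg b => ¬ b.Holds s
  | conj b c => b.Holds s ∧ c.Holds s

/-- The time to evaluate a test: one step for each operation in it. -/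
def BExp.cost : BExp → ℕ
  | nlt e f => e.cost + f.cost + 1
  | rlt e f => e.cost + f.cost + 1
  | neg b => b.cost + 1
  | conj b c => b.cost + c.cost + 1

/-- Programs. `setNat a i e` stores the word `e` at index `i` of the word array `a`, and
`setReal a i e` stores the real `e` at index `i` of the real array `a`. -/
inductive Cmd where
  | skip
  | setNat (a : ℕ) (i : NExp) (e : NExp)
  | setReal (a : ℕ) (i : NExp) (e : RExp)
  | seq (c d : Cmd)
  | ite (b : BExp) (c d : Cmd)
  | loop (b : BExp) (c : Cmd)

/-- The memory after storing the word `v` at index `i` of the word array `a`. -/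
def Mem.setNat (s : Mem) (a i v : ℕ) : Mem :=
  { s with nat := Function.update s.nat a (Function.update (s.nat a) i v) }

/-- The memory after storing the real `v` at index `i` of the real array `a`. -/
noncomputable def Mem.setReal (s : Mem) (a i : ℕ) (v : ℝ) : Mem :=
  { s with real := Function.update s.real a (Function.update (s.real a) i v) }

/-- `Exec W c s t s'`: started in memory `s`, the program `c` halts after exactly `t` time steps
with memory `s'`, and every word that it stores on the way is at most `W`. (The words that
occur while one of the fixed expressions of the program is evaluated are therefore bounded by
a polynomial in `W`.) Execution is deterministic: one rule applies to each program and memory. -/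
inductive Exec (W : ℕ) : Cmd → Mem → ℕ → Mem → Prop
  | skip (s : Mem) : Exec W .skip s 1 s
  | setNat (s : Mem) (a : ℕ) (i e : NExp) (h : e.eval s ≤ W) :
      Exec W (.setNat a i e) s (i.cost + e.cost + 1) (s.setNat a (i.eval s) (e.eval s))
  | setReal (s : Mem) (a : ℕ) (i : NExp) (e : RExp) :
      Exec W (.setReal a i e) s (i.cost + e.cost + 1) (s.setReal a (i.eval s) (e.eval s))
  | seq {c d : Cmd} {s s' s'' : Mem} {t t' : ℕ} (hc : Exec W c s t s')
      (hd : Exec W d s' t' s'') : Exec W (.seq c d) s (t + t') s''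
  | ite_true {b : BExp} {c d : Cmd} {s s' : Mem} {t : ℕ} (hb : b.Holds s)
      (hc : Exec W c s t s') : Exec W (.ite b c d) s (b.cost + 1 + t) s'
  | ite_false {b : BExp} {c d : Cmd} {s s' : Mem} {t : ℕ} (hb : ¬ b.Holds s)
      (hd : Exec W d s t s') : Exec W (.ite b c d) s (b.cost + 1 + t) s'
  | loop_true {b : BExp} {c : Cmd} {s s' s'' : Mem} {t t' : ℕ} (hb : b.Holds s)
      (hc : Exec W c s t s') (hl : Exec W (.loop b c) s' t' s'') :
      Exec W (.loop b c) s (b.cost + 1 + t + t') s''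
  | loop_false {b : BExp} {c : Cmd} {s : Mem} (hb : ¬ b.Holds s) :
      Exec W (.loop b c) s (b.cost + 1) s

/-- The initial memory for red points `r₀, r₁, …` and blue points `b₀, b₁, …`: word array `0`
holds the number of red points and the number of blue points, the real arrays `0`, `1`, `2`, `3`
hold the x-coordinates of the red points, the y-coordinates of the red points, the
x-coordinates of the blue points and the y-coordinates of the blue points; all else is `0`. -/
noncomputable def inputMem (r b : List (ℝ × ℝ)) : Mem where
  nat
    | 0, 0 => r.length
    | 0, 1 => b.length
    | _, _ => 0
  real
    | 0, i => (r.getD i 0).1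
    | 1, i => (r.getD i 0).2
    | 2, i => (b.getD i 0).1
    | 3, i => (b.getD i 0).2
    | _, _ => 0

/-- The four output numbers: the first four entries `a, b, c₁, c₂` of the real array `4` satisfy
`(a, b) ≠ (0, 0)` and `c₁ < c₂`, and describe the strip `W`. -/
def OutputsStrip (s : Mem) (W : Set (ℝ × ℝ)) : Prop :=
  (s.real 4 0, s.real 4 1) ≠ (0, 0) ∧ s.real 4 2 < s.real 4 3 ∧
    W = stripRegion (s.real 4 0) (s.real 4 1) (s.real 4 2) (s.real 4 3)

end RealRAM

/-!
The program sweeps over the slopes of the lines through two points, in increasing order, and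
maintains the order of all points in the current direction.

*Values of strips.* Up to the constant number of blue points, the number of outliers is the
negative of `stripVal`: blue points in the closed strip minus red points in the open strip. For a
fixed direction only the sequence of points across the strip matters, where points on a common
line of this direction form one group. A blue point counts on the boundary of the strip, a red one
does not, so letting neighbouring groups merge never decreases the best value
(`exists_stripVal_le_of_monotone`). Therefore every direction, the vertical one included, can be
rotated to the slope of a line through two points without loss (`exists_stripVal_le_of_slope`). In
such a direction a best strip has a point on either boundary (`exists_stripVal_le_of_pair`),
because the points are not all collinear, and its value is a sum over a contiguous part of the
sequence of groups, where the red points of the first and of the last group do not count.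

*The tree.* The maximum of these sums is kept by a complete binary tree whose nodes store the
usual data for maximal subarrays (`Summary`). A point changes its group in logarithmic time
(`runs_moveCmd`), and the root gives the maximum (`IsTree.root_le_iff_of_rank`).

*The sweep.* A pair of points, `i` to the left of `j`, changes its order at the slope of its line.
This is split into two steps: first `j` moves one slot down, and later `i` moves one slot up. If
all pairs of slope at most `m` have made the first step and those of slope less than `m` the
second, then the slot of a point is the number of points strictly before it in the direction of
slope `m` (`sweepSlot_eq_rank`). This needs no adjacency of the points that are exchanged; it
holds also when several pairs have the same slope, and when a point is both red and blue and thus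
occurs twice. The two steps are driven by two pointers into the sorted list of pairs, and the root
is read whenever the first pointer has passed a group of equal slopes that the second has not
entered (`runs_sweepCmd`).

There are fewer than `N ^ 2` pairs for `N` points; they are sorted with a tournament tree
(`runs_sortCmd`), and every pair costs a constant number of leaf updates, each of `O(log N)`
steps. Only the best slope is remembered; for this one slope all pairs of points are tried as
boundary points in `O(N ^ 2)` steps (`runs_countCmd`, `runs_pickCmd`).

*Programs.* `Runs` is a Hoare triple with a time bound. Loops have a known number of rounds,
loop-free code is evaluated symbolically (`Runs.straight`), and arrays that a program does not
mention in a store are unchanged (`Exec.frame`). Word variables are the entries with index `0` of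
word arrays: `1` is the number of points, `2` the number of leaves of either tree, `3` a loop
counter, `7` the number of events, `8` a tree node, `9` and `10` the two pointers, `11` a flag,
`12` and `13` points, and `14` a slot. The word arrays `4`, `5` and `6` hold the tournament tree,
the slots and the sorted events. The real arrays `0`, `1`, `5` and `6` hold the coordinates, the
colours and the slopes, `7` to `10` the summaries, `11` and `12` the best value and its slope, and
`14`, `15` and `16` serve the final search.
-/

namespace RealRAM

open Finset

/-! ### Reasoning about programs -/

@[simp] theorem Mem.nat_setNat_self (s : Mem) (a i v : ℕ) :
    (s.setNat a i v).nat a = Function.update (s.nat a) i v := by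
  simp [Mem.setNat]

@[simp] theorem Mem.nat_setNat_of_ne (s : Mem) {a b : ℕ} (i v : ℕ) (h : b ≠ a) :
    (s.setNat a i v).nat b = s.nat b := by
  simp [Mem.setNat, h]

@[simp] theorem Mem.real_setNat (s : Mem) (a i v : ℕ) : (s.setNat a i v).real = s.real := rfl

@[simp] theorem Mem.nat_setReal (s : Mem) (a i : ℕ) (v : ℝ) : (s.setReal a i v).nat = s.nat := rfl

@[simp] theorem Mem.real_setReal_self (s : Mem) (a i : ℕ) (v : ℝ) :
    (s.setReal a i v).real a = Function.update (s.real a) i v := by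
  simp [Mem.setReal]

@[simp] theorem Mem.real_setReal_of_ne (s : Mem) {a b : ℕ} (i : ℕ) (v : ℝ) (h : b ≠ a) :
    (s.setReal a i v).real b = s.real b := by
  simp [Mem.setReal, h]

/-- Whether the program text contains a store to the word array `x`. -/
def Cmd.writesNat : Cmd → ℕ → Bool
  | .skip, _ => false
  | .setNat a _ _, x => a == x
  | .setReal _ _ _, _ => false
  | .seq c d, x => c.writesNat x || d.writesNat x
  | .ite _ c d, x => c.writesNat x || d.writesNat x
  | .loop _ c, x => c.writesNat x

/-- Whether the program text contains a store to the real array `x`. -/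
def Cmd.writesReal : Cmd → ℕ → Bool
  | .skip, _ => false
  | .setNat _ _ _, _ => false
  | .setReal a _ _, x => a == x
  | .seq c d, x => c.writesReal x || d.writesReal x
  | .ite _ c d, x => c.writesReal x || d.writesReal x
  | .loop _ c, x => c.writesReal x

/-- The memories `s` and `s'` agree on all arrays to which `c` contains no store. -/
structure Frame (c : Cmd) (s s' : Mem) : Prop where
  nat : ∀ a, c.writesNat a = false → s'.nat a = s.nat a
  real : ∀ a, c.writesReal a = false → s'.real a = s.real a

theorem Exec.frame {W : ℕ} {c : Cmd} {s s' : Mem} {t : ℕ} (h : Exec W c s t s') :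
    Frame c s s' := by
  induction h with
  | skip s => exact ⟨fun _ _ => rfl, fun _ _ => rfl⟩
  | setNat s a i e h =>
    refine ⟨fun x hx => ?_, fun _ _ => rfl⟩
    simp only [Cmd.writesNat, beq_eq_false_iff_ne] at hx
    exact Mem.nat_setNat_of_ne _ _ _ (Ne.symm hx)
  | setReal s a i e =>
    refine ⟨fun _ _ => rfl, fun x hx => ?_⟩
    simp only [Cmd.writesReal, beq_eq_false_iff_ne] at hx
    exact Mem.real_setReal_of_ne _ _ _ (Ne.symm hx)
  | seq _ _ ih₁ ih₂ =>
    constructor <;> intro x hx <;>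
      simp only [Cmd.writesNat, Cmd.writesReal, Bool.or_eq_false_iff] at hx
    · rw [ih₂.nat x hx.2, ih₁.nat x hx.1]
    · rw [ih₂.real x hx.2, ih₁.real x hx.1]
  | ite_true _ _ ih =>
    constructor <;> intro x hx <;>
      simp only [Cmd.writesNat, Cmd.writesReal, Bool.or_eq_false_iff] at hx
    · exact ih.nat x hx.1
    · exact ih.real x hx.1
  | ite_false _ _ ih =>
    constructor <;> intro x hx <;>
      simp only [Cmd.writesNat, Cmd.writesReal, Bool.or_eq_false_iff] at hx
    · exact ih.nat x hx.2
    · exact ih.real x hx.2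
  | loop_true _ _ _ ih₁ ih₂ =>
    constructor <;> intro x hx
    · rw [ih₂.nat x hx, ih₁.nat x hx]
    · rw [ih₂.real x hx, ih₁.real x hx]
  | loop_false _ => exact ⟨fun _ _ => rfl, fun _ _ => rfl⟩

/-- Started in `s`, the program `c` halts after at most `T` steps in a memory that
satisfies `Q`, storing no word above `W`: a Hoare triple for total correctness with a time bound. -/
def Runs (W : ℕ) (c : Cmd) (s : Mem) (T : ℕ) (Q : Mem → Prop) : Prop :=
  ∃ t s', Exec W c s t s' ∧ t ≤ T ∧ Q s'

section Rules

variable {W T T₁ T₂ : ℕ} {c d : Cmd} {s : Mem} {Q Q' : Mem → Prop}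

theorem Runs.mono (h : Runs W c s T₁ Q) (hT : T₁ ≤ T₂) (hQ : ∀ s', Q s' → Q' s') :
    Runs W c s T₂ Q' := by
  obtain ⟨t, s', he, ht, hq⟩ := h
  exact ⟨t, s', he, ht.trans hT, hQ _ hq⟩

theorem Runs.withFrame (h : Runs W c s T Q) :
    Runs W c s T (fun s' => Q s' ∧ Frame c s s') := by
  obtain ⟨t, s', he, ht, hq⟩ := h
  exact ⟨t, s', he, ht, hq, he.frame⟩

theorem Runs.seq (hc : Runs W c s T₁ Q) (hd : ∀ s', Q s' → Frame c s s' → Runs W d s' T₂ Q') :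
    Runs W (.seq c d) s (T₁ + T₂) Q' := by
  obtain ⟨t, s', he, ht, hq⟩ := hc
  obtain ⟨t', s'', he', ht', hq'⟩ := hd s' hq he.frame
  exact ⟨t + t', s'', he.seq he', by omega, hq'⟩

theorem Runs.ite {b : BExp} (hc : b.Holds s → Runs W c s T Q)
    (hd : ¬ b.Holds s → Runs W d s T Q) : Runs W (.ite b c d) s (b.cost + 1 + T) Q := by
  by_cases hb : b.Holds s
  · obtain ⟨t, s', he, ht, hq⟩ := hc hb
    exact ⟨_, s', .ite_true hb he, by omega, hq⟩
  · obtain ⟨t, s', he, ht, hq⟩ := hd hb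
    exact ⟨_, s', .ite_false hb he, by omega, hq⟩

/-- The rule for a loop whose number of rounds `n` is known: `I k` holds after `k` rounds. -/
theorem Runs.loop {b : BExp} (n D : ℕ) (I : ℕ → Mem → Prop) (h0 : I 0 s)
    (hb : ∀ k s, k < n → I k s → b.Holds s)
    (hstep : ∀ k s, k < n → I k s → Runs W c s D (I (k + 1)))
    (hend : ∀ s, I n s → ¬ b.Holds s) :
    Runs W (.loop b c) s (n * (b.cost + 1 + D) + (b.cost + 1)) (I n) := by
  suffices H : ∀ m k s, k + m = n → I k s →
      Runs W (.loop b c) s (m * (b.cost + 1 + D) + (b.cost + 1)) (I n) from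
    H n 0 s (by simp) h0
  intro m
  induction m with
  | zero =>
    intro k s hk hI
    obtain rfl : k = n := by simpa using hk
    exact ⟨_, s, .loop_false (hend s hI), by simp, hI⟩
  | succ m ih =>
    intro k s hk hI
    obtain ⟨t, s', he, ht, hq⟩ := hstep k s (by omega) hI
    obtain ⟨t', s'', he', ht', hq'⟩ := ih (k + 1) s' (by omega) hq
    refine ⟨_, s'', .loop_true (hb k s (by omega) hI) he he', ?_, hq'⟩
    rw [Nat.add_mul]
    omega

end Rules

/-- The most steps that a program without loops can take. -/
def Cmd.maxCost : Cmd → ℕ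
  | .skip => 1
  | .setNat _ i e => i.cost + e.cost + 1
  | .setReal _ i e => i.cost + e.cost + 1
  | .seq c d => c.maxCost + d.maxCost
  | .ite b c d => b.cost + 1 + max c.maxCost d.maxCost
  | .loop _ _ => 0

open Classical in
/-- The memory in which a program without loops halts. -/
noncomputable def Cmd.post : Cmd → Mem → Mem
  | .skip, s => s
  | .setNat a i e, s => s.setNat a (i.eval s) (e.eval s)
  | .setReal a i e, s => s.setReal a (i.eval s) (e.eval s)
  | .seq c d, s => d.post (c.post s)
  | .ite b c d, s => if b.Holds s then c.post s else d.post s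
  | .loop _ _, s => s

theorem Cmd.post_ite_pos {b : BExp} {c d : Cmd} {s : Mem} (h : b.Holds s) :
    (Cmd.ite b c d).post s = c.post s :=
  if_pos h

theorem Cmd.post_ite_neg {b : BExp} {c d : Cmd} {s : Mem} (h : ¬ b.Holds s) :
    (Cmd.ite b c d).post s = d.post s :=
  if_neg h

/-- The program has no loops, and run from `s` it stores no word above `W`. -/
def Cmd.Safe (W : ℕ) : Cmd → Mem → Prop
  | .skip, _ => True
  | .setNat _ _ e, s => e.eval s ≤ W
  | .setReal _ _ _, _ => True
  | .seq c d, s => c.Safe W s ∧ d.Safe W (c.post s)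
  | .ite b c d, s => (b.Holds s → c.Safe W s) ∧ (¬ b.Holds s → d.Safe W s)
  | .loop _ _, _ => False

theorem Cmd.Safe.runs {W : ℕ} {c : Cmd} {s : Mem} (h : c.Safe W s) :
    Runs W c s c.maxCost (fun s' => s' = c.post s) := by
  induction c generalizing s with
  | skip => exact ⟨_, _, .skip s, le_rfl, rfl⟩
  | setNat a i e => exact ⟨_, _, .setNat s a i e h, le_rfl, rfl⟩
  | setReal a i e => exact ⟨_, _, .setReal s a i e, le_rfl, rfl⟩
  | seq c d ihc ihd =>
    refine (ihc h.1).seq ?_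
    rintro _ rfl -
    exact ihd h.2
  | ite b c d ihc ihd =>
    refine Runs.ite (fun hb => ?_) (fun hb => ?_)
    · refine (ihc (h.1 hb)).mono (le_max_left _ _) ?_
      rintro _ rfl
      simp [Cmd.post, hb]
    · refine (ihd (h.2 hb)).mono (le_max_right _ _) ?_
      rintro _ rfl
      simp [Cmd.post, hb]
  | loop b c => exact h.elim

/-- Loop-free code, by symbolic evaluation. -/
theorem Runs.straight {W T : ℕ} {c : Cmd} {s : Mem} {Q : Mem → Prop} (h : c.Safe W s)
    (hT : c.maxCost ≤ T) (hQ : Q (c.post s)) : Runs W c s T Q :=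
  h.runs.mono hT (by rintro _ rfl; exact hQ)

/-! ### Trees stored in arrays -/

/-- The values `T` at the nodes of a complete binary tree (root `1`, children `2 * i` and
`2 * i + 1`, leaves `M, …, 2 * M - 1`) are computed bottom-up by `op`. -/
def IsTree {α : Type*} (op : α → α → α) (M : ℕ) (T : ℕ → α) : Prop :=
  ∀ i, 1 ≤ i → i < M → T i = op (T (2 * i)) (T (2 * i + 1))

/-- The program that runs `body` at all proper ancestors of the node in word array `8`. -/
def climb (body : Cmd) : Cmd :=
  .loop (.nlt (.lit 1) (.get 8 (.lit 0)))
    (.seq (.setNat 8 (.lit 0) (.div (.get 8 (.lit 0)) (.lit 2))) body)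

/-- After a change of the leaf `h`, recomputing its ancestors restores the tree. -/
theorem Runs.climb {α : Type*} {op : α → α → α} {tr : Mem → ℕ → α} {inv : Mem → Prop}
    {W D K M : ℕ} {body : Cmd} (hM : M = 2 ^ K) (hMW : M ≤ W)
    (htr : ∀ s v, tr (s.setNat 8 0 v) = tr s) (hinv : ∀ s v, inv s → inv (s.setNat 8 0 v))
    (hbody : ∀ s j, inv s → 1 ≤ j → j < M → s.nat 8 0 = j → Runs W body s D (fun s' =>
      inv s' ∧ s'.nat 8 0 = j ∧
        tr s' = Function.update (tr s) j (op (tr s (2 * j)) (tr s (2 * j + 1)))))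
    {s : Mem} (hs : inv s) {h : ℕ} (hh : s.nat 8 0 = h) (h1 : M ≤ h) (h2 : h < 2 * M)
    {T₀ : ℕ → α} (hT : IsTree op M T₀) {x : α} (hsT : tr s = Function.update T₀ h x) :
    Runs W (climb body) s (K * (D + 11) + 5) (fun s' => inv s' ∧ IsTree op M (tr s') ∧
      ∀ i, M ≤ i → tr s' i = Function.update T₀ h x i) := by
  have hpos : 0 < M := by rw [hM]; positivity
  have hdiv : ∀ k, k ≤ K → 2 ^ (K - k) ≤ h / 2 ^ k ∧ h / 2 ^ k < 2 * 2 ^ (K - k) := by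
    intro k hk
    have e : 2 ^ (K - k) * 2 ^ k = M := by rw [hM, ← pow_add]; congr 1; omega
    constructor
    · rw [Nat.le_div_iff_mul_le (by positivity)]; omega
    · rw [Nat.div_lt_iff_lt_mul (by positivity), mul_assoc, e]; omega
  refine (Runs.loop (W := W) (s := s) K (D + 6) (fun k s' => inv s' ∧ s'.nat 8 0 = h / 2 ^ k ∧
    (∀ i, M ≤ i → tr s' i = Function.update T₀ h x i) ∧
    ∀ i, 1 ≤ i → i < M → (∀ d, i ≠ h / 2 ^ (k + d + 1)) →
      tr s' i = op (tr s' (2 * i)) (tr s' (2 * i + 1))) ?_ ?_ ?_ ?_).mono ?_ ?_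
  · refine ⟨hs, by simpa using hh, by simp [hsT], fun i hi hi' hd => ?_⟩
    have hd0 := hd 0
    simp only [Nat.add_zero, Nat.zero_add, pow_one] at hd0
    rw [hsT, Function.update_of_ne (by omega), Function.update_of_ne (by omega),
      Function.update_of_ne (by omega)]
    exact hT i hi hi'
  · rintro k s' hk ⟨-, h8, -⟩
    have := (hdiv k hk.le).1
    have h2 : 2 ^ 1 ≤ 2 ^ (K - k) := Nat.pow_le_pow_right (by norm_num) (by omega)
    simp only [BExp.Holds, NExp.eval, h8]
    omega
  · rintro k s' hk ⟨hi, h8, hleaf, hok⟩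
    have hd := hdiv (k + 1) hk
    have e : h / 2 ^ k / 2 = h / 2 ^ (k + 1) := by rw [Nat.div_div_eq_div_mul, pow_succ]
    have hlt : 2 * 2 ^ (K - (k + 1)) ≤ M := by
      rw [hM, ← pow_succ']
      exact Nat.pow_le_pow_right (by norm_num) (by omega)
    have hge : 1 ≤ 2 ^ (K - (k + 1)) := Nat.one_le_two_pow
    refine (Runs.seq (T₁ := 6) (T₂ := D) (Q := fun s'' => s'' = s'.setNat 8 0 (h / 2 ^ (k + 1)))
      (Runs.straight ?_ le_rfl ?_) ?_).mono (by omega) (fun _ => id)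
    · simp only [Cmd.Safe, NExp.eval, h8, e]; omega
    · simp only [Cmd.post, NExp.eval, h8, e]
    · rintro _ rfl -
      refine (hbody _ (h / 2 ^ (k + 1)) (hinv _ _ hi) (by omega) (by omega)
        (by simp)).mono le_rfl ?_
      rintro s'' ⟨hi', h8', ht'⟩
      rw [htr] at ht'
      refine ⟨hi', h8', fun i hi => ?_, fun i h1i hiM hne => ?_⟩
      · rw [ht', Function.update_of_ne (by omega), hleaf i hi]
      · rw [ht']
        have hn0 := hne 0
        rw [show k + 1 + 0 + 1 = (k + 1) + 1 from rfl, pow_succ, ← Nat.div_div_eq_div_mul] at hn0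
        rw [Function.update_of_ne (a := 2 * i) (by omega),
          Function.update_of_ne (a := 2 * i + 1) (by omega)]
        by_cases hij : i = h / 2 ^ (k + 1)
        · subst hij; simp
        · rw [Function.update_of_ne hij]
          refine hok i h1i hiM fun d => ?_
          rcases d with _ | d
          · exact hij
          · have := hne d
            rwa [show k + 1 + d + 1 = k + (d + 1) + 1 by ring] at this
  · rintro s' ⟨-, h8, -⟩
    have := (hdiv K le_rfl).2
    simp only [Nat.sub_self, pow_zero, mul_one] at this
    simp only [BExp.Holds, NExp.eval, h8]
    omega
  · simp only [BExp.cost, NExp.cost]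
    exact Nat.add_le_add (Nat.mul_le_mul_left _ (by omega)) le_rfl
  · rintro s' ⟨hi, h8, hleaf, hok⟩
    refine ⟨hi, fun i hi1 hiM => hok i hi1 hiM fun d => ?_, hleaf⟩
    have := (hdiv K le_rfl).2
    have h0 : h / 2 ^ (K + d + 1) = 0 := by
      rw [show K + d + 1 = K + (d + 1) from rfl, pow_add, ← Nat.div_div_eq_div_mul]
      apply Nat.div_eq_of_lt
      have : 2 ^ 1 ≤ 2 ^ (d + 1) := Nat.pow_le_pow_right (by norm_num) (by omega)
      simp only [Nat.sub_self, pow_zero] at *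
      omega
    omega

/-- Induction along a tree: `P a e n` says that `n` is a correct value for the leaves in
`[a, e)`. -/
theorem IsTree.induction {α : Type*} {op : α → α → α} {M K : ℕ} (hM : M = 2 ^ K) {T : ℕ → α}
    (hT : IsTree op M T) {P : ℕ → ℕ → α → Prop}
    (leaf : ∀ k, M ≤ k → k < 2 * M → P k (k + 1) (T k))
    (append : ∀ a m e l r, a ≤ m → m ≤ e → P a m l → P m e r → P a e (op l r)) :
    P M (2 * M) (T 1) := by
  suffices H : ∀ h ≤ K, ∀ i, 2 ^ (K - h) ≤ i → i < 2 * 2 ^ (K - h) →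
      P (i * 2 ^ h) ((i + 1) * 2 ^ h) (T i) by
    have := H K le_rfl 1 (by simp) (by simp)
    rwa [← hM, one_mul] at this
  intro h
  induction h with
  | zero =>
    intro _ i h1 h2
    simp only [Nat.sub_zero, ← hM] at h1 h2
    rw [pow_zero, mul_one, mul_one]
    exact leaf i h1 h2
  | succ h ih =>
    intro hK i h1 h2
    have e1 : 2 ^ (K - h) = 2 * 2 ^ (K - (h + 1)) := by
      rw [← pow_succ']; congr 1; omega
    have hiM : i < M := by
      have : 2 * 2 ^ (K - (h + 1)) ≤ M := by
        rw [← e1, hM]; exact Nat.pow_le_pow_right (by norm_num) (by omega)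
      omega
    have h1' : 1 ≤ 2 ^ (K - (h + 1)) := Nat.one_le_two_pow
    rw [hT i (by omega) hiM]
    have ea : i * 2 ^ (h + 1) = 2 * i * 2 ^ h := by ring
    have eb : (i + 1) * 2 ^ (h + 1) = (2 * i + 1 + 1) * 2 ^ h := by ring
    rw [ea, eb]
    exact append _ _ _ _ _ (Nat.mul_le_mul_right _ (by omega)) (Nat.mul_le_mul_right _ (by omega))
      (ih (by omega) (2 * i) (by omega) (by omega))
      (ih (by omega) (2 * i + 1) (by omega) (by omega))

/-! ### The value of a strip in a fixed direction -/

/-- The number of blue points in the closed strip `c₁ ≤ w ≤ c₂` minus the number of red points in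
the open strip `c₁ < w < c₂`. The points are numbered by `i < N`; the colour `c i` of a point is
`0` (red) or `1` (blue), and `w i` is its position across the strip. -/
noncomputable def stripVal (N : ℕ) (c w : ℕ → ℝ) (c₁ c₂ : ℝ) : ℝ :=
  ∑ i ∈ range N, ((if c₁ ≤ w i ∧ w i ≤ c₂ then c i else 0) -
    (if c₁ < w i ∧ w i < c₂ then 1 - c i else 0))

section StripVal

variable {N : ℕ} {c w w' : ℕ → ℝ}

/-- It suffices to keep the blue points in the closed strip, and not to add red points to the open
strip. -/
theorem stripVal_le_stripVal (hc : ∀ i, 0 ≤ c i ∧ c i ≤ 1) {c₁ c₂ c₁' c₂' : ℝ}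
    (h₁ : ∀ i < N, c₁ ≤ w i → w i ≤ c₂ → c₁' ≤ w' i ∧ w' i ≤ c₂')
    (h₂ : ∀ i < N, c₁' < w' i → w' i < c₂' → c₁ < w i ∧ w i < c₂) :
    stripVal N c w c₁ c₂ ≤ stripVal N c w' c₁' c₂' := by
  refine sum_le_sum fun i hi => ?_
  rw [mem_range] at hi
  have h0 := (hc i).1
  have h1 := (hc i).2
  refine sub_le_sub ?_ ?_
  · by_cases h : c₁ ≤ w i ∧ w i ≤ c₂
    · rw [if_pos h, if_pos (h₁ i hi h.1 h.2)]
    · rw [if_neg h]; split_ifs <;> linarith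
  · by_cases h : c₁' < w' i ∧ w' i < c₂'
    · rw [if_pos h, if_pos (h₂ i hi h.1 h.2)]
    · rw [if_neg h]; split_ifs <;> linarith

theorem stripVal_congr_order (h : ∀ i < N, ∀ j < N, w i ≤ w j ↔ w' i ≤ w' j) {p q : ℕ}
    (hp : p < N) (hq : q < N) :
    stripVal N c w (w p) (w q) = stripVal N c w' (w' p) (w' q) := by
  refine sum_congr rfl fun i hi => ?_
  rw [mem_range] at hi
  simp only [h p hp i hi, h i hi q hq, ← not_le, h q hq i hi, h i hi p hp]

theorem stripVal_neg (c₁ c₂ : ℝ) :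
    stripVal N c (fun i => - w i) (-c₂) (-c₁) = stripVal N c w c₁ c₂ := by
  simp only [stripVal, neg_le_neg_iff, neg_lt_neg_iff]
  simp only [and_comm]

theorem stripVal_one_zero : stripVal N c w 1 0 = 0 := by
  refine sum_eq_zero fun i _ => ?_
  rw [if_neg (by rintro ⟨h, h'⟩; linarith), if_neg (by rintro ⟨h, h'⟩; linarith), sub_zero]

/-- If the points do not all lie on one line of the given direction, then an optimal strip of this
direction has a point on each of its two boundary lines. -/
theorem exists_stripVal_le_of_pair (hc : ∀ i, 0 ≤ c i ∧ c i ≤ 1)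
    (hw : ∃ i < N, ∃ j < N, w i < w j) (c₁ c₂ : ℝ) :
    ∃ p < N, ∃ q < N, w p < w q ∧ stripVal N c w c₁ c₂ ≤ stripVal N c w (w p) (w q) := by
  set T := (range N).filter (fun i => c₁ ≤ w i ∧ w i ≤ c₂) with hT
  have mT : ∀ i, i ∈ T ↔ i < N ∧ c₁ ≤ w i ∧ w i ≤ c₂ := by simp [hT]
  by_cases h : ∃ i ∈ T, ∃ j ∈ T, w i < w j
  · obtain ⟨i, hi, j, hj, hij⟩ := h
    obtain ⟨p, hp, hp'⟩ := T.exists_min_image w ⟨i, hi⟩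
    obtain ⟨q, hq, hq'⟩ := T.exists_max_image w ⟨i, hi⟩
    refine ⟨p, ((mT p).1 hp).1, q, ((mT q).1 hq).1,
      (hp' i hi).trans_lt (hij.trans_le (hq' j hj)), stripVal_le_stripVal hc ?_ ?_⟩
    · intro k hk h1 h2
      exact ⟨hp' k ((mT k).2 ⟨hk, h1, h2⟩), hq' k ((mT k).2 ⟨hk, h1, h2⟩)⟩
    · intro k hk h1 h2
      exact ⟨((mT p).1 hp).2.1.trans_lt h1, h2.trans_le ((mT q).1 hq).2.2⟩
  · push Not at h
    -- All points in the closed strip lie on one line, through `a` say; the strip between this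
    -- line and a neighbouring one has no point in its interior.
    obtain ⟨i₀, hi₀, j₀, hj₀, hij₀⟩ := hw
    obtain ⟨a, ha, haT⟩ : ∃ a < N, ∀ i ∈ T, w i = w a := by
      rcases T.eq_empty_or_nonempty with h0 | ⟨a, ha⟩
      · exact ⟨i₀, hi₀, by simp [h0]⟩
      · exact ⟨a, ((mT a).1 ha).1, fun i hi => le_antisymm (h a ha i hi) (h i hi a ha)⟩
    by_cases hr : ∃ r < N, w a < w r
    · obtain ⟨r, hr, har⟩ := hr
      obtain ⟨q, hq, hq'⟩ := ((range N).filter (fun i => w a < w i)).exists_min_image w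
        ⟨r, by simp [hr, har]⟩
      simp only [mem_filter, mem_range] at hq hq'
      refine ⟨a, ha, q, hq.1, hq.2, stripVal_le_stripVal hc ?_ ?_⟩
      · intro k hk h1 h2
        have := haT k ((mT k).2 ⟨hk, h1, h2⟩)
        exact ⟨this.ge, this.le.trans hq.2.le⟩
      · intro k hk h1 h2
        exact absurd (hq' k ⟨hk, h1⟩) (not_le.2 h2)
    · push Not at hr
      have har : w i₀ < w a := hij₀.trans_le (hr j₀ hj₀)
      obtain ⟨q, hq, hq'⟩ := ((range N).filter (fun i => w i < w a)).exists_max_image w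
        ⟨i₀, by simp [hi₀, har]⟩
      simp only [mem_filter, mem_range] at hq hq'
      refine ⟨q, hq.1, a, ha, hq.2, stripVal_le_stripVal hc ?_ ?_⟩
      · intro k hk h1 h2
        have := haT k ((mT k).2 ⟨hk, h1, h2⟩)
        exact ⟨hq.2.le.trans this.ge, this.le⟩
      · intro k hk h1 h2
        exact absurd (hq' k ⟨hk, h2⟩) (not_le.2 h1)

/-- Letting points with different positions `w` come to the same position `w'` does not decrease
the maximal value of a strip, provided that no two points change their order. -/
theorem exists_stripVal_le_of_monotone (hc : ∀ i, 0 ≤ c i ∧ c i ≤ 1)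
    (h : ∀ i < N, ∀ j < N, w i ≤ w j → w' i ≤ w' j) (c₁ c₂ : ℝ) :
    ∃ c₁' c₂', stripVal N c w c₁ c₂ ≤ stripVal N c w' c₁' c₂' := by
  set T := (range N).filter (fun i => c₁ ≤ w i ∧ w i ≤ c₂) with hT
  have mT : ∀ i, i ∈ T ↔ i < N ∧ c₁ ≤ w i ∧ w i ≤ c₂ := by simp [hT]
  rcases T.eq_empty_or_nonempty with h0 | h0
  · refine ⟨1, 0, stripVal_le_stripVal hc ?_ ?_⟩
    · intro k hk h1 h2
      have : k ∈ T := (mT k).2 ⟨hk, h1, h2⟩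
      simp [h0] at this
    · intro k hk h1 h2; linarith
  · obtain ⟨p, hp, hp'⟩ := T.exists_min_image w' h0
    obtain ⟨q, hq, hq'⟩ := T.exists_max_image w' h0
    have hpT := (mT p).1 hp
    have hqT := (mT q).1 hq
    refine ⟨w' p, w' q, stripVal_le_stripVal hc ?_ ?_⟩
    · intro k hk h1 h2
      exact ⟨hp' k ((mT k).2 ⟨hk, h1, h2⟩), hq' k ((mT k).2 ⟨hk, h1, h2⟩)⟩
    · intro k hk h1 h2
      exact ⟨hpT.2.1.trans_lt (lt_of_not_ge fun hle => absurd (h k hk p hpT.1 hle) (not_le.2 h1)),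
        (lt_of_not_ge fun hle => absurd (h q hqT.1 k hk hle) (not_le.2 h2)).trans_le hqT.2.2⟩

end StripVal

/-! ### Critical directions -/

/-- The intercept of the line of slope `m` through the point with number `i`. -/
def lineHeight (x y : ℕ → ℝ) (m : ℝ) (i : ℕ) : ℝ := y i - m * x i

/-- The slope of the line through the points with numbers `i` and `j`. -/
noncomputable def lineSlope (x y : ℕ → ℝ) (i j : ℕ) : ℝ := (y j - y i) / (x j - x i)

section Slopes

variable {N : ℕ} {c x y : ℕ → ℝ}

theorem lineHeight_le_iff {m : ℝ} {i j : ℕ} (h : x i < x j) :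
    lineHeight x y m i ≤ lineHeight x y m j ↔ m ≤ lineSlope x y i j := by
  rw [lineHeight, lineHeight, lineSlope, le_div_iff₀ (sub_pos.2 h)]
  constructor <;> intro h <;> linarith

theorem lineHeight_ge_iff {m : ℝ} {i j : ℕ} (h : x i < x j) :
    lineHeight x y m j ≤ lineHeight x y m i ↔ lineSlope x y i j ≤ m := by
  rw [lineHeight, lineHeight, lineSlope, div_le_iff₀ (sub_pos.2 h)]
  constructor <;> intro h <;> linarith

/-- Every strip can be rotated until the lines in its direction through two of the points
coincide, without decrease of the maximal value of a strip in its direction. -/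
theorem exists_stripVal_le_of_slope (hc : ∀ i, 0 ≤ c i ∧ c i ≤ 1)
    (hxy : ∀ i < N, ∀ j < N, x i = x j → y i = y j) (hx : ∃ i < N, ∃ j < N, x i < x j)
    {a b : ℝ} (hab : a ≠ 0 ∨ b ≠ 0) (c₁ c₂ : ℝ) :
    ∃ i < N, ∃ j < N, x i < x j ∧ ∃ c₁' c₂', stripVal N c (fun k => a * x k + b * y k) c₁ c₂ ≤
      stripVal N c (lineHeight x y (lineSlope x y i j)) c₁' c₂' := by
  wlog hpos : 0 < b ∨ (b = 0 ∧ 0 < a) generalizing a b c₁ c₂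
  · obtain ⟨i, hi, j, hj, hij, d₁, d₂, h⟩ := this (a := -a) (b := -b) (by simpa using hab)
      (-c₂) (-c₁) (by
        push Not at hpos
        rcases hpos.1.lt_or_eq with hb | hb
        · left; linarith
        · right
          refine ⟨by simp [hb], ?_⟩
          have := hpos.2 hb
          rcases hab with ha | hb'
          · have := lt_of_le_of_ne this ha; linarith
          · exact absurd hb hb')
    refine ⟨i, hi, j, hj, hij, d₁, d₂, le_trans (le_of_eq ?_) h⟩
    rw [← stripVal_neg]
    congr 1; ext k; ring
  obtain ⟨i₀, hi₀, j₀, hj₀, hij₀⟩ := hx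
  set E := ((range N) ×ˢ (range N)).filter (fun e : ℕ × ℕ => x e.1 < x e.2) with hE
  set f : ℕ × ℕ → ℝ := fun e => lineSlope x y e.1 e.2 with hf
  have mE : ∀ i j, (i, j) ∈ E ↔ (i < N ∧ j < N) ∧ x i < x j := by simp [hE]
  have he₀ : (i₀, j₀) ∈ E := (mE _ _).2 ⟨⟨hi₀, hj₀⟩, hij₀⟩
  have key : ∀ e ∈ E, (∀ i < N, ∀ j < N, a * x i + b * y i ≤ a * x j + b * y j →
      lineHeight x y (f e) i ≤ lineHeight x y (f e) j) →
      ∃ i < N, ∃ j < N, x i < x j ∧ ∃ c₁' c₂', stripVal N c (fun k => a * x k + b * y k) c₁ c₂ ≤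
      stripVal N c (lineHeight x y (lineSlope x y i j)) c₁' c₂' := by
    rintro ⟨i, j⟩ he h
    have he' := (mE _ _).1 he
    exact ⟨i, he'.1.1, j, he'.1.2, he'.2, exists_stripVal_le_of_monotone hc h c₁ c₂⟩
  rcases hpos with hb | ⟨rfl, ha⟩
  · have hw : ∀ i j, a * x i + b * y i ≤ a * x j + b * y j ↔
        lineHeight x y (-a / b) i ≤ lineHeight x y (-a / b) j := by
      intro i j
      have e : ∀ k, a * x k + b * y k = b * lineHeight x y (-a / b) k := by
        intro k; rw [lineHeight]; field_simp; ring
      rw [e, e, mul_le_mul_iff_right₀ hb]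
    set m₀ := -a / b with hm₀
    have same : ∀ i < N, ∀ j < N, ∀ m, x i = x j → lineHeight x y m i ≤ lineHeight x y m j := by
      intro i hi j hj m h
      rw [lineHeight, lineHeight, h, hxy i hi j hj h]
    -- Rotate counterclockwise to the next critical slope, or, if there is none, clockwise.
    by_cases hex : ∃ e ∈ E, m₀ ≤ f e
    · obtain ⟨e, he, hme⟩ := hex
      obtain ⟨g, hg, hg'⟩ := (E.filter (fun e => m₀ ≤ f e)).exists_min_image f
        ⟨e, by simp [he, hme]⟩
      simp only [mem_filter] at hg hg'
      refine key g hg.1 fun i hi j hj hij => ?_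
      rw [hw] at hij
      rcases lt_trichotomy (x i) (x j) with h | h | h
      · rw [lineHeight_le_iff h] at hij ⊢
        exact hg' (i, j) ⟨(mE _ _).2 ⟨⟨hi, hj⟩, h⟩, hij⟩
      · exact same i hi j hj _ h
      · rw [lineHeight_ge_iff h] at hij ⊢
        exact hij.trans hg.2
    · push Not at hex
      obtain ⟨g, hg, hg'⟩ := E.exists_max_image f ⟨_, he₀⟩
      refine key g hg fun i hi j hj hij => ?_
      rw [hw] at hij
      rcases lt_trichotomy (x i) (x j) with h | h | h
      · rw [lineHeight_le_iff h] at hij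
        exact absurd hij (not_le.2 (hex (i, j) ((mE _ _).2 ⟨⟨hi, hj⟩, h⟩)))
      · exact same i hi j hj _ h
      · rw [lineHeight_ge_iff h]
        exact hg' (j, i) ((mE _ _).2 ⟨⟨hj, hi⟩, h⟩)
  · obtain ⟨g, hg, hg'⟩ := E.exists_min_image f ⟨_, he₀⟩
    refine key g hg fun i hi j hj hij => ?_
    simp only [zero_mul, add_zero] at hij
    rcases (le_of_mul_le_mul_left hij ha).lt_or_eq with h | h
    · rw [lineHeight_le_iff h]
      exact hg' (i, j) ((mE _ _).2 ⟨⟨hi, hj⟩, h⟩)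
    · rw [lineHeight, lineHeight, h, hxy i hi j hj h]

end Slopes

/-! ### Ranks and the maximum subarray tree -/

/-- The rank of the point with number `p`: the number of points before it. -/
noncomputable def rank (N : ℕ) (w : ℕ → ℝ) (p : ℕ) : ℕ := #{q ∈ range N | w q < w p}

theorem rank_le_rank_iff {N : ℕ} {w : ℕ → ℝ} {p q : ℕ} (hq : q < N) :
    rank N w p ≤ rank N w q ↔ w p ≤ w q := by
  constructor
  · intro h
    by_contra! hlt
    refine absurd h (not_le.2 (card_lt_card ?_))
    refine ⟨fun i hi => ?_, fun hsub => ?_⟩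
    · simp only [mem_filter] at hi ⊢
      exact ⟨hi.1, hi.2.trans hlt⟩
    · have : q ∈ ({i ∈ range N | w i < w q} : Finset ℕ) := hsub (by simp [hq, hlt])
      simp at this
  · intro h
    refine card_le_card fun i hi => ?_
    simp only [mem_filter] at hi ⊢
    exact ⟨hi.1, hi.2.trans_le h⟩

theorem rank_lt {N : ℕ} {w : ℕ → ℝ} {p : ℕ} (hp : p < N) : rank N w p < N := by
  refine (card_lt_card (t := range N) ⟨filter_subset _ _, fun h => ?_⟩).trans_eq (card_range N)
  have := h (mem_range.2 hp)
  simp at this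

/-- What a node of the tree knows about the sequence of points below it, ordered by position and
grouped by ties: the total weight (blue minus red); the maximal weight of an initial part, in
which the red points of the last group do not count; likewise for final parts; and the
maximal value of a strip that begins and ends at different groups, or `0`. -/
abbrev Summary := ℝ × ℝ × ℝ × ℝ

/-- The summary of the concatenation of two sequences. -/
noncomputable def Summary.append (l r : Summary) : Summary :=
  (l.1 + r.1, max l.2.1 (l.1 + r.2.1), max r.2.2.1 (l.2.2.1 + r.1),
    max (max l.2.2.2 r.2.2.2) (l.2.2.1 + r.2.1))

/-- `n` summarizes the groups with numbers in `[a, e)`. Group `k` has weight `A (k + 1) - A k` and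
contains `b k` blue points. The maxima are described by their upper bounds. -/
structure Summarizes (A b : ℕ → ℝ) (a e : ℕ) (n : Summary) : Prop where
  sum : n.1 = A e - A a
  pre : ∀ z, n.2.1 ≤ z ↔ ∀ k, a ≤ k → k < e → A k - A a + b k ≤ z
  suf : ∀ z, n.2.2.1 ≤ z ↔ ∀ k, a ≤ k → k < e → A e - A (k + 1) + b k ≤ z
  best : ∀ z, n.2.2.2 ≤ z ↔
    0 ≤ z ∧ ∀ k l, a ≤ k → k < l → l < e → A l + b l - A (k + 1) + b k ≤ z

theorem Summarizes.append {A b : ℕ → ℝ} {a m e : ℕ} {l r : Summary} (ham : a ≤ m) (hme : m ≤ e)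
    (hl : Summarizes A b a m l) (hr : Summarizes A b m e r) :
    Summarizes A b a e (l.append r) := by
  refine ⟨?_, fun z => ?_, fun z => ?_, fun z => ?_⟩
  · simp only [Summary.append, hl.sum, hr.sum]; ring
  · simp only [Summary.append, max_le_iff, ← le_sub_iff_add_le', hl.pre, hr.pre, hl.sum]
    constructor
    · rintro ⟨h1, h2⟩ k hak hke
      rcases lt_or_ge k m with h | h
      · exact h1 k hak h
      · have := h2 k h hke; linarith
    · intro h
      refine ⟨fun k h1 h2 => h k h1 (by omega), fun k h1 h2 => ?_⟩
      have := h k (by omega) h2; linarith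
  · simp only [Summary.append, max_le_iff, ← le_sub_iff_add_le, hl.suf, hr.suf, hr.sum]
    constructor
    · rintro ⟨h1, h2⟩ k hak hke
      rcases lt_or_ge k m with h | h
      · have := h2 k hak h; linarith
      · exact h1 k h hke
    · intro h
      refine ⟨fun k h1 h2 => h k (by omega) h2, fun k h1 h2 => ?_⟩
      have := h k h1 (by omega); linarith
  · have hx : l.2.2.1 + r.2.1 ≤ z ↔ ∀ k k', a ≤ k → k < m → m ≤ k' → k' < e →
        A k' + b k' - A (k + 1) + b k ≤ z := by
      rw [← le_sub_iff_add_le, hl.suf]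
      constructor
      · intro h k k' h1 h2 h3 h4
        have hr' : r.2.1 ≤ z - (A m - A (k + 1) + b k) := by
          have := h k h1 h2; linarith
        have := (hr.pre _).1 hr' k' h3 h4
        linarith
      · intro h k h1 h2
        have hr' : r.2.1 ≤ z - (A m - A (k + 1) + b k) := by
          rw [hr.pre]
          intro k' h3 h4
          have := h k k' h1 h2 h3 h4
          linarith
        linarith
    simp only [Summary.append, max_le_iff, hl.best, hr.best, hx]
    constructor
    · rintro ⟨⟨⟨h0, h1⟩, -, h2⟩, h3⟩
      refine ⟨h0, fun k k' hk hkk hk' => ?_⟩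
      rcases lt_or_ge k' m with h | h
      · exact h1 k k' hk hkk h
      · rcases lt_or_ge k m with h' | h'
        · exact h3 k k' hk h' h hk'
        · exact h2 k k' h' hkk hk'
    · rintro ⟨h0, h⟩
      exact ⟨⟨⟨h0, fun k k' h1 h2 h3 => h k k' h1 h2 (by omega)⟩, h0,
        fun k k' h1 h2 h3 => h k k' (by omega) h2 h3⟩,
        fun k k' h1 h2 h3 h4 => h k k' h1 (by omega) h4⟩

/-- The root of a tree, where the leaf with number `M + k` describes the group `k`,
summarizes all groups. -/
theorem IsTree.summarizes_root {M K : ℕ} (hM : M = 2 ^ K) {T : ℕ → Summary}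
    (hT : IsTree Summary.append M T) {A b : ℕ → ℝ}
    (hA : ∀ k, M ≤ k → k < 2 * M → T k = (A (k + 1) - A k, b k, b k, 0)) :
    Summarizes A b M (2 * M) (T 1) := by
  refine hT.induction hM (P := Summarizes A b) (fun i h1 h2 => ?_)
    (fun a m e l r ham hme hl hr => hl.append ham hme hr)
  rw [hA i h1 h2]
  refine ⟨rfl, fun z => ⟨fun h k hk hk' => ?_, fun h => ?_⟩,
    fun z => ⟨fun h k hk hk' => ?_, fun h => ?_⟩,
    fun z => ⟨fun h => ⟨h, fun k l hk hkl hl => ?_⟩, fun h => h.1⟩⟩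
  · obtain rfl : k = i := by omega
    simpa using h
  · simpa using h i le_rfl (by omega)
  · obtain rfl : k = i := by omega
    simpa using h
  · simpa using h i le_rfl (by omega)
  · omega

/-- The leaf for the points that lie in slot `k`. -/
noncomputable def slotLeaf (N : ℕ) (c : ℕ → ℝ) (slot : ℕ → ℕ) (k : ℕ) : Summary :=
  (∑ p ∈ range N, if slot p = k then 2 * c p - 1 else 0,
    ∑ p ∈ range N, if slot p = k then c p else 0,
    ∑ p ∈ range N, if slot p = k then c p else 0, 0)

/-- The last entry of the root is the maximum of `0` and the values of strips that begin and end at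
different slots. -/
theorem IsTree.root_le_iff {M K N : ℕ} (hM : M = 2 ^ K) {T : ℕ → Summary} {c : ℕ → ℝ}
    {slot : ℕ → ℕ} (hT : IsTree Summary.append M T)
    (hleaf : ∀ k < M, T (M + k) = slotLeaf N c slot k) (z : ℝ) :
    (T 1).2.2.2 ≤ z ↔ 0 ≤ z ∧ ∀ k l : ℕ, k < l → l < M →
      stripVal N c (fun p => (slot p : ℝ)) k l ≤ z := by
  have hS := IsTree.summarizes_root hM hT
    (A := fun j => ∑ p ∈ range N, if slot p < j - M then 2 * c p - 1 else 0)
    (b := fun j => ∑ p ∈ range N, if slot p = j - M then c p else 0) (by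
      intro k h1 h2
      obtain ⟨k, rfl⟩ := Nat.exists_eq_add_of_le h1
      rw [hleaf k (by omega), slotLeaf, ← sum_sub_distrib]
      simp only [Nat.add_sub_cancel_left, show M + k + 1 - M = k + 1 by omega]
      congr 1
      refine sum_congr rfl fun p _ => ?_
      rcases lt_trichotomy (slot p) k with h | h | h
      · simp [h, h.ne, h.trans (Nat.lt_succ_self k)]
      · simp [h]
      · rw [if_neg (by omega), if_neg (by omega), if_neg (by omega), sub_zero])
  rw [hS.best]
  have hval : ∀ k l : ℕ, k < l → stripVal N c (fun p => (slot p : ℝ)) k l =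
      (∑ p ∈ range N, if slot p < l then 2 * c p - 1 else 0) +
      (∑ p ∈ range N, if slot p = l then c p else 0) -
      (∑ p ∈ range N, if slot p < k + 1 then 2 * c p - 1 else 0) +
      (∑ p ∈ range N, if slot p = k then c p else 0) := by
    intro k l hkl
    rw [← sum_add_distrib, ← sum_sub_distrib, ← sum_add_distrib]
    refine sum_congr rfl fun p _ => ?_
    simp only [Nat.cast_le, Nat.cast_lt]
    rcases lt_trichotomy (slot p) k with h | h | h
    · rw [if_neg (by omega), if_neg (by omega), if_pos (by omega), if_neg (by omega),
        if_pos (by omega), if_neg (by omega)]; ring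
    · rw [if_pos (by omega), if_neg (by omega), if_pos (by omega), if_neg (by omega),
        if_pos (by omega), if_pos (by omega)]; ring
    · rcases lt_trichotomy (slot p) l with h' | h' | h'
      · rw [if_pos (by omega), if_pos (by omega), if_pos (by omega), if_neg (by omega),
          if_neg (by omega), if_neg (by omega)]; ring
      · rw [if_pos (by omega), if_neg (by omega), if_neg (by omega), if_pos (by omega),
          if_neg (by omega), if_neg (by omega)]; ring
      · rw [if_neg (by omega), if_neg (by omega), if_neg (by omega), if_neg (by omega),
          if_neg (by omega), if_neg (by omega)]; ring
  refine and_congr_right fun _ => ⟨fun h k l hkl hl => ?_, fun h k l hk hkl hl => ?_⟩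
  · have := h (M + k) (M + l) (by omega) (by omega) (by omega)
    rw [hval k l hkl]
    simpa only [Nat.add_sub_cancel_left, show M + k + 1 - M = k + 1 by omega] using this
  · obtain ⟨k, rfl⟩ := Nat.exists_eq_add_of_le hk
    obtain ⟨l, rfl⟩ := Nat.exists_eq_add_of_le (show M ≤ l by omega)
    have := h k l (by omega) (by omega)
    rw [hval k l (by omega)] at this
    simpa only [Nat.add_sub_cancel_left, show M + k + 1 - M = k + 1 by omega] using this

/-- When the slots are the ranks in a direction, the last entry of the root of the tree is the
maximal value of a strip of this direction. -/
theorem IsTree.root_le_iff_of_rank {M K N : ℕ} (hM : M = 2 ^ K) (hNM : N ≤ M) {T : ℕ → Summary}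
    {c w : ℕ → ℝ} {slot : ℕ → ℕ} (hT : IsTree Summary.append M T)
    (hleaf : ∀ k < M, T (M + k) = slotLeaf N c slot k)
    (hslot : ∀ p < N, slot p = rank N w p) (hc : ∀ i, 0 ≤ c i ∧ c i ≤ 1)
    (hw : ∃ i < N, ∃ j < N, w i < w j) (z : ℝ) :
    (T 1).2.2.2 ≤ z ↔ ∀ c₁ c₂, stripVal N c w c₁ c₂ ≤ z := by
  have hord : ∀ i < N, ∀ j < N, (slot i : ℝ) ≤ slot j ↔ w i ≤ w j := by
    intro i hi j hj
    rw [Nat.cast_le, hslot i hi, hslot j hj, rank_le_rank_iff hj]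
  have hlt : ∀ i < N, ∀ j < N, (slot i : ℝ) < slot j ↔ w i < w j := by
    intro i hi j hj
    rw [← not_le, ← not_le, hord j hj i hi]
  rw [IsTree.root_le_iff hM hT hleaf]
  constructor
  · rintro ⟨-, h⟩ c₁ c₂
    obtain ⟨p, hp, q, hq, hpq, hle⟩ := exists_stripVal_le_of_pair hc hw c₁ c₂
    refine hle.trans ?_
    rw [← stripVal_congr_order hord hp hq]
    refine h _ _ ?_ ?_
    · exact_mod_cast (hlt p hp q hq).2 hpq
    · rw [hslot q hq]; exact (rank_lt hq).trans_le hNM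
  · intro h
    refine ⟨stripVal_one_zero.ge.trans (h 1 0), fun k l _ _ => ?_⟩
    obtain ⟨i, hi, j, hj, hij⟩ := hw
    obtain ⟨p, hp, q, hq, -, hle⟩ := exists_stripVal_le_of_pair (N := N)
      (w := fun p => (slot p : ℝ)) hc ⟨i, hi, j, hj, (hlt i hi j hj).2 hij⟩ k l
    refine hle.trans ?_
    rw [stripVal_congr_order hord hp hq]
    exact h _ _

/-- The points outside the tree are those with a slot `M` or more; so adding and removing a point
are both changes of its slot. -/
theorem slotLeaf_update {N : ℕ} {c : ℕ → ℝ} {slot : ℕ → ℕ} {p k : ℕ} (hp : p < N) (j : ℕ) :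
    slotLeaf N c (Function.update slot p k) j =
      slotLeaf N c slot j +
        ((if k = j then 2 * c p - 1 else 0) - (if slot p = j then 2 * c p - 1 else 0),
        (if k = j then c p else 0) - (if slot p = j then c p else 0),
        (if k = j then c p else 0) - (if slot p = j then c p else 0), 0) := by
  have key : ∀ f : ℕ → ℝ, (∑ q ∈ range N, if Function.update slot p k q = j then f q else 0) =
      (∑ q ∈ range N, if slot q = j then f q else 0) +
        ((if k = j then f p else 0) - (if slot p = j then f p else 0)) := by
    intro f
    rw [← add_sum_erase _ _ (mem_range.2 hp), ← add_sum_erase _ _ (mem_range.2 hp),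
      sum_congr rfl (g := fun q => if slot q = j then f q else 0), Function.update_self]
    · ring
    · intro q hq
      rw [Function.update_of_ne (ne_of_mem_erase hq)]
  simp only [slotLeaf, key, Prod.mk_add_mk, add_zero]

/-! ### Sorting by a tournament tree -/

/-- The word variable stored at index `0` of the word array `a`. -/
abbrev var (a : ℕ) : NExp := .get a (.lit 0)

/-- The comparison in a tournament: the competitor number `e` with key `σ e` is represented by
`e + 1`, and `0` stands for no competitor. -/
noncomputable def minOp (σ : ℕ → ℝ) (a b : ℕ) : ℕ :=
  open Classical in if 0 < b ∧ ¬ (0 < a ∧ ¬ σ (b - 1) < σ (a - 1)) then b else a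

/-- The winner of the tournament is a competitor with minimal key. -/
theorem IsTree.winner {M K : ℕ} (hM : M = 2 ^ K) {σ : ℕ → ℝ} {T : ℕ → ℕ}
    (hT : IsTree (minOp σ) M T) {D : Finset ℕ} (hD : ∀ e ∈ D, e < M)
    (hleaf : ∀ e < M, T (M + e) = if e ∈ D then e + 1 else 0) :
    (T 1 = 0 ∧ D = ∅) ∨ ∃ g ∈ D, T 1 = g + 1 ∧ ∀ e ∈ D, σ g ≤ σ e := by
  have H := hT.induction hM (P := fun a b n =>
    (n = 0 ∧ ∀ e ∈ D, a ≤ M + e → ¬ M + e < b) ∨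
    ∃ g ∈ D, n = g + 1 ∧ ∀ e ∈ D, a ≤ M + e → M + e < b → σ g ≤ σ e) (by
      intro k h1 h2
      obtain ⟨k, rfl⟩ := Nat.exists_eq_add_of_le h1
      rw [hleaf k (by omega)]
      by_cases hk : k ∈ D
      · right
        refine ⟨k, hk, by simp [hk], fun e he h1 h2 => ?_⟩
        obtain rfl : e = k := by omega
        exact le_rfl
      · left
        refine ⟨by simp [hk], fun e he h1 h2 => hk ?_⟩
        obtain rfl : e = k := by omega
        exact he) (by
      rintro a m b l r ham hmb (⟨rfl, hl⟩ | ⟨g, hg, rfl, hl⟩) (⟨rfl, hr⟩ | ⟨g', hg', rfl, hr⟩)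
      · left
        refine ⟨by simp [minOp], fun e he h1 h2 => ?_⟩
        rcases lt_or_ge (M + e) m with h | h
        · exact hl e he h1 h
        · exact hr e he h h2
      · right
        refine ⟨g', hg', by simp [minOp], fun e he h1 h2 => ?_⟩
        rcases lt_or_ge (M + e) m with h | h
        · exact absurd h (hl e he h1)
        · exact hr e he h h2
      · right
        refine ⟨g, hg, by simp [minOp], fun e he h1 h2 => ?_⟩
        rcases lt_or_ge (M + e) m with h | h
        · exact hl e he h1 h
        · exact absurd h2 (hr e he h)
      · right
        by_cases hlt : σ g' < σ g
        · refine ⟨g', hg', by simp [minOp, hlt], fun e he h1 h2 => ?_⟩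
          rcases lt_or_ge (M + e) m with h | h
          · exact hlt.le.trans (hl e he h1 h)
          · exact hr e he h h2
        · refine ⟨g, hg, by simp [minOp, hlt], fun e he h1 h2 => ?_⟩
          rcases lt_or_ge (M + e) m with h | h
          · exact hl e he h1 h
          · exact (not_lt.1 hlt).trans (hr e he h h2))
  refine H.imp (fun h => ⟨h.1, eq_empty_of_forall_notMem fun e he => ?_⟩) ?_
  · have := hD e he
    exact h.2 e he (by omega) (by omega)
  · rintro ⟨g, hg, h1, h2⟩
    refine ⟨g, hg, h1, fun e he => h2 e he (by omega) ?_⟩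
    have := hD e he
    omega

/-- The left child of the node in word array `8`. -/
abbrev leftChild : NExp := .mul (.lit 2) (var 8)

/-- The right child of the node in word array `8`. -/
abbrev rightChild : NExp := .add (.mul (.lit 2) (var 8)) (.lit 1)

/-- The program that computes `minOp` at a node of the tree in word array `4`, with keys in real
array `6`. -/
def minBody : Cmd :=
  .ite (.conj (.nlt (.lit 0) (.get 4 rightChild)) (.neg (.conj (.nlt (.lit 0) (.get 4 leftChild))
      (.neg (.rlt (.get 6 (.sub (.get 4 rightChild) (.lit 1)))
        (.get 6 (.sub (.get 4 leftChild) (.lit 1))))))))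
    (.setNat 4 (var 8) (.get 4 rightChild)) (.setNat 4 (var 8) (.get 4 leftChild))

/-- The program that stores `v` at the leaf `M + i` of the tournament and updates the tree. -/
def setLeaf (i v : NExp) : Cmd :=
  .seq (.setNat 8 (.lit 0) (.add (var 2) i))
    (.seq (.setNat 4 (var 8) v) (climb minBody))

theorem runs_climb_minBody {W K M : ℕ} (hM : M = 2 ^ K) (hMW : M ≤ W) {σ : ℕ → ℝ}
    {s : Mem} (hσ : s.real 6 = σ) (hW : ∀ i, s.nat 4 i ≤ W) {h : ℕ} (hh : s.nat 8 0 = h)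
    (h1 : M ≤ h) (h2 : h < 2 * M) {T₀ : ℕ → ℕ} (hT : IsTree (minOp σ) M T₀) {v : ℕ}
    (hsT : s.nat 4 = Function.update T₀ h v) :
    Runs W (climb minBody) s (K * 100 + 5) (fun s' => (∀ i, s'.nat 4 i ≤ W) ∧
      IsTree (minOp σ) M (s'.nat 4) ∧ ∀ i, M ≤ i → s'.nat 4 i = Function.update T₀ h v i) := by
  refine (Runs.climb (op := minOp σ) (tr := fun s => s.nat 4) (D := 89)
    (inv := fun s => s.real 6 = σ ∧ ∀ i, s.nat 4 i ≤ W) hM hMW (by simp) (by simp) ?_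
    ⟨hσ, hW⟩ hh h1 h2 hT hsT).mono (by omega) (fun s' h => ⟨h.1.2, h.2⟩)
  rintro s j ⟨hσ, hW⟩ hj1 hjM h8
  refine Runs.straight ?_ (by decide) ?_
  · simp only [minBody, Cmd.Safe, NExp.eval]
    exact ⟨fun _ => hW _, fun _ => hW _⟩
  · simp only [minBody, Cmd.post, BExp.Holds, NExp.eval, RExp.eval, h8, hσ, minOp]
    by_cases hlt : 0 < s.nat 4 (2 * j + 1) ∧
        ¬ (0 < s.nat 4 (2 * j) ∧ ¬ σ (s.nat 4 (2 * j + 1) - 1) < σ (s.nat 4 (2 * j) - 1))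
    · rw [if_pos hlt, if_pos hlt]
      refine ⟨⟨by simpa using hσ, fun i => ?_⟩, by simpa using h8, by simp⟩
      rw [Mem.nat_setNat_self, Function.update_apply]
      split_ifs <;> exact hW _
    · rw [if_neg hlt, if_neg hlt]
      refine ⟨⟨by simpa using hσ, fun i => ?_⟩, by simpa using h8, by simp⟩
      rw [Mem.nat_setNat_self, Function.update_apply]
      split_ifs <;> exact hW _

/-- The tree in word array `4` is a tournament between the elements of `D`. -/
structure Tournament (W M : ℕ) (σ : ℕ → ℝ) (D : Finset ℕ) (s : Mem) : Prop where
  word : ∀ i, s.nat 4 i ≤ W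
  tree : IsTree (minOp σ) M (s.nat 4)
  leaf : ∀ e < M, s.nat 4 (M + e) = if e ∈ D then e + 1 else 0

/-- The set `D'` of competitors may differ from `D` only in the competitor `e`. -/
theorem runs_setLeaf {W K M : ℕ} (hM : M = 2 ^ K) (hMW : 2 * M ≤ W) {σ : ℕ → ℝ} {D D' : Finset ℕ}
    {s : Mem} (hσ : s.real 6 = σ) (h2 : s.nat 2 0 = M) (hs : Tournament W M σ D s)
    {i v : NExp} {e : ℕ} (hi : i.eval s = e) (he : e < M)
    (hv : ∀ h, v.eval (s.setNat 8 0 h) = if e ∈ D' then e + 1 else 0)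
    (hD : ∀ e' < M, e' ≠ e → (e' ∈ D' ↔ e' ∈ D)) :
    Runs W (setLeaf i v) s (K * 100 + 14 + i.cost + v.cost)
      (fun s' => Tournament W M σ D' s') := by
  have hvW : (if e ∈ D' then e + 1 else 0) ≤ W := by split_ifs <;> omega
  refine (Runs.seq (T₁ := i.cost + 5) (T₂ := v.cost + 4 + (K * 100 + 5))
    (Q := fun s' => s' = s.setNat 8 0 (M + e))
    (Runs.straight ?_ ?_ ?_) ?_).mono (by omega) (fun _ => id)
  · simp only [Cmd.Safe, NExp.eval, h2, hi]; omega
  · simp only [Cmd.maxCost, NExp.cost]; omega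
  · simp only [Cmd.post, NExp.eval, h2, hi]
  rintro _ rfl -
  refine (Runs.seq (T₁ := v.cost + 4) (T₂ := K * 100 + 5)
    (Q := fun s' => s' = (s.setNat 8 0 (M + e)).setNat 4 (M + e) (if e ∈ D' then e + 1 else 0))
    (Runs.straight ?_ ?_ ?_) ?_).mono (by omega) (fun _ => id)
  · simp only [Cmd.Safe, hv]; exact hvW
  · simp only [Cmd.maxCost, NExp.cost]; omega
  · simp only [Cmd.post, NExp.eval, hv]
    simp
  rintro _ rfl -
  refine (runs_climb_minBody hM (by omega) (by simpa using hσ) ?_ (h := M + e) (by simp)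
    (by omega) (by omega) hs.tree (v := if e ∈ D' then e + 1 else 0) (by simp)).mono le_rfl ?_
  · intro j
    rw [Mem.nat_setNat_self, Function.update_apply]
    split_ifs
    · omega
    · exact Nat.zero_le _
    · simpa using hs.word j
  · rintro s' ⟨hW', hT', hl'⟩
    refine ⟨hW', hT', fun e' he' => ?_⟩
    rw [hl' _ (by omega), Function.update_apply]
    by_cases hee : e' = e
    · subst hee; simp
    · rw [if_neg (by omega), hs.leaf e' he']
      simp only [hD e' he' hee]

/-- The program that moves the winners of the tournament, one after another, to word array
`6`; the word variable `7` counts them. -/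
def sortCmd : Cmd :=
  .loop (.nlt (.lit 0) (.get 4 (.lit 1)))
    (.seq (.setNat 6 (var 7) (.sub (.get 4 (.lit 1)) (.lit 1)))
      (.seq (setLeaf (.get 6 (var 7)) (.lit 0))
        (.setNat 7 (.lit 0) (.add (var 7) (.lit 1)))))

/-- The sequence `ord 0, …, ord (E - 1)` lists the elements of `D` in the order of their keys. -/
structure IsSorting (σ : ℕ → ℝ) (D : Finset ℕ) (E : ℕ) (ord : ℕ → ℕ) : Prop where
  image : (range E).image ord = D
  inj : Set.InjOn ord (range E)
  mono : ∀ i j, i ≤ j → j < E → σ (ord i) ≤ σ (ord j)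

/-- The number of rounds is the number of competitors, and each round is one update of the tree. -/
theorem runs_sortCmd {W K M : ℕ} (hM : M = 2 ^ K) (hMW : 2 * M ≤ W) {σ : ℕ → ℝ} {D : Finset ℕ}
    {s : Mem} (hσ : s.real 6 = σ) (h2 : s.nat 2 0 = M) (hD : ∀ e ∈ D, e < M)
    (hs : Tournament W M σ D s) (h7 : s.nat 7 0 = 0) :
    Runs W sortCmd s (#D * (K * 100 + 100) + 100)
      (fun s' => s'.nat 7 0 = #D ∧ IsSorting σ D (#D) (s'.nat 6)) := by
  have hcard : #D ≤ M := by
    have : D ⊆ range M := fun e he => mem_range.2 (hD e he)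
    simpa using card_le_card this
  refine (Runs.loop (#D) (K * 100 + 60) (fun k s' => s'.real 6 = σ ∧ s'.nat 2 0 = M ∧
    s'.nat 7 0 = k ∧ (range k).image (s'.nat 6) ⊆ D ∧ Set.InjOn (s'.nat 6) (range k) ∧
    Tournament W M σ (D \ (range k).image (s'.nat 6)) s' ∧
    (∀ i j, i ≤ j → j < k → σ (s'.nat 6 i) ≤ σ (s'.nat 6 j)) ∧
    ∀ i < k, ∀ e ∈ D \ (range k).image (s'.nat 6), σ (s'.nat 6 i) ≤ σ e)
    ?_ ?_ ?_ ?_).mono ?_ ?_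
  · exact ⟨hσ, h2, h7, by simp, by simp, by simpa using hs, by simp, by simp⟩
  · rintro k s' hk ⟨-, -, -, hsub, hinj, hT, -⟩
    have hne : D \ (range k).image (s'.nat 6) ≠ ∅ := by
      intro h
      have := card_le_card (sdiff_eq_empty_iff_subset.1 h)
      rw [card_image_of_injOn hinj, card_range] at this
      omega
    rcases hT.tree.winner hM (fun e he => hD e (mem_sdiff.1 he).1) hT.leaf with
      ⟨-, h⟩ | ⟨g, -, h, -⟩
    · exact absurd h hne
    · simp [BExp.Holds, NExp.eval, h]
  · rintro k s' hk ⟨hσ, h2, h7, hsub, hinj, hT, hmono, hmin⟩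
    have hne : D \ (range k).image (s'.nat 6) ≠ ∅ := by
      intro h
      have := card_le_card (sdiff_eq_empty_iff_subset.1 h)
      rw [card_image_of_injOn hinj, card_range] at this
      omega
    obtain ⟨g, hg, hroot, hgmin⟩ : ∃ g ∈ D \ (range k).image (s'.nat 6), s'.nat 4 1 = g + 1 ∧
        ∀ e ∈ D \ (range k).image (s'.nat 6), σ g ≤ σ e := by
      rcases hT.tree.winner hM (fun e he => hD e (mem_sdiff.1 he).1) hT.leaf with ⟨-, h⟩ | h
      · exact absurd h hne
      · exact h
    have hgD := (mem_sdiff.1 hg).1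
    have hgM := hD g hgD
    refine (Runs.seq (T₁ := 9) (T₂ := K * 100 + 50) (Q := fun s'' => s'' = s'.setNat 6 k g)
      (Runs.straight ?_ (by decide) ?_) ?_).mono (by omega) (fun _ => id)
    · simp only [Cmd.Safe, NExp.eval, hroot]; omega
    · simp only [Cmd.post, NExp.eval, hroot, h7, Nat.add_sub_cancel]
    rintro _ rfl -
    refine (Runs.seq (T₂ := 6) (runs_setLeaf (K := K) hM hMW (σ := σ)
      (D := D \ (range k).image (s'.nat 6)) (D' := (D \ (range k).image (s'.nat 6)).erase g)
      (e := g) (by simpa using hσ) (by simpa using h2) ⟨by simpa using hT.word,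
        by simpa using hT.tree, by simpa using hT.leaf⟩
      (by simp [NExp.eval, h7]) hgM (by simp [NExp.eval]) (by
        intro e' _ hne
        simp [hne])) ?_).mono (by simp [NExp.cost]) (fun _ => id)
    intro s'' hT'' hf
    have h6 : s''.nat 6 = Function.update (s'.nat 6) k g := by rw [hf.nat 6 rfl]; simp
    have h7' : s''.nat 7 0 = k := by rw [hf.nat 7 rfl]; simpa using h7
    have hr6 : s''.real 6 = σ := (hf.real 6 rfl).trans hσ
    have h2' : s''.nat 2 0 = M := by rw [hf.nat 2 rfl]; simpa using h2
    have himg : (range (k + 1)).image (Function.update (s'.nat 6) k g) =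
        insert g ((range k).image (s'.nat 6)) := by
      rw [range_add_one, image_insert, Function.update_self]
      congr 1
      refine image_congr fun i hi => ?_
      have : i < k := by simpa using hi
      rw [Function.update_of_ne this.ne]
    have hgk := (mem_sdiff.1 hg).2
    have herase : D \ insert g ((range k).image (s'.nat 6)) =
        (D \ (range k).image (s'.nat 6)).erase g := by
      ext e; simp only [mem_sdiff, mem_insert, mem_erase]; tauto
    have hlt : ∀ i < k, Function.update (s'.nat 6) k g i = s'.nat 6 i :=
      fun i hi => Function.update_of_ne hi.ne _ _
    refine Runs.straight ?_ (by decide) ?_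
    · simp only [Cmd.Safe, NExp.eval, h7']; omega
    · simp only [Cmd.post, NExp.eval, h7']
      have e6 : (s''.setNat 7 0 (k + 1)).nat 6 = Function.update (s'.nat 6) k g := by
        rw [Mem.nat_setNat_of_ne _ _ _ (by norm_num), h6]
      simp only [e6, himg, herase]
      refine ⟨by simpa using hr6, by simpa using h2', by simp, ?_, ?_, ?_, ?_, ?_⟩
      · exact insert_subset hgD hsub
      · intro i hi j hj hij
        simp only [coe_range, Set.mem_Iio] at hi hj
        rcases Nat.lt_succ_iff_lt_or_eq.1 hi with hi | rfl <;>
          rcases Nat.lt_succ_iff_lt_or_eq.1 hj with hj | rfl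
        · rw [hlt i hi, hlt j hj] at hij
          exact hinj (by simpa using hi) (by simpa using hj) hij
        · rw [hlt i hi, Function.update_self] at hij
          exact absurd (mem_image.2 ⟨i, by simpa using hi, hij⟩) hgk
        · rw [hlt j hj, Function.update_self] at hij
          exact absurd (mem_image.2 ⟨j, by simpa using hj, hij.symm⟩) hgk
        · rfl
      · exact ⟨by simpa using hT''.word, by simpa using hT''.tree, by simpa using hT''.leaf⟩
      · intro i j hij hj
        rcases Nat.lt_succ_iff_lt_or_eq.1 hj with hj | rfl
        · rw [hlt i (by omega), hlt j hj]; exact hmono i j hij hj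
        · rcases hij.lt_or_eq with hi | rfl
          · rw [hlt i hi, Function.update_self]; exact hmin i hi g hg
          · rfl
      · intro i hi e he
        rcases Nat.lt_succ_iff_lt_or_eq.1 hi with hi | rfl
        · rw [hlt i hi]; exact hmin i hi e (mem_of_mem_erase he)
        · rw [Function.update_self]; exact hgmin e (mem_of_mem_erase he)
  · rintro s' ⟨-, -, -, hsub, hinj, hT, -⟩
    have heq : (range (#D)).image (s'.nat 6) = D := by
      refine eq_of_subset_of_card_le hsub ?_
      rw [card_image_of_injOn hinj, card_range]
    rcases hT.tree.winner hM (fun e he => hD e (mem_sdiff.1 he).1) hT.leaf with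
      ⟨h, -⟩ | ⟨g, hg, -⟩
    · simp [BExp.Holds, NExp.eval, h]
    · rw [heq] at hg; simp at hg
  · simp only [BExp.cost, NExp.cost]
    exact Nat.add_le_add (Nat.mul_le_mul_left _ (by omega)) (by omega)
  · rintro s' ⟨-, -, h7, hsub, hinj, -, hmono, -⟩
    refine ⟨h7, ?_, hinj, hmono⟩
    refine eq_of_subset_of_card_le hsub ?_
    rw [card_image_of_injOn hinj, card_range]

/-! ### Critical slopes and slots -/

theorem mul_add_eq_iff {N p q e : ℕ} (hp : p < N) : q * N + p = e ↔ q = e / N ∧ p = e % N := by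
  have hN : 0 < N := by omega
  constructor
  · rintro rfl
    rw [Nat.add_comm, Nat.add_mul_div_right _ _ hN, Nat.div_eq_of_lt hp, Nat.add_mul_mod_self_right,
      Nat.mod_eq_of_lt hp]
    simp
  · rintro ⟨rfl, rfl⟩
    rw [Nat.mul_comm]; exact Nat.div_add_mod e N

/-- The pairs `(i, j)` of points such that `i` is to the left of `j`, encoded as `i * N + j`.
At the slope of their line, `i` and `j` change their order. -/
noncomputable def events (N : ℕ) (x : ℕ → ℝ) : Finset ℕ :=
  {e ∈ range (N * N) | x (e / N) < x (e % N)}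

theorem mem_events {N : ℕ} {x : ℕ → ℝ} {e : ℕ} :
    e ∈ events N x ↔ e < N * N ∧ x (e / N) < x (e % N) := by
  simp [events]

theorem div_lt_of_mem_events {N : ℕ} {x : ℕ → ℝ} {e : ℕ} (h : e ∈ events N x) : e / N < N :=
  Nat.div_lt_of_lt_mul (mem_events.1 h).1

theorem mod_lt_of_mem_events {N : ℕ} {x : ℕ → ℝ} {e : ℕ} (h : e ∈ events N x) : e % N < N := by
  refine Nat.mod_lt _ (Nat.pos_of_ne_zero ?_)
  rintro rfl
  simp [events] at h

theorem mul_add_mem_events {N : ℕ} {x : ℕ → ℝ} {p q : ℕ} (hp : p < N) (hq : q < N) :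
    q * N + p ∈ events N x ↔ x q < x p := by
  obtain ⟨h1, h2⟩ := (mul_add_eq_iff (q := q) hp).1 rfl
  rw [mem_events, ← h1, ← h2]
  refine and_iff_right ?_
  calc q * N + p < q * N + N := by omega
    _ = (q + 1) * N := by ring
    _ ≤ N * N := Nat.mul_le_mul_right _ hq

/-- The position of the point `p` in the sweep, when the right points of the pairs in `D₁` have
joined the left ones, and the left points of the pairs in `D₂` have gone on. -/
noncomputable def sweepSlot (N : ℕ) (x : ℕ → ℝ) (D₁ D₂ : Finset ℕ) (p : ℕ) : ℕ :=
  #{q ∈ range N | x q < x p ∧ q * N + p ∉ D₁} + #{q ∈ range N | x p < x q ∧ p * N + q ∈ D₂}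

section SweepSlot

variable {N : ℕ} {x : ℕ → ℝ} {D₁ D₂ : Finset ℕ} {e p : ℕ}

/-- Merging a pair moves its right point one slot down. -/
theorem sweepSlot_insert_left (he : e ∈ events N x) (heD : e ∉ D₁) (hp : p < N) :
    sweepSlot N x (insert e D₁) D₂ p + (if p = e % N then 1 else 0) = sweepSlot N x D₁ D₂ p := by
  rw [sweepSlot, sweepSlot, add_right_comm]
  congr 1
  have hi := div_lt_of_mem_events he
  by_cases h : p = e % N
  · have e1 : e / N * N + p = e := (mul_add_eq_iff hp).2 ⟨rfl, h⟩
    have : ({q ∈ range N | x q < x p ∧ q * N + p ∉ D₁} : Finset ℕ) =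
        insert (e / N) {q ∈ range N | x q < x p ∧ q * N + p ∉ insert e D₁} := by
      ext q
      simp only [mem_filter, mem_range, mem_insert, mul_add_eq_iff hp, not_or]
      constructor
      · rintro ⟨h1, h2, h3⟩
        by_cases hq : q = e / N
        · exact .inl hq
        · exact .inr ⟨h1, h2, fun h => hq h.1, h3⟩
      · rintro (rfl | ⟨h1, h2, -, h3⟩)
        · refine ⟨hi, ?_, by rwa [e1]⟩
          rw [h]; exact (mem_events.1 he).2
        · exact ⟨h1, h2, h3⟩
    rw [this, card_insert_of_notMem (by simp [e1]), if_pos h]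
  · rw [if_neg h, add_zero]
    congr 1
    refine filter_congr fun q _ => ?_
    simp only [mem_insert, mul_add_eq_iff hp, not_or]
    tauto

theorem sweepSlot_insert_left_of_notMem (he : e ∉ events N x) (hp : p < N) :
    sweepSlot N x (insert e D₁) D₂ p = sweepSlot N x D₁ D₂ p := by
  rw [sweepSlot, sweepSlot]
  congr 2
  refine filter_congr fun q hq => and_congr_right fun hqp => ?_
  have : q * N + p ≠ e := by
    rintro rfl
    exact he ((mul_add_mem_events hp (mem_range.1 hq)).2 hqp)
  simp [this]

/-- Splitting a pair moves its left point one slot up. -/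
theorem sweepSlot_insert_right (he : e ∈ events N x) (heD : e ∉ D₂) :
    sweepSlot N x D₁ (insert e D₂) p =
      sweepSlot N x D₁ D₂ p + (if p = e / N then 1 else 0) := by
  rw [sweepSlot, sweepSlot, add_assoc]
  congr 1
  have hj := mod_lt_of_mem_events he
  by_cases h : p = e / N
  · have e1 : p * N + e % N = e := (mul_add_eq_iff hj).2 ⟨h, rfl⟩
    have : ({q ∈ range N | x p < x q ∧ p * N + q ∈ insert e D₂} : Finset ℕ) =
        insert (e % N) {q ∈ range N | x p < x q ∧ p * N + q ∈ D₂} := by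
      ext q
      simp only [mem_filter, mem_range, mem_insert]
      constructor
      · rintro ⟨h1, h2, h3 | h3⟩
        · exact .inl ((mul_add_eq_iff h1).1 h3).2
        · exact .inr ⟨h1, h2, h3⟩
      · rintro (rfl | ⟨h1, h2, h3⟩)
        · refine ⟨hj, ?_, .inl e1⟩
          rw [h]; exact (mem_events.1 he).2
        · exact ⟨h1, h2, .inr h3⟩
    rw [this, card_insert_of_notMem (by simp [e1, heD]), if_pos h]
  · rw [if_neg h, add_zero]
    congr 1
    refine filter_congr fun q hq => ?_
    have : p * N + q ≠ e := fun h' => h ((mul_add_eq_iff (mem_range.1 hq)).1 h').1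
    simp [this]

theorem sweepSlot_lt (hp : p < N) : sweepSlot N x D₁ D₂ p < N := by
  rw [sweepSlot, ← card_union_of_disjoint]
  · refine (card_lt_card (t := range N) ⟨?_, fun h => ?_⟩).trans_eq (card_range N)
    · exact union_subset (filter_subset _ _) (filter_subset _ _)
    · have := h (mem_range.2 hp)
      simp at this
  · rw [disjoint_left]
    intro q h1 h2
    simp only [mem_filter] at h1 h2
    exact lt_asymm h1.2.1 h2.2.1

/-- When the pairs whose slope is at most `m` have been merged, and those whose slope is less than
`m` have been split, the positions are the ranks in the direction of slope `m`. -/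
theorem sweepSlot_eq_rank {y : ℕ → ℝ} {m : ℝ}
    (hxy : ∀ i < N, ∀ j < N, x i = x j → y i = y j)
    (h₁ : ∀ e ∈ events N x, e ∈ D₁ ↔ lineSlope x y (e / N) (e % N) ≤ m)
    (h₂ : ∀ e ∈ events N x, e ∈ D₂ ↔ lineSlope x y (e / N) (e % N) < m) (hp : p < N) :
    sweepSlot N x D₁ D₂ p = rank N (lineHeight x y m) p := by
  rw [sweepSlot, rank, ← card_union_of_disjoint, ← filter_or]
  · congr 1
    refine filter_congr fun q hq => ?_
    have hq := mem_range.1 hq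
    rw [← not_le (a := lineHeight x y m p)]
    rcases lt_trichotomy (x q) (x p) with h | h | h
    · have he := (mul_add_mem_events hp hq).2 h
      obtain ⟨e1, e2⟩ := (mul_add_eq_iff (q := q) hp).1 rfl
      rw [h₁ _ he, ← e1, ← e2, lineHeight_ge_iff h]
      simp [h, h.not_gt]
    · have : lineHeight x y m p ≤ lineHeight x y m q := by
        rw [lineHeight, lineHeight, h, hxy q hq p hp h]
      simp [h, this]
    · have he := (mul_add_mem_events hq hp).2 h
      obtain ⟨e1, e2⟩ := (mul_add_eq_iff (q := p) hq).1 rfl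
      rw [h₂ _ he, ← e1, ← e2, lineHeight_le_iff h]
      simp [h, h.not_gt]
  · rw [disjoint_left]
    intro q h1 h2
    simp only [mem_filter] at h1 h2
    exact lt_asymm h1.2.1 h2.2.1

end SweepSlot

/-! ### Preparation of the memory -/

/-- The program `for t = 0, …, bound - 1 do body`, with `t` in the word variable `3`. -/
def forTo (bound : NExp) (body : Cmd) : Cmd :=
  .seq (.setNat 3 (.lit 0) (.lit 0))
    (.loop (.nlt (var 3) bound) (.seq body (.setNat 3 (.lit 0) (.add (var 3) (.lit 1)))))

theorem Runs.forTo {W n D : ℕ} {bound : NExp} {body : Cmd} {s : Mem} (I : ℕ → Mem → Prop)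
    (hnW : n ≤ W) (hwr : body.writesNat 3 = false) (h0 : I 0 s)
    (hI : ∀ k s v, I k s → I k (s.setNat 3 0 v))
    (hbound : ∀ k s, k ≤ n → I k s → bound.eval s = n)
    (hbody : ∀ k s, k < n → I k s → s.nat 3 0 = k → Runs W body s D (I (k + 1))) :
    Runs W (forTo bound body) s (n * (bound.cost + D + 10) + (bound.cost + 10)) (I n) := by
  refine (Runs.seq (T₁ := 3) (Q := fun s' => s' = s.setNat 3 0 0)
    (Runs.straight (Nat.zero_le _) (by decide) rfl) ?_).mono (by omega) (fun _ => id)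
    (T₁ := 3 + (n * (bound.cost + D + 10) + (bound.cost + 7)))
  rintro _ rfl -
  refine (Runs.loop n (D + 6) (fun k s' => I k s' ∧ s'.nat 3 0 = k)
    ⟨hI _ _ _ h0, by simp⟩ ?_ ?_ ?_).mono ?_ (fun _ h => h.1)
  · rintro k s' hk ⟨hi, h3⟩
    simpa only [BExp.Holds, NExp.eval, h3, hbound k s' hk.le hi] using hk
  · rintro k s' hk ⟨hi, h3⟩
    refine (hbody k s' hk hi h3).seq fun s'' hi' hf => ?_
    have h3' : s''.nat 3 0 = k := by rw [hf.nat 3 hwr, h3]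
    refine Runs.straight ?_ (by decide) ?_
    · simp only [Cmd.Safe, NExp.eval, h3']; omega
    · simp only [Cmd.post, NExp.eval, h3']
      exact ⟨hI _ _ _ hi', by simp⟩
  · rintro s' ⟨hi, h3⟩
    simp only [BExp.Holds, NExp.eval, h3, hbound n s' le_rfl hi, lt_irrefl, not_false_eq_true]
  · simp only [BExp.cost, NExp.cost]
    exact Nat.add_le_add (Nat.mul_le_mul_left _ (by omega)) (by omega)

/-- The part of the memory that stays the same after the preparation: the number `N` of points,
the size `M` of the trees, and the coordinates and colours of the points. -/
structure Base (N M : ℕ) (x y c : ℕ → ℝ) (s : Mem) : Prop where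
  size : s.nat 1 0 = N
  leaves : s.nat 2 0 = M
  x : s.real 0 = x
  y : s.real 1 = y
  colour : s.real 5 = c

theorem Base.of_frame {N M : ℕ} {x y c : ℕ → ℝ} {s s' : Mem} {P : Cmd} (h : Base N M x y c s)
    (hf : Frame P s s') (h1 : P.writesNat 1 = false := by rfl)
    (h2 : P.writesNat 2 = false := by rfl) (h3 : P.writesReal 0 = false := by rfl)
    (h4 : P.writesReal 1 = false := by rfl) (h5 : P.writesReal 5 = false := by rfl) :
    Base N M x y c s' where
  size := by rw [hf.nat 1 h1, h.size]
  leaves := by rw [hf.nat 2 h2, h.leaves]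
  x := by rw [hf.real 0 h3, h.x]
  y := by rw [hf.real 1 h4, h.y]
  colour := by rw [hf.real 5 h5, h.colour]

theorem Base.setNat {N M : ℕ} {x y c : ℕ → ℝ} {s : Mem} (h : Base N M x y c s) {a : ℕ} (i v : ℕ)
    (h1 : 1 ≠ a := by decide) (h2 : 2 ≠ a := by decide) : Base N M x y c (s.setNat a i v) where
  size := by rw [Mem.nat_setNat_of_ne _ _ _ h1, h.size]
  leaves := by rw [Mem.nat_setNat_of_ne _ _ _ h2, h.leaves]
  x := h.x
  y := h.y
  colour := h.colour

/-- The program that joins the blue points to the red points in the real arrays `0` and `1`, with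
colours in the real array `5`. -/
def joinCmd : Cmd :=
  .seq (.setNat 1 (.lit 0) (.add (.get 0 (.lit 0)) (.get 0 (.lit 1))))
    (forTo (.get 0 (.lit 1))
      (.seq (.setReal 0 (.add (.get 0 (.lit 0)) (var 3)) (.get 2 (var 3)))
      (.seq (.setReal 1 (.add (.get 0 (.lit 0)) (var 3)) (.get 3 (var 3)))
        (.setReal 5 (.add (.get 0 (.lit 0)) (var 3)) (.ofNat (.lit 1))))))

/-- The colours of the points when `n₁` red points are followed by `n₂` blue points. -/
noncomputable def colours (n₁ n₂ : ℕ) (i : ℕ) : ℝ := if n₁ ≤ i ∧ i < n₁ + n₂ then 1 else 0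

theorem getD_append_take_succ (r b : List (ℝ × ℝ)) {k : ℕ} (hk : k < b.length) (i : ℕ) :
    (r ++ b.take (k + 1)).getD i 0 =
      if i = r.length + k then b.getD k 0 else (r ++ b.take k).getD i 0 := by
  have hl : (b.take k).length = k := by simp; omega
  have e : r ++ b.take (k + 1) = (r ++ b.take k) ++ [b[k]] := by
    rw [List.take_succ_eq_append_getElem hk, List.append_assoc]
  rw [e]
  split_ifs with h
  · subst h
    rw [List.getD_append_right _ _ _ _ (by simp)]
    simp [hl, hk]
  · rcases lt_or_gt_of_ne h with h | h
    · rw [List.getD_append _ _ _ _ (by simp; omega)]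
    · rw [List.getD_eq_default _ _ (by simp; omega), List.getD_eq_default _ _ (by simp; omega)]

theorem runs_joinCmd {W : ℕ} {r b : List (ℝ × ℝ)} (hW : r.length + b.length ≤ W) :
    Runs W joinCmd (inputMem r b) (b.length * 40 + 40) (fun s =>
      s.nat 1 0 = r.length + b.length ∧ s.real 0 = (fun i => ((r ++ b).getD i 0).1) ∧
      s.real 1 = (fun i => ((r ++ b).getD i 0).2) ∧ s.real 5 = colours r.length b.length) := by
  refine (Runs.seq (T₁ := 8) (T₂ := b.length * (2 + 26 + 10) + (2 + 10))
    (Q := fun s => s = (inputMem r b).setNat 1 0 (r.length + b.length))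
    (Runs.straight ?_ (by decide) ?_) ?_).mono (by omega) (fun _ => id)
  · simpa [Cmd.Safe, NExp.eval, inputMem] using hW
  · simp [Cmd.post, NExp.eval, inputMem]
  rintro _ rfl -
  refine (Runs.forTo (n := b.length) (D := 26) (fun k s => s.nat 0 0 = r.length ∧
    s.nat 0 1 = b.length ∧ s.nat 1 0 = r.length + b.length ∧
    s.real 2 = (fun i => (b.getD i 0).1) ∧ s.real 3 = (fun i => (b.getD i 0).2) ∧
    s.real 0 = (fun i => ((r ++ b.take k).getD i 0).1) ∧
    s.real 1 = (fun i => ((r ++ b.take k).getD i 0).2) ∧ s.real 5 = colours r.length k)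
    (by omega) rfl ?_ ?_ ?_ ?_).mono le_rfl ?_
  · refine ⟨by simp [inputMem], by simp [inputMem], by simp, ?_, ?_, ?_, ?_, ?_⟩
    · funext i; simp [inputMem]
    · funext i; simp [inputMem]
    · funext i; simp [inputMem]
    · funext i; simp [inputMem]
    · funext i
      rw [colours, if_neg (by omega)]
      simp [inputMem]
  · intro k s v h; simpa using h
  · intro k s hk h; simpa only [NExp.eval] using h.2.1
  · rintro k s hk ⟨h1, h2, h3, h4, h5, h6, h7, h8⟩ hk3
    refine Runs.straight ?_ (by decide) ?_
    · simp [Cmd.Safe]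
    · simp only [Cmd.post, NExp.eval, RExp.eval, Mem.nat_setReal, h1, hk3]
      refine ⟨by simp, by simpa using h2, by simpa using h3, by simpa using h4,
        by simpa using h5, ?_, ?_, ?_⟩
      · funext i
        rw [getD_append_take_succ r b hk]
        simp only [ne_eq, OfNat.ofNat_ne_zero, OfNat.zero_ne_ofNat, not_false_eq_true, zero_ne_one,
          Mem.real_setReal_of_ne, Mem.real_setReal_self, Function.update_apply, h6, h4]
        split_ifs <;> rfl
      · funext i
        rw [getD_append_take_succ r b hk]
        simp only [ne_eq, OfNat.one_ne_ofNat, OfNat.ofNat_ne_zero, not_false_eq_true,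
          one_ne_zero, Mem.real_setReal_of_ne, Mem.real_setReal_self, Function.update_apply, h7, h5]
        split_ifs <;> rfl
      · funext i
        rw [Mem.real_setReal_self, Mem.real_setReal_of_ne _ _ _ (by decide),
          Mem.real_setReal_of_ne _ _ _ (by decide), h8, Function.update_apply]
        simp only [colours, Nat.cast_one]
        split_ifs <;> first | rfl | omega
  · rintro s ⟨-, -, h3, -, -, h6, h7, h8⟩
    simp only [List.take_length] at h6 h7
    exact ⟨h3, h6, h7, h8⟩

/-- The program that computes a power of two that is at least `N * N`. -/
def doubleCmd : Cmd :=
  .seq (.setNat 2 (.lit 0) (.lit 1))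
    (.loop (.nlt (var 2) (.mul (var 1) (var 1))) (.setNat 2 (.lit 0) (.add (var 2) (var 2))))

theorem runs_doubleCmd {W N K : ℕ} (hK : K = Nat.clog 2 (N * N)) (hW : 2 ^ K ≤ W) {s : Mem}
    (h1 : s.nat 1 0 = N) :
    Runs W doubleCmd s (K * 20 + 20) (fun s' => s'.nat 2 0 = 2 ^ K) := by
  have hpow : ∀ k, k ≤ K → 2 ^ k ≤ W :=
    fun k hk => (Nat.pow_le_pow_right (by norm_num) hk).trans hW
  refine (Runs.seq (T₁ := 3) (T₂ := K * 20 + 17) (Q := fun s' => s' = s.setNat 2 0 1)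
    (Runs.straight ?_ (by decide) rfl) ?_).mono (by omega) (fun _ => id)
  · exact hpow 0 (Nat.zero_le _)
  rintro _ rfl -
  refine (Runs.loop K 7 (fun k s' => s'.nat 1 0 = N ∧ s'.nat 2 0 = 2 ^ k)
    (by simpa using h1) ?_ ?_ ?_).mono ?_ (fun _ h => h.2)
  · rintro k s' hk ⟨h1, h2⟩
    simp only [BExp.Holds, NExp.eval, h1, h2]
    rw [hK] at hk
    exact (Nat.lt_clog_iff_pow_lt (by norm_num)).1 hk
  · rintro k s' hk ⟨h1, h2⟩
    refine Runs.straight ?_ (by decide) ?_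
    · simp only [Cmd.Safe, NExp.eval, h2]
      rw [← two_mul, ← pow_succ']; exact hpow (k + 1) hk
    · simp only [Cmd.post, NExp.eval, h2]
      rw [← two_mul, ← pow_succ']
      exact ⟨by simpa using h1, by simp⟩
  · rintro s' ⟨h1, h2⟩
    simp only [BExp.Holds, NExp.eval, h1, h2, not_lt, hK]
    exact Nat.le_pow_clog (by norm_num) _
  · simp only [BExp.cost, NExp.cost]
    omega

/-- The program that decodes the pair with number `t` into the word variables `12` and `13`. -/
def decodeCmd : Cmd :=
  .seq (.setNat 12 (.lit 0) (.div (var 3) (var 1)))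
    (.setNat 13 (.lit 0) (.sub (var 3) (.mul (var 12) (var 1))))

theorem runs_decodeCmd {W N k : ℕ} {s : Mem} (h1 : s.nat 1 0 = N) (h3 : s.nat 3 0 = k)
    (hk : k ≤ W) : Runs W decodeCmd s 17
      (fun s' => s' = (s.setNat 12 0 (k / N)).setNat 13 0 (k % N)) := by
  have e : k - k / N * N = k % N := by
    rw [Nat.mod_def, Nat.mul_comm]
  refine Runs.straight ?_ (by decide) ?_
  · simp only [decodeCmd, Cmd.Safe, Cmd.post, NExp.eval, h1, h3]
    constructor
    · exact (Nat.div_le_self _ _).trans hk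
    · simp [h1, h3, e]
      exact (Nat.mod_le _ _).trans hk
  · simp only [decodeCmd, Cmd.post, NExp.eval]
    simp [h1, h3, e]

/-- The program that computes the slopes of the lines through all pairs of points. For two points
with the same abscissa it computes `0`, but such pairs are not events. -/
def slopesCmd : Cmd :=
  forTo (.mul (var 1) (var 1)) (.seq decodeCmd
    (.setReal 6 (var 3) (.div (.sub (.get 1 (var 13)) (.get 1 (var 12)))
      (.sub (.get 0 (var 13)) (.get 0 (var 12))))))

theorem runs_slopesCmd {W N M : ℕ} {x y c : ℕ → ℝ} {s : Mem} (h : Base N M x y c s)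
    (hW : N * N ≤ W) : Runs W slopesCmd s (N * N * 50 + 20)
      (fun s' => ∀ e < N * N, s'.real 6 e = lineSlope x y (e / N) (e % N)) := by
  refine (Runs.forTo (n := N * N) (D := 35) (fun k s => Base N M x y c s ∧ ∀ e < k,
    s.real 6 e = lineSlope x y (e / N) (e % N)) hW rfl ⟨h, by simp⟩ ?_ ?_ ?_).mono
    (by simp only [NExp.cost]; omega) (fun s h => h.2)
  · rintro k s v ⟨h, h'⟩
    exact ⟨h.setNat _ _, by simpa using h'⟩
  · rintro k s - ⟨h, -⟩
    simp [NExp.eval, h.size]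
  · rintro k s hk ⟨h, hs⟩ h3
    refine ((runs_decodeCmd h.size h3 (by omega)).seq (T₂ := 18) ?_).withFrame.mono le_rfl
      (Q := fun s' => (∀ e < k + 1, s'.real 6 e = lineSlope x y (e / N) (e % N)) ∧ Frame _ s s')
      (fun s' h' => ⟨h.of_frame h'.2, h'.1⟩)
    rintro _ rfl -
    refine Runs.straight trivial (by decide) ?_
    intro e he
    simp only [Cmd.post, NExp.eval, RExp.eval, Mem.real_setReal_self, Function.update_apply]
    simp only [h.x, h.y, Mem.real_setNat, ne_eq, Nat.reduceEqDiff, not_false_eq_true,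
      Mem.nat_setNat_of_ne, h3, Mem.nat_setNat_self, Function.update_self]
    split_ifs with hek
    · subst hek; rfl
    · exact hs e (by omega)

/-- The program that starts the tournament between the critical slopes and counts, for each point,
the points to its left. -/
def eventsCmd : Cmd :=
  forTo (.mul (var 1) (var 1)) (.seq decodeCmd
    (.ite (.rlt (.get 0 (var 12)) (.get 0 (var 13)))
      (.seq (.setNat 5 (var 13) (.add (.get 5 (var 13)) (.lit 1)))
        (setLeaf (var 3) (.add (var 3) (.lit 1))))
      .skip))

/-- While the pairs are added to the tournament, the slots are those of a sweep in which the pairs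
not yet added are merged. -/
theorem runs_eventsCmd {W N M K : ℕ} {x y c σ : ℕ → ℝ} {s : Mem} (h : Base N M x y c s)
    (hM : M = 2 ^ K) (hNM : N * N ≤ M) (hMW : 2 * M ≤ W) (hσ : s.real 6 = σ)
    (h4 : s.nat 4 = fun _ => 0) (h5 : s.nat 5 = fun _ => 0) :
    Runs W eventsCmd s (N * N * (K * 100 + 70) + 20)
      (fun s' => Tournament W M σ (events N x) s' ∧
        ∀ p < N, s'.nat 5 p = sweepSlot N x ∅ ∅ p) := by
  have hN : N ≤ N * N := Nat.le_mul_self N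
  refine (Runs.forTo (n := N * N) (D := K * 100 + 55) (fun k s => (Base N M x y c s ∧
    s.real 6 = σ) ∧ Tournament W M σ {e ∈ events N x | e < k} s ∧
    ∀ p < N, s.nat 5 p = sweepSlot N x (Ico k (N * N)) ∅ p)
    (by omega) rfl ⟨⟨h, hσ⟩, ⟨?_, ?_, ?_⟩, ?_⟩ ?_ ?_ ?_).mono
    (by simp only [NExp.cost]
        exact Nat.add_le_add (Nat.mul_le_mul_left _ (by omega)) (by omega)) (fun s h => ?_)
  · simp [h4]
  · intro i _ _; simp [h4, minOp]
  · simp [h4]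
  · intro p hp
    rw [h5, sweepSlot]
    have : ∀ q < N, q * N + p < N * N := by
      intro q hq
      calc q * N + p < q * N + N := by omega
        _ = (q + 1) * N := by ring
        _ ≤ N * N := Nat.mul_le_mul_right _ hq
    symm
    simp only [Nat.add_eq_zero_iff, card_eq_zero, filter_eq_empty_iff, mem_range]
    refine ⟨fun q hq => ?_, fun q hq => by simp⟩
    simp [this q hq]
  · rintro k s v ⟨⟨h, hσ⟩, hT, hs⟩
    exact ⟨⟨h.setNat _ _, hσ⟩, ⟨by simpa using hT.word, by simpa using hT.tree,
      by simpa using hT.leaf⟩, by simpa using hs⟩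
  · rintro k s - ⟨⟨h, -⟩, -⟩
    simp [NExp.eval, h.size]
  · rintro k s hk ⟨⟨h, hσ⟩, hT, hs⟩ h3
    have hIco : Ico k (N * N) = insert k (Ico (k + 1) (N * N)) := by
      ext e; simp only [mem_Ico, mem_insert]; omega
    have hNpos : 0 < N := Nat.pos_of_ne_zero (by rintro rfl; simp at hk)
    refine ((runs_decodeCmd h.size h3 (by omega)).seq (T₂ := K * 100 + 38)
      ?_).withFrame.mono (by omega)
      (Q := fun s' => (Tournament W M σ {e ∈ events N x | e < k + 1} s' ∧
        ∀ p < N, s'.nat 5 p = sweepSlot N x (Ico (k + 1) (N * N)) ∅ p) ∧ Frame _ s s')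
      (fun s' h' => ⟨⟨h.of_frame h'.2, (h'.2.real 6 rfl).trans hσ⟩, h'.1⟩)
    rintro _ rfl -
    refine (Runs.ite (T := K * 100 + 30) (fun hb => ?_) (fun hb => ?_)).mono
      (by simp [BExp.cost, NExp.cost, RExp.cost]; omega) (fun _ => id)
    · have hke : k ∈ events N x := by
        simp [BExp.Holds, RExp.eval, NExp.eval, h.x] at hb
        exact mem_events.2 ⟨hk, hb⟩
      have hkm := mod_lt_of_mem_events hke
      have hval : s.nat 5 (k % N) + 1 ≤ W := by
        have := sweepSlot_lt (N := N) (x := x) (D₁ := Ico k (N * N)) (D₂ := ∅) hkm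
        rw [← hs _ hkm] at this
        omega
      refine (Runs.seq (T₁ := 9) (T₂ := K * 100 + 20) (Q := fun s' =>
        s' = ((s.setNat 12 0 (k / N)).setNat 13 0 (k % N)).setNat 5 (k % N) (s.nat 5 (k % N) + 1))
        (Runs.straight ?_ (by decide) ?_) ?_).mono (by omega) (fun _ => id)
      · simpa [Cmd.Safe, NExp.eval] using hval
      · simp [Cmd.post, NExp.eval]
      rintro _ rfl -
      have hset := runs_setLeaf (W := W) (i := var 3) (v := .add (var 3) (.lit 1))
        (s := ((s.setNat 12 0 (k / N)).setNat 13 0 (k % N)).setNat 5 (k % N)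
          (s.nat 5 (k % N) + 1)) (D := {e ∈ events N x | e < k})
        (D' := {e ∈ events N x | e < k + 1}) (e := k) (σ := σ) hM hMW hσ (by simpa using h.leaves)
        ⟨by simpa using hT.word, by simpa using hT.tree, by simpa using hT.leaf⟩
        (by simpa [NExp.eval] using h3) (by omega) ?_ ?_
      · refine hset.withFrame.mono (by simp only [NExp.cost]; omega)
          (fun s' h' => ⟨h'.1, fun p hp => ?_⟩)
        rw [h'.2.nat 5 rfl]
        have hins := sweepSlot_insert_left (D₁ := Ico (k + 1) (N * N)) (D₂ := ∅) hke (by simp) hp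
        rw [← hIco, ← hs p hp] at hins
        simp only [Mem.nat_setNat_self, Function.update_apply]
        split_ifs at hins ⊢ with hpk
        · rw [← hpk]; simpa using hins
        · simpa using hins
      · simp [NExp.eval, h3, hke]
      · intro e' _ hne
        simp only [mem_filter]
        refine and_congr_right fun _ => ?_
        omega
    · have hke : k ∉ events N x := by
        simp [BExp.Holds, RExp.eval, NExp.eval, h.x] at hb
        rw [mem_events]
        rintro ⟨-, h'⟩
        exact absurd h' (not_lt.2 hb)
      have hD : ({e ∈ events N x | e < k + 1} : Finset ℕ) = {e ∈ events N x | e < k} := by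
        refine filter_congr fun e he => ?_
        have : e ≠ k := by rintro rfl; exact hke he
        omega
      refine Runs.straight trivial (by simp [Cmd.maxCost]) ?_
      simp only [Cmd.post]
      refine ⟨?_, fun p hp => ?_⟩
      · rw [hD]
        exact ⟨by simpa using hT.word, by simpa using hT.tree, by simpa using hT.leaf⟩
      · have := hs p hp
        rw [hIco, sweepSlot_insert_left_of_notMem hke hp] at this
        simpa using this
  · obtain ⟨-, hT, hs⟩ := h
    rw [filter_true_of_mem (fun e he => (mem_events.1 he).1)] at hT
    simp only [Ico_self] at hs
    exact ⟨hT, hs⟩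

/-! ### The maximum subarray tree in memory -/

/-- The program that stores the maximum of `e` and `f` in the real array `a`. -/
def storeMax (a : ℕ) (i : NExp) (e f : RExp) : Cmd :=
  .ite (.rlt e f) (.setReal a i f) (.setReal a i e)

theorem post_storeMax (a : ℕ) (i : NExp) (e f : RExp) (s : Mem) :
    (storeMax a i e f).post s = s.setReal a (i.eval s) (max (e.eval s) (f.eval s)) := by
  rw [storeMax, Cmd.post]
  split_ifs with h
  · rw [Cmd.post, max_eq_right (le_of_lt h)]
  · rw [Cmd.post, max_eq_left (not_lt.1 h)]

theorem safe_storeMax (W a : ℕ) (i : NExp) (e f : RExp) (s : Mem) :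
    (storeMax a i e f).Safe W s :=
  ⟨fun _ => trivial, fun _ => trivial⟩

/-- The summary stored at a node of the tree in the real arrays `7`, `8`, `9` and `10`. -/
noncomputable def summaryAt (s : Mem) (i : ℕ) : Summary :=
  (s.real 7 i, s.real 8 i, s.real 9 i, s.real 10 i)

/-- The program that computes `Summary.append` at a node. -/
def appendBody : Cmd :=
  .seq (.setReal 7 (var 8) (.add (.get 7 leftChild) (.get 7 rightChild)))
  (.seq (storeMax 8 (var 8) (.get 8 leftChild) (.add (.get 7 leftChild) (.get 8 rightChild)))
  (.seq (storeMax 9 (var 8) (.get 9 rightChild) (.add (.get 9 leftChild) (.get 7 rightChild)))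
  (.seq (storeMax 10 (var 8) (.get 10 leftChild) (.get 10 rightChild))
    (storeMax 10 (var 8) (.get 10 (var 8)) (.add (.get 9 leftChild) (.get 8 rightChild))))))

theorem runs_appendBody {W j : ℕ} {s : Mem} (hj : 1 ≤ j) (h8 : s.nat 8 0 = j) :
    Runs W appendBody s 160 (fun s' => s'.nat 8 0 = j ∧ summaryAt s' =
      Function.update (summaryAt s) j
        ((summaryAt s (2 * j)).append (summaryAt s (2 * j + 1)))) := by
  have h2 : 2 * j ≠ j := by omega
  have h3 : 2 * j + 1 ≠ j := by omega
  refine Runs.straight ⟨trivial, ?_⟩ (by decide) ?_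
  · refine ⟨safe_storeMax _ _ _ _ _ _, safe_storeMax _ _ _ _ _ _, safe_storeMax _ _ _ _ _ _,
      safe_storeMax _ _ _ _ _ _⟩
  · simp only [appendBody, Cmd.post, post_storeMax, NExp.eval, RExp.eval, Mem.nat_setReal, h8]
    refine ⟨trivial, funext fun i => ?_⟩
    by_cases hi : i = j
    · subst hi
      simp [summaryAt, Summary.append, h2, h3]
    · simp [summaryAt, hi]

/-- The tree holds the points with colours `c`, each at the leaf given by its slot; a point with a
slot that is not less than `M` is not in the tree. -/
structure SlotTree (N M : ℕ) (c : ℕ → ℝ) (slot : ℕ → ℕ) (s : Mem) : Prop where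
  tree : IsTree Summary.append M (summaryAt s)
  leaf : ∀ k < M, summaryAt s (M + k) = slotLeaf N c slot k

/-- The program that adds the point with number in the word variable `12`, with multiplicity `z`,
to the slot in the word variable `14`. -/
def bump (z : RExp) : Cmd :=
  .seq (.setNat 8 (.lit 0) (.add (var 2) (var 14)))
  (.seq (.setReal 7 (var 8) (.add (.get 7 (var 8))
      (.mul z (.sub (.add (.get 5 (var 12)) (.get 5 (var 12))) (.ofNat (.lit 1))))))
  (.seq (.setReal 8 (var 8) (.add (.get 8 (var 8)) (.mul z (.get 5 (var 12)))))
  (.seq (.setReal 9 (var 8) (.add (.get 9 (var 8)) (.mul z (.get 5 (var 12)))))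
    (climb appendBody))))

section Bump

variable {W N M K : ℕ} {x y c : ℕ → ℝ} {s : Mem}

theorem runs_bump {slot slot' : ℕ → ℕ} {p k : ℕ} {z : RExp} {v : ℝ} (hM : M = 2 ^ K)
    (hMW : 2 * M ≤ W) (hs : Base N M x y c s) (hT : SlotTree N M c slot s) (hp : s.nat 12 0 = p)
    (hk : s.nat 14 0 = k) (hkM : k < M) (hz : ∀ s, z.eval s = v) (hzc : z.cost ≤ 10)
    (hslot : ∀ j < M, slotLeaf N c slot' j = slotLeaf N c slot j +
      if k = j then (v * (2 * c p - 1), v * c p, v * c p, 0) else 0) :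
    Runs W (bump z) s (K * 180 + 100) (SlotTree N M c slot') := by
  have h2 := hs.leaves
  refine (Runs.seq (T₁ := 10) (T₂ := K * 171 + 90)
    (Q := fun s' => s' = s.setNat 8 0 (M + k)) (Runs.straight ?_ (by decide) ?_) ?_).mono
    (by omega) (fun _ => id)
  · simp only [Cmd.Safe, NExp.eval, h2, hk]; omega
  · simp only [Cmd.post, NExp.eval, h2, hk]
  rintro _ rfl -
  set L := summaryAt s (M + k) + (v * (2 * c p - 1), v * c p, v * c p, 0) with hL
  suffices H : Runs W (.seq _ (.seq _ (.seq _ (climb appendBody)))) (s.setNat 8 0 (M + k))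
      (K * 171 + 90) (fun s' => True ∧ IsTree Summary.append M (summaryAt s') ∧
        ∀ i, M ≤ i → summaryAt s' i = Function.update (summaryAt s) (M + k) L i) by
    refine H.mono le_rfl fun s' h => ⟨h.2.1, fun j hj => ?_⟩
    rw [h.2.2 _ (by omega), hslot j hj, ← hT.leaf j hj]
    by_cases hkj : k = j
    · subst hkj; simp [hL]
    · rw [if_neg hkj, add_zero, Function.update_of_ne (by omega)]
  have hc5 := hs.colour
  set s₁ := s.setNat 8 0 (M + k) with hs₁
  set s₂ := s₁.setReal 7 (M + k) (s.real 7 (M + k) + v * (c p + c p - 1)) with hs₂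
  set s₃ := s₂.setReal 8 (M + k) (s.real 8 (M + k) + v * c p) with hs₃
  set s₄ := s₃.setReal 9 (M + k) (s.real 9 (M + k) + v * c p) with hs₄
  refine (Runs.seq (T₁ := 28) (T₂ := K * 171 + 62) (Q := fun s' => s' = s₂)
    (Runs.straight (by exact trivial) ?_ ?_) ?_).mono (by omega) (fun _ => id)
  · simp only [Cmd.maxCost, NExp.cost, RExp.cost]; omega
  · simp [Cmd.post, NExp.eval, RExp.eval, hs₂, hs₁, hz, hc5, hp]
  rintro _ rfl -
  refine (Runs.seq (T₁ := 24) (T₂ := K * 171 + 34) (Q := fun s' => s' = s₃)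
    (Runs.straight (by exact trivial) ?_ ?_) ?_).mono (by omega) (fun _ => id)
  · simp only [Cmd.maxCost, NExp.cost, RExp.cost]; omega
  · simp [Cmd.post, NExp.eval, RExp.eval, hs₃, hs₂, hs₁, hz, hc5, hp]
  rintro _ rfl -
  refine (Runs.seq (T₁ := 24) (T₂ := K * 171 + 5) (Q := fun s' => s' = s₄)
    (Runs.straight (by exact trivial) ?_ ?_) ?_).mono (by omega) (fun _ => id)
  · simp only [Cmd.maxCost, NExp.cost, RExp.cost]; omega
  · simp [Cmd.post, NExp.eval, RExp.eval, hs₄, hs₃, hs₂, hs₁, hz, hc5, hp]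
  rintro _ rfl -
  refine (Runs.climb (op := Summary.append) (tr := summaryAt) (inv := fun _ => True) (D := 160)
    (h := M + k) (T₀ := summaryAt s) (x := L) hM (by omega) (fun _ _ => rfl) (fun _ _ h => h)
    (fun s j _ hj _ h8 => ?_) trivial ?_ (by omega) (by omega) hT.tree ?_).mono le_rfl
    (fun _ h => h)
  · exact (runs_appendBody hj h8).mono le_rfl fun s' h => ⟨trivial, h⟩
  · simp [hs₄, hs₃, hs₂, hs₁]
  · funext i
    by_cases hi : i = M + k
    · subst hi
      simp [summaryAt, hL, hs₄, hs₃, hs₂, hs₁, two_mul]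
    · simp [summaryAt, hi, hs₄, hs₃, hs₂, hs₁]

theorem runs_bump_one {slot : ℕ → ℕ} {p k : ℕ} (hM : M = 2 ^ K) (hMW : 2 * M ≤ W)
    (hs : Base N M x y c s) (hT : SlotTree N M c slot s) (hp : s.nat 12 0 = p) (hpN : p < N)
    (hk : s.nat 14 0 = k) (hkM : k < M) (hslot : slot p = M) :
    Runs W (bump (.ofNat (.lit 1))) s (K * 180 + 100)
      (SlotTree N M c (Function.update slot p k)) := by
  refine runs_bump (v := 1) hM hMW hs hT hp hk hkM (fun s => by simp [RExp.eval, NExp.eval])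
    (by decide) fun j hj => ?_
  rw [slotLeaf_update hpN, hslot]
  congr 1
  have hMj : ¬ M = j := by omega
  simp only [if_neg hMj]
  split_ifs <;> simp

theorem runs_bump_neg_one {p k : ℕ} {slot : ℕ → ℕ} (hM : M = 2 ^ K) (hMW : 2 * M ≤ W)
    (hs : Base N M x y c s) (hT : SlotTree N M c slot s) (hp : s.nat 12 0 = p) (hpN : p < N)
    (hk : s.nat 14 0 = k) (hkM : k < M) (hslot : slot p = k) :
    Runs W (bump (.sub (.ofNat (.lit 0)) (.ofNat (.lit 1)))) s (K * 180 + 100)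
      (SlotTree N M c (Function.update slot p M)) := by
  refine runs_bump (v := -1) hM hMW hs hT hp hk hkM (fun s => by simp [RExp.eval, NExp.eval])
    (by decide) fun j hj => ?_
  rw [slotLeaf_update hpN, hslot]
  congr 1
  have hMj : ¬ M = j := by omega
  simp only [if_neg hMj]
  split_ifs <;> simp

/-- The program that moves the point with number in the word variable `12` to the slot `e`, where
`e` may refer to the old slot as the word variable `14`. -/
def moveCmd (e : NExp) : Cmd :=
  .seq (.setNat 14 (.lit 0) (.get 5 (var 12)))
  (.seq (bump (.sub (.ofNat (.lit 0)) (.ofNat (.lit 1))))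
  (.seq (.setNat 14 (.lit 0) e)
  (.seq (.setNat 5 (var 12) (var 14))
    (bump (.ofNat (.lit 1))))))

theorem SlotTree.setNat {slot : ℕ → ℕ} (h : SlotTree N M c slot s) (a i v : ℕ) :
    SlotTree N M c slot (s.setNat a i v) :=
  ⟨h.tree, h.leaf⟩

theorem runs_moveCmd {p k : ℕ} {e : NExp} (hM : M = 2 ^ K) (hMW : 2 * M ≤ W)
    (hs : Base N M x y c s) (hT : SlotTree N M c (s.nat 5) s) (hp : s.nat 12 0 = p) (hpN : p < N)
    (hslot : s.nat 5 p < M) (hk : k < M) (he : ∀ s', s'.nat 14 0 = s.nat 5 p → e.eval s' = k)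
    (hec : e.cost ≤ 10) :
    Runs W (moveCmd e) s (K * 360 + 240) (fun s' => s'.nat 5 = Function.update (s.nat 5) p k ∧
      SlotTree N M c (s'.nat 5) s') := by
  refine (Runs.seq (T₁ := 10) (T₂ := K * 360 + 230)
    (Q := fun s' => s' = s.setNat 14 0 (s.nat 5 p)) (Runs.straight ?_ (by decide) ?_) ?_).mono
    (by omega) (fun _ => id)
  · simp only [Cmd.Safe, NExp.eval, hp]; omega
  · simp only [Cmd.post, NExp.eval, hp]
  rintro _ rfl -
  refine ((runs_bump_neg_one (s := s.setNat 14 0 (s.nat 5 p)) (p := p) (k := s.nat 5 p) hM hMW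
    (hs.setNat _ _) (hT.setNat _ _ _) (by simpa using hp) hpN (by simp) hslot rfl).seq
    (T₂ := K * 180 + 130) ?_).mono (by omega) (fun _ => id)
  intro s₁ hT₁ hf
  have hb₁ : Base N M x y c s₁ := (hs.setNat (a := 14) 0 (s.nat 5 p)).of_frame hf
  have h5 : s₁.nat 5 = s.nat 5 := by rw [hf.nat 5 rfl]; simp
  have h14 : s₁.nat 14 0 = s.nat 5 p := by rw [hf.nat 14 rfl]; simp
  have h12 : s₁.nat 12 0 = p := by rw [hf.nat 12 rfl]; simpa using hp
  refine (Runs.seq (T₁ := 12) (T₂ := K * 180 + 118)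
    (Q := fun s' => s' = s₁.setNat 14 0 k) (Runs.straight ?_ ?_ ?_) ?_).mono
    (by omega) (fun _ => id)
  · simp only [Cmd.Safe, he _ h14]; omega
  · simp only [Cmd.maxCost, NExp.cost]; omega
  · simp only [Cmd.post, NExp.eval, he _ h14]
  rintro _ rfl -
  refine (Runs.seq (T₁ := 10) (T₂ := K * 180 + 100)
    (Q := fun s' => s' = (s₁.setNat 14 0 k).setNat 5 p k) (Runs.straight ?_ (by decide) ?_)
    ?_).mono (by omega) (fun _ => id)
  · simp [Cmd.Safe, NExp.eval]; omega
  · simp [Cmd.post, NExp.eval, h12]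
  rintro _ rfl -
  refine (runs_bump_one (s := (s₁.setNat 14 0 k).setNat 5 p k) (p := p) (k := k) hM hMW
    ((hb₁.setNat _ _).setNat _ _) ((hT₁.setNat _ _ _).setNat _ _ _) (by simpa using h12) hpN
    (by simp) hk (by simp)).withFrame.mono le_rfl ?_
  rintro s' ⟨hT', hf'⟩
  have h5' : s'.nat 5 = Function.update (s.nat 5) p k := by
    rw [hf'.nat 5 rfl]; simp [h5]
  refine ⟨h5', ?_⟩
  rw [Function.update_idem] at hT'
  rw [h5']
  exact hT'

/-- The program that puts all points into the tree. -/
def insertCmd : Cmd :=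
  forTo (var 1) (.seq (.setNat 12 (.lit 0) (var 3))
    (.seq (.setNat 14 (.lit 0) (.get 5 (var 3))) (bump (.ofNat (.lit 1)))))

/-- A point not yet in the tree is represented by the slot `M`. -/
theorem runs_insertCmd (hM : M = 2 ^ K) (hMW : 2 * M ≤ W) (hNM : N ≤ M) (hs : Base N M x y c s)
    (hslot : ∀ p < N, s.nat 5 p < M) (h7 : s.real 7 = fun _ => 0) (h8 : s.real 8 = fun _ => 0)
    (h9 : s.real 9 = fun _ => 0) (h10 : s.real 10 = fun _ => 0) :
    Runs W insertCmd s (N * (K * 180 + 130) + 20) (SlotTree N M c (s.nat 5)) := by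
  have hcongr : ∀ (f g : ℕ → ℕ) (s : Mem), (∀ p < N, f p = g p) → SlotTree N M c f s →
      SlotTree N M c g s := by
    refine fun f g s h hT => ⟨hT.tree, fun k hk => ?_⟩
    rw [hT.leaf k hk, slotLeaf, slotLeaf]
    congr 1
    · exact sum_congr rfl fun p hp => by rw [h p (mem_range.1 hp)]
    · congr 1
      · exact sum_congr rfl fun p hp => by rw [h p (mem_range.1 hp)]
      · congr 1
        exact sum_congr rfl fun p hp => by rw [h p (mem_range.1 hp)]
  refine (Runs.forTo (n := N) (D := K * 180 + 110) (fun k s' => Base N M x y c s' ∧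
    s'.nat 5 = s.nat 5 ∧ SlotTree N M c (fun p => if p < k then s.nat 5 p else M) s')
    (by omega) rfl ⟨hs, rfl, ⟨?_, ?_⟩⟩ ?_ ?_ ?_).mono
    (by simp only [NExp.cost]
        exact Nat.add_le_add (Nat.mul_le_mul_left _ (by omega)) (by omega)) ?_
  · intro i _ _; simp [summaryAt, h7, h8, h9, h10, Summary.append]
  · intro k hk
    simp [summaryAt, h7, h8, h9, h10, slotLeaf, hk.ne']
  · rintro k s' v ⟨h1, h2, h3⟩
    exact ⟨h1.setNat _ _, by simpa using h2, h3.setNat _ _ _⟩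
  · rintro k s' - ⟨h1, -⟩
    simpa [NExp.eval] using h1.size
  · rintro k s' hk ⟨hb, h5, hT⟩ h3
    have hsk := hslot k hk
    refine (Runs.seq (T₁ := 4) (T₂ := K * 180 + 106)
      (Q := fun s'' => s'' = s'.setNat 12 0 k) (Runs.straight ?_ (by decide) ?_) ?_).withFrame.mono
      (by omega) (Q := fun s'' => (SlotTree N M c (fun p => if p < k + 1 then s.nat 5 p else M) s''
        ∧ s''.nat 5 = s.nat 5) ∧ Frame _ s' s'') (fun s'' h => ⟨hb.of_frame h.2, h.1.2, h.1.1⟩)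
    · simp only [Cmd.Safe, NExp.eval, h3]; omega
    · simp only [Cmd.post, NExp.eval, h3]
    rintro _ rfl -
    refine (Runs.seq (T₁ := 6) (T₂ := K * 180 + 100)
      (Q := fun s'' => s'' = (s'.setNat 12 0 k).setNat 14 0 (s.nat 5 k))
      (Runs.straight ?_ (by decide) ?_) ?_).mono (by omega) (fun _ => id)
    · simp [Cmd.Safe, NExp.eval, h3, h5]; omega
    · simp [Cmd.post, NExp.eval, h3, h5]
    rintro _ rfl -
    refine (runs_bump_one (p := k) (k := s.nat 5 k) hM hMW ((hb.setNat _ _).setNat _ _)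
      ((hT.setNat _ _ _).setNat _ _ _) (by simp) hk (by simp) hsk (by simp)).withFrame.mono
      le_rfl ?_
    rintro s'' ⟨h, hf⟩
    refine ⟨hcongr _ _ _ (fun p hp => ?_) h, ?_⟩
    · by_cases hpk : p = k
      · subst hpk; simp
      · rw [Function.update_of_ne hpk]
        have : p < k + 1 ↔ p < k := by omega
        simp only [this]
    · rw [hf.nat 5 rfl]; simpa using h5
  · rintro s' ⟨-, -, h⟩
    exact hcongr _ _ _ (fun p hp => by simp [hp]) h

end Bump

/-! ### The sweep -/

/-- What the sweep needs to know about the points: the colours are between `0` and `1`, points with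
the same abscissa are equal (a point may occur twice, with both colours), and no line that is not
vertical contains all points. -/
structure IsPointSet (N : ℕ) (x y c : ℕ → ℝ) : Prop where
  colour : ∀ i, 0 ≤ c i ∧ c i ≤ 1
  eq_of_eq : ∀ i < N, ∀ j < N, x i = x j → y i = y j
  not_line : ∀ m, ∃ i < N, ∃ j < N, lineHeight x y m i < lineHeight x y m j

/-- The program that, if the word variable `11` is set, updates the best value (real array `11`)
and its slope (real array `12`) from the root of the tree, and resets the word variable. -/
def checkCmd : Cmd :=
  .ite (.nlt (.lit 0) (var 11))
    (.seq (.ite (.rlt (.get 11 (.lit 0)) (.get 10 (.lit 1)))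
        (.seq (.setReal 11 (.lit 0) (.get 10 (.lit 1)))
          (.setReal 12 (.lit 0) (.get 6 (.get 6 (var 10)))))
        .skip)
      (.setNat 11 (.lit 0) (.lit 0)))
    .skip

/-- The program for the event in which the right point of a pair joins the left point. -/
def mergeCmd : Cmd :=
  .seq (.setNat 12 (.lit 0)
      (.sub (.get 6 (var 9)) (.mul (.div (.get 6 (var 9)) (var 1)) (var 1))))
  (.seq (moveCmd (.sub (var 14) (.lit 1)))
  (.seq (.setNat 9 (.lit 0) (.add (var 9) (.lit 1)))
    (.setNat 11 (.lit 0) (.lit 1))))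

/-- The program for the event in which the left point of a pair goes on. -/
def splitCmd : Cmd :=
  .seq checkCmd
  (.seq (.setNat 12 (.lit 0) (.div (.get 6 (var 10)) (var 1)))
  (.seq (moveCmd (.add (var 14) (.lit 1)))
    (.setNat 10 (.lit 0) (.add (var 10) (.lit 1)))))

/-- The program that goes through the sorted events with two pointers, in the word variables `9`
(next pair to merge) and `10` (next pair to split). -/
def sweepCmd : Cmd :=
  .loop (.nlt (var 10) (var 7))
    (.ite (.conj (.nlt (var 9) (var 7))
        (.neg (.rlt (.get 6 (.get 6 (var 10))) (.get 6 (.get 6 (var 9))))))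
      mergeCmd splitCmd)

section Sweep

variable {W N M K E : ℕ} {x y c σ : ℕ → ℝ} {ord : ℕ → ℕ}

/-- No strip of slope `m` is better than the best value so far. -/
def Covered (N : ℕ) (x y c : ℕ → ℝ) (m : ℝ) (s : Mem) : Prop :=
  ∀ c₁ c₂, stripVal N c (lineHeight x y m) c₁ c₂ ≤ s.real 11 0

/-- The best value so far is attained up to any error by strips whose slope is stored. -/
def BestSound (N : ℕ) (x y c : ℕ → ℝ) (s : Mem) : Prop :=
  ∀ z, (∀ c₁ c₂, stripVal N c (lineHeight x y (s.real 12 0)) c₁ c₂ ≤ z) → s.real 11 0 ≤ z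

/-- The state of the sweep that does not concern the best value, when the pairs `ord i` with
`i < e₁` are merged, and those with `i < e₂` are split. -/
structure SweepState (N M : ℕ) (x y c σ : ℕ → ℝ) (E : ℕ) (ord : ℕ → ℕ) (e₁ e₂ : ℕ) (s : Mem) :
    Prop where
  base : Base N M x y c s
  key : s.real 6 = σ
  perm : s.nat 6 = ord
  num : s.nat 7 0 = E
  ptr₁ : s.nat 9 0 = e₁
  ptr₂ : s.nat 10 0 = e₂
  le : e₂ ≤ e₁
  le' : e₁ ≤ E
  slot : ∀ p < N, s.nat 5 p =
    sweepSlot N x ((range e₁).image ord) ((range e₂).image ord) p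
  tree : SlotTree N M c (s.nat 5) s
  group : ∀ i, e₂ ≤ i → i < e₁ → σ (ord i) = σ (ord e₂)

/-- All directions of merged pairs have been examined, and all merged pairs have a slope less than
those of the other pairs. -/
structure Examined (N : ℕ) (x y c σ : ℕ → ℝ) (E : ℕ) (ord : ℕ → ℕ) (e₁ : ℕ) (s : Mem) :
    Prop where
  flag : s.nat 11 0 = 0
  sound : BestSound N x y c s
  covered : ∀ i < e₁, Covered N x y c (σ (ord i)) s
  lt : e₁ < E → ∀ i < e₁, σ (ord i) < σ (ord e₁)

/-- The current group of pairs is being merged, and none of its pairs is split. -/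
structure Merging (N : ℕ) (x y c σ : ℕ → ℝ) (ord : ℕ → ℕ) (e₁ e₂ : ℕ) (s : Mem) : Prop where
  flag : s.nat 11 0 = 1
  sound : BestSound N x y c s
  covered : ∀ i < e₂, Covered N x y c (σ (ord i)) s
  lt : e₂ < e₁
  lt' : ∀ i < e₂, σ (ord i) < σ (ord e₂)

theorem IsSorting.mem_iff_lt {D : Finset ℕ} (h : IsSorting σ D E ord) {k i : ℕ} (hk : k ≤ E)
    (hi : i < E) : ord i ∈ (range k).image ord ↔ i < k := by
  rw [mem_image]
  constructor
  · rintro ⟨j, hj, hij⟩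
    have hj := mem_range.1 hj
    obtain rfl := h.inj (by simp; omega) (by simpa using hi) hij
    exact hj
  · exact fun hik => ⟨i, mem_range.2 hik, rfl⟩

theorem IsSorting.ord_mem {D : Finset ℕ} (h : IsSorting σ D E ord) {i : ℕ} (hi : i < E) :
    ord i ∈ D := by
  rw [← h.image]; exact mem_image_of_mem _ (mem_range.2 hi)

theorem IsSorting.exists_eq {D : Finset ℕ} (h : IsSorting σ D E ord) {e : ℕ} (he : e ∈ D) :
    ∃ i < E, ord i = e := by
  rw [← h.image] at he
  simpa using he

theorem image_range_succ (f : ℕ → ℕ) (k : ℕ) :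
    (range (k + 1)).image f = insert (f k) ((range k).image f) := by
  rw [range_add_one, image_insert]

/-- A pair is merged only if its slope is that of the next pair to be split. If the current group
has been examined, this forces the pointers to agree, and a new group begins. -/
theorem runs_mergeCmd {e₁ e₂ : ℕ} {s : Mem} (hM : M = 2 ^ K) (hMW : 2 * M ≤ W)
    (hNM : N * N ≤ M) (hord : IsSorting σ (events N x) E ord)
    (hs : SweepState N M x y c σ E ord e₁ e₂ s) (he₁ : e₁ < E)
    (hle : σ (ord e₁) ≤ σ (ord e₂))
    (hex : Examined N x y c σ E ord e₁ s ∨ Merging N x y c σ ord e₁ e₂ s) :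
    Runs W mergeCmd s (K * 360 + 290) (fun s' => SweepState N M x y c σ E ord (e₁ + 1) e₂ s' ∧
      Merging N x y c σ ord (e₁ + 1) e₂ s') := by
  have hN : N ≤ N * N := Nat.le_mul_self N
  have hev := hord.ord_mem he₁
  have hevN := (mem_events.1 hev).1
  set p := ord e₁ % N with hp
  have hpN : p < N := mod_lt_of_mem_events hev
  have hmod : ord e₁ - ord e₁ / N * N = p := by rw [hp, Nat.mod_def, Nat.mul_comm]
  have hnew : ord e₁ ∉ (range e₁).image ord := by rw [hord.mem_iff_lt he₁.le he₁]; simp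
  have hslot : ∀ q < N, s.nat 5 q = sweepSlot N x ((range (e₁ + 1)).image ord)
      ((range e₂).image ord) q + if q = p then 1 else 0 := by
    intro q hq
    rw [hs.slot q hq, image_range_succ, ← sweepSlot_insert_left hev hnew hq]
  have hspN : s.nat 5 p < N := by rw [hs.slot p hpN]; exact sweepSlot_lt hpN
  -- By `hslot` the old slot of `p` is positive, so that the subtraction is not truncated.
  refine ((Runs.seq (T₁ := 20) (T₂ := K * 360 + 270) (Q := fun s' => s' = s.setNat 12 0 p)
    (Runs.straight ?_ (by decide) ?_) ?_).mono (by omega) (fun _ => id)).withFrame.mono le_rfl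
    (Q := fun s' => (s'.nat 9 0 = e₁ + 1 ∧ s'.nat 11 0 = 1 ∧
      s'.nat 5 = Function.update (s.nat 5) p (s.nat 5 p - 1) ∧ SlotTree N M c (s'.nat 5) s') ∧
      Frame _ s s') ?_
  · simp only [Cmd.Safe, NExp.eval, hs.perm, hs.ptr₁, hs.base.size, hmod]; omega
  · simp only [Cmd.post, NExp.eval, hs.perm, hs.ptr₁, hs.base.size, hmod]
  · rintro _ rfl -
    refine (Runs.seq (T₁ := K * 360 + 240) (T₂ := 30) (runs_moveCmd (s := s.setNat 12 0 p) (p := p)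
      (k := s.nat 5 p - 1) hM hMW (hs.base.setNat _ _) (by simpa using hs.tree.setNat 12 0 p)
      (by simp) hpN
      (by simp; omega) (by omega) (fun s' h => ?_) (by decide)) ?_).mono (by omega) (fun _ => id)
    · simp at h; simp [NExp.eval, h]
    rintro s' ⟨h5, hT⟩ hf
    have h9 : s'.nat 9 0 = e₁ := by rw [hf.nat 9 rfl]; simpa using hs.ptr₁
    have hEW : e₁ + 1 ≤ W := by
      have : (range E).card ≤ (range (N * N)).card := by
        rw [← card_image_of_injOn hord.inj, hord.image]
        exact card_le_card (filter_subset _ _)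
      simp only [card_range] at this
      omega
    refine Runs.straight ?_ (by decide) ?_
    · simp only [Cmd.Safe, NExp.eval, h9]; exact ⟨hEW, by omega⟩
    · simp only [Cmd.post, NExp.eval, h9]
      refine ⟨by simp, by simp, by simpa using h5, ?_⟩
      exact (((by simpa using hT : SlotTree N M c _ s').setNat _ _ _).setNat _ _ _)
  · rintro s' ⟨⟨h9, h11, h5, hT⟩, hf⟩
    have hr11 : s'.real 11 = s.real 11 := hf.real 11 rfl
    have hr12 : s'.real 12 = s.real 12 := hf.real 12 rfl
    have hbest : BestSound N x y c s → BestSound N x y c s' := by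
      simp only [BestSound, hr11, hr12]; exact id
    have hcov : ∀ m, Covered N x y c m s → Covered N x y c m s' := by
      simp only [Covered, hr11]; exact fun _ => id
    refine ⟨⟨hs.base.of_frame hf, (hf.real 6 rfl).trans hs.key, (hf.nat 6 rfl).trans hs.perm,
      by rw [hf.nat 7 rfl, hs.num], h9, by rw [hf.nat 10 rfl, hs.ptr₂], by have := hs.le; omega,
      he₁, ?_, hT, ?_⟩, ?_⟩
    · intro q hq
      have h1 := hslot q hq
      rw [h5, Function.update_apply]
      split_ifs at h1 ⊢ with hqp
      · rw [← hqp]; omega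
      · exact h1
    · intro i hi hi'
      rcases Nat.lt_succ_iff_lt_or_eq.1 hi' with hi' | rfl
      · exact hs.group i hi hi'
      · exact le_antisymm hle (hord.mono _ _ hi he₁)
    · rcases hex with h | h
      · have he : e₂ = e₁ := by
          by_contra hne
          have := hs.le
          exact absurd (h.lt he₁ e₂ (by omega)) (not_lt.2 hle)
        subst he
        exact ⟨h11, hbest h.sound, fun i hi => hcov _ (h.covered i hi), by omega, h.lt he₁⟩
      · exact ⟨h11, hbest h.sound, fun i hi => hcov _ (h.covered i hi),
          h.lt.trans (Nat.lt_succ_self _), h.lt'⟩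

/-- When the current group is complete and untouched by splits, the slots are the ranks in its
direction, so that the root of the tree is the maximal value of a strip of this direction. -/
theorem runs_checkCmd {e₁ e₂ : ℕ} {s : Mem} (hM : M = 2 ^ K) (hNM : N * N ≤ M)
    (hP : IsPointSet N x y c) (hσ : ∀ e < N * N, σ e = lineSlope x y (e / N) (e % N))
    (hord : IsSorting σ (events N x) E ord)
    (hs : SweepState N M x y c σ E ord e₁ e₂ s) (he : e₂ < e₁)
    (hgt : e₁ < E → σ (ord e₂) < σ (ord e₁))
    (hex : Examined N x y c σ E ord e₁ s ∨ Merging N x y c σ ord e₁ e₂ s) :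
    Runs W checkCmd s 40 (fun s' => Examined N x y c σ E ord e₁ s') := by
  have hlt : e₁ < E → ∀ i < e₁, σ (ord i) < σ (ord e₁) := by
    intro h i hi
    refine lt_of_le_of_lt ?_ (hgt h)
    rcases lt_or_ge i e₂ with hi' | hi'
    · exact hord.mono _ _ hi'.le (he.trans h)
    · exact (hs.group i hi' hi).le
  rcases hex with h | h
  · refine Runs.straight ?_ (by decide) ?_
    · simp [checkCmd, Cmd.Safe, BExp.Holds, NExp.eval, h.flag]
    · simpa [checkCmd, Cmd.post, BExp.Holds, NExp.eval, h.flag] using h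
  · have he₂E : e₂ < E := he.trans_le hs.le'
    have key : ∀ e ∈ events N x, lineSlope x y (e / N) (e % N) = σ e :=
      fun e he => (hσ e (mem_events.1 he).1).symm
    have hrank : ∀ p < N, s.nat 5 p = rank N (lineHeight x y (σ (ord e₂))) p := by
      intro p hp
      rw [hs.slot p hp]
      refine sweepSlot_eq_rank hP.eq_of_eq (fun e hev => ?_) (fun e hev => ?_) hp
      · rw [key e hev]
        obtain ⟨i, hi, rfl⟩ := hord.exists_eq hev
        rw [hord.mem_iff_lt hs.le' hi]
        constructor
        · intro hi1
          rcases lt_or_ge i e₂ with hi2 | hi2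
          · exact (h.lt' i hi2).le
          · exact (hs.group i hi2 hi1).le
        · intro hi1
          by_contra! hi2
          exact absurd ((hgt (by omega)).trans_le (hord.mono _ _ hi2 hi)) (not_lt.2 hi1)
      · rw [key e hev]
        obtain ⟨i, hi, rfl⟩ := hord.exists_eq hev
        rw [hord.mem_iff_lt (hs.le.trans hs.le') hi]
        constructor
        · exact h.lt' i
        · intro hi1
          by_contra! hi2
          exact absurd hi1 (not_lt.2 (hord.mono _ _ hi2 hi))
    have hroot := IsTree.root_le_iff_of_rank hM ((Nat.le_mul_self N).trans hNM) hs.tree.tree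
      hs.tree.leaf hrank hP.colour (hP.not_line _)
    simp only [summaryAt] at hroot
    -- It suffices that the new best value is the maximum of the old one and the root.
    have fin : ∀ s' : Mem, s'.nat 11 0 = 0 → BestSound N x y c s' →
        s.real 11 0 ≤ s'.real 11 0 → s.real 10 1 ≤ s'.real 11 0 →
        Examined N x y c σ E ord e₁ s' := by
      refine fun s' h1 h2 h3 h4 => ⟨h1, h2, fun i hi c₁ c₂ => ?_, hlt⟩
      rcases lt_or_ge i e₂ with hi' | hi'
      · exact (h.covered i hi' c₁ c₂).trans h3
      · rw [hs.group i hi' hi]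
        exact (hroot _).1 h4 c₁ c₂
    refine Runs.straight ?_ (by decide) ?_
    · refine ⟨fun _ => ⟨⟨fun _ => ⟨trivial, trivial⟩, fun _ => trivial⟩, Nat.zero_le _⟩,
        fun _ => trivial⟩
    · have hflag : (BExp.nlt (.lit 0) (var 11)).Holds s := by simp [BExp.Holds, NExp.eval, h.flag]
      rw [checkCmd, Cmd.post_ite_pos hflag, Cmd.post]
      by_cases hb : (BExp.rlt (.get 11 (.lit 0)) (.get 10 (.lit 1))).Holds s
      · rw [Cmd.post_ite_pos hb]
        simp only [BExp.Holds, RExp.eval, NExp.eval] at hb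
        simp only [Cmd.post, RExp.eval, NExp.eval]
        refine fin _ (by simp) ?_ (by simpa using hb.le) (by simp)
        intro z hz
        simp only [Mem.nat_setReal, hs.ptr₂, hs.perm, Mem.real_setNat, ne_eq, Nat.reduceEqDiff,
          not_false_eq_true, Mem.real_setReal_of_ne, hs.key, Mem.real_setReal_self,
          Function.update_self] at hz ⊢
        exact (hroot z).2 hz
      · rw [Cmd.post_ite_neg hb]
        simp only [BExp.Holds, RExp.eval, NExp.eval] at hb
        exact fin _ (by simp [Cmd.post, NExp.eval]) h.sound le_rfl (not_lt.1 hb)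

theorem runs_splitCmd {e₁ e₂ : ℕ} {s : Mem} (hM : M = 2 ^ K) (hMW : 2 * M ≤ W)
    (hNM : N * N ≤ M) (hP : IsPointSet N x y c)
    (hσ : ∀ e < N * N, σ e = lineSlope x y (e / N) (e % N))
    (hord : IsSorting σ (events N x) E ord)
    (hs : SweepState N M x y c σ E ord e₁ e₂ s) (he : e₂ < e₁)
    (hgt : e₁ < E → σ (ord e₂) < σ (ord e₁))
    (hex : Examined N x y c σ E ord e₁ s ∨ Merging N x y c σ ord e₁ e₂ s) :
    Runs W splitCmd s (K * 360 + 300) (fun s' => SweepState N M x y c σ E ord e₁ (e₂ + 1) s' ∧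
      Examined N x y c σ E ord e₁ s') := by
  have hN : N ≤ N * N := Nat.le_mul_self N
  have he₂E : e₂ < E := he.trans_le hs.le'
  have hev := hord.ord_mem he₂E
  have hevN := (mem_events.1 hev).1
  set p := ord e₂ / N with hp
  have hpN : p < N := div_lt_of_mem_events hev
  have hnew : ord e₂ ∉ (range e₂).image ord := by rw [hord.mem_iff_lt he₂E.le he₂E]; simp
  have hslot : ∀ q < N, sweepSlot N x ((range e₁).image ord)
      ((range (e₂ + 1)).image ord) q = s.nat 5 q + if q = p then 1 else 0 := by
    intro q hq
    rw [hs.slot q hq, image_range_succ, sweepSlot_insert_right hev hnew]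
  have hspN : s.nat 5 p + 1 < N := by
    have := sweepSlot_lt (N := N) (x := x) (D₁ := (range e₁).image ord)
      (D₂ := (range (e₂ + 1)).image ord) hpN
    rw [hslot p hpN, if_pos rfl] at this
    exact this
  refine ((runs_checkCmd hM hNM hP hσ hord hs he hgt hex).seq (T₂ := K * 360 + 260)
    (Q' := fun s' => Examined N x y c σ E ord e₁ s' ∧ s'.nat 10 0 = e₂ + 1 ∧
      s'.nat 5 = Function.update (s.nat 5) p (s.nat 5 p + 1) ∧ SlotTree N M c (s'.nat 5) s')
    ?_).withFrame.mono (by omega) ?_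
  · intro s₁ hex₁ hf₁
    have hb₁ := hs.base.of_frame hf₁
    have h5₁ : s₁.nat 5 = s.nat 5 := hf₁.nat 5 rfl
    have h10₁ : s₁.nat 10 0 = e₂ := by rw [hf₁.nat 10 rfl, hs.ptr₂]
    have h6₁ : s₁.nat 6 = ord := (hf₁.nat 6 rfl).trans hs.perm
    have hT₁ : SlotTree N M c (s₁.nat 5) s₁ := by
      have : summaryAt s₁ = summaryAt s := by
        funext i
        simp only [summaryAt, hf₁.real 7 rfl, hf₁.real 8 rfl, hf₁.real 9 rfl, hf₁.real 10 rfl]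
      rw [h5₁]
      exact ⟨this ▸ hs.tree.tree, this ▸ hs.tree.leaf⟩
    refine (Runs.seq (T₁ := 10) (T₂ := K * 360 + 250) (Q := fun s' => s' = s₁.setNat 12 0 p)
      (Runs.straight ?_ (by decide) ?_) ?_).mono (by omega) (fun _ => id)
    · simp only [Cmd.Safe, NExp.eval, h6₁, h10₁, hb₁.size, ← hp]; omega
    · simp only [Cmd.post, NExp.eval, h6₁, h10₁, hb₁.size, ← hp]
    rintro _ rfl -
    refine (Runs.seq (T₁ := K * 360 + 240) (T₂ := 10) (runs_moveCmd (s := s₁.setNat 12 0 p) (p := p)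
      (k := s.nat 5 p + 1) hM hMW (hb₁.setNat _ _) (by simpa using hT₁.setNat 12 0 p) (by simp) hpN
      (by simp [h5₁]; omega) (by omega) (fun s' h => ?_) (by decide)) ?_).mono (by omega)
      (fun _ => id)
    · simp [h5₁] at h; simp [NExp.eval, h]
    rintro s' ⟨h5, hT⟩ hf
    have h10 : s'.nat 10 0 = e₂ := by rw [hf.nat 10 rfl]; simpa using h10₁
    have hEW : e₂ + 1 ≤ W := by
      have : (range E).card ≤ (range (N * N)).card := by
        rw [← card_image_of_injOn hord.inj, hord.image]
        exact card_le_card (filter_subset _ _)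
      simp only [card_range] at this
      omega
    refine Runs.straight ?_ (by decide) ?_
    · simp only [Cmd.Safe, NExp.eval, h10]; exact hEW
    · simp only [Cmd.post, NExp.eval, h10]
      have hr11 : (s'.setNat 10 0 (e₂ + 1)).real 11 = s₁.real 11 := hf.real 11 rfl
      have hr12 : (s'.setNat 10 0 (e₂ + 1)).real 12 = s₁.real 12 := hf.real 12 rfl
      refine ⟨⟨?_, ?_, ?_, hex₁.lt⟩, by simp, ?_, ?_⟩
      · rw [Mem.nat_setNat_of_ne _ _ _ (by decide), hf.nat 11 rfl]
        simpa using hex₁.flag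
      · simpa only [BestSound, hr11, hr12] using hex₁.sound
      · simpa only [Covered, hr11] using hex₁.covered
      · simpa [h5₁] using h5
      · exact (by simpa using hT : SlotTree N M c _ s').setNat _ _ _
  · rintro s' ⟨⟨hex', h10, h5, hT⟩, hf⟩
    refine ⟨⟨hs.base.of_frame hf, (hf.real 6 rfl).trans hs.key, (hf.nat 6 rfl).trans hs.perm,
      by rw [hf.nat 7 rfl, hs.num], by rw [hf.nat 9 rfl, hs.ptr₁], h10, he, hs.le', ?_, hT, ?_⟩,
      hex'⟩
    · intro q hq
      rw [h5, Function.update_apply, hslot q hq]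
      split_ifs with hqp
      · rw [hqp]
      · rfl
    · intro i hi hi'
      rw [hs.group i (by omega) hi', hs.group (e₂ + 1) (by omega) (by omega)]

/-- After the sweep, the best value is the maximal value of a strip with the slope of a line through
two points. -/
theorem runs_sweepCmd {s : Mem} (hM : M = 2 ^ K) (hMW : 2 * M ≤ W) (hNM : N * N ≤ M)
    (hP : IsPointSet N x y c) (hσ : ∀ e < N * N, σ e = lineSlope x y (e / N) (e % N))
    (hord : IsSorting σ (events N x) E ord) (hs : SweepState N M x y c σ E ord 0 0 s)
    (h11 : s.nat 11 0 = 0) (hr11 : s.real 11 0 = 0) :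
    Runs W sweepCmd s (2 * E * (K * 360 + 330) + 10) (fun s' => BestSound N x y c s' ∧
      ∀ e ∈ events N x, Covered N x y c (lineSlope x y (e / N) (e % N)) s') := by
  refine (Runs.loop (2 * E) (K * 360 + 321) (fun k s' => ∃ e₁ e₂, e₁ + e₂ = k ∧
    SweepState N M x y c σ E ord e₁ e₂ s' ∧
    (Examined N x y c σ E ord e₁ s' ∨ Merging N x y c σ ord e₁ e₂ s')) ?_ ?_ ?_ ?_).mono ?_ ?_
  · refine ⟨0, 0, rfl, hs, .inl ⟨h11, fun z hz => ?_, by simp, by simp⟩⟩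
    rw [hr11]
    exact stripVal_one_zero.ge.trans (hz 1 0)
  · rintro k s' hk ⟨e₁, e₂, rfl, hs, -⟩
    have := hs.le
    have := hs.le'
    simp only [BExp.Holds, NExp.eval, hs.ptr₂, hs.num]
    omega
  · rintro k s' hk ⟨e₁, e₂, rfl, hs, hex⟩
    have h1 := hs.le
    have h2 := hs.le'
    refine (Runs.ite (T := K * 360 + 300) (fun hb => ?_) (fun hb => ?_)).mono
      (by simp only [BExp.cost, NExp.cost, RExp.cost]; omega) (fun _ => id)
    · simp only [BExp.Holds, NExp.eval, RExp.eval, hs.ptr₁, hs.ptr₂, hs.num, hs.perm, hs.key,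
        not_lt] at hb
      exact (runs_mergeCmd hM hMW hNM hord hs hb.1 hb.2 hex).mono (by omega)
        fun s'' h => ⟨e₁ + 1, e₂, by omega, h.1, .inr h.2⟩
    · simp only [BExp.Holds, NExp.eval, RExp.eval, hs.ptr₁, hs.ptr₂, hs.num, hs.perm, hs.key,
        not_and, not_not] at hb
      have he : e₂ < e₁ := by
        refine lt_of_le_of_ne h1 ?_
        rintro rfl
        exact lt_irrefl _ (hb (by omega))
      exact (runs_splitCmd hM hMW hNM hP hσ hord hs he hb hex).mono le_rfl
        fun s'' h => ⟨e₁, e₂ + 1, by omega, h.1, .inl h.2⟩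
  · rintro s' ⟨e₁, e₂, hk, hs, -⟩
    have := hs.le
    have := hs.le'
    simp only [BExp.Holds, NExp.eval, hs.ptr₂, hs.num]
    omega
  · simp only [BExp.cost, NExp.cost]
    exact Nat.add_le_add (Nat.mul_le_mul_left _ (by omega)) (by omega)
  · rintro s' ⟨e₁, e₂, hk, hs, hex⟩
    have h1 := hs.le
    have h2 := hs.le'
    rcases hex with h | h
    · refine ⟨h.sound, fun e he => ?_⟩
      obtain ⟨i, hi, rfl⟩ := hord.exists_eq he
      rw [← hσ _ (mem_events.1 he).1]
      exact h.covered i (by omega)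
    · have := h.lt; omega

end Sweep

/-! ### The best strip of a given direction -/

/-- The height of a point, in the direction whose slope is in the real array `12`. -/
abbrev heightExp (p : NExp) : RExp := .sub (.get 1 p) (.mul (.get 12 (.lit 0)) (.get 0 p))

/-- The program that computes the numbers `upperCount` and `lowerCount` of all points. -/
def countCmd : Cmd :=
  forTo (.mul (var 1) (var 1)) (.seq decodeCmd
    (.ite (.rlt (heightExp (var 13)) (heightExp (var 12)))
      (.seq (.setReal 14 (var 12) (.add (.get 14 (var 12))
          (.sub (.add (.get 5 (var 13)) (.get 5 (var 13))) (.ofNat (.lit 1)))))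
        (.setReal 15 (var 12) (.add (.get 15 (var 12))
          (.sub (.add (.get 5 (var 13)) (.get 5 (var 13))) (.ofNat (.lit 1))))))
      (.ite (.rlt (heightExp (var 12)) (heightExp (var 13))) .skip
        (.seq (.setReal 14 (var 12) (.add (.get 14 (var 12)) (.get 5 (var 13))))
          (.setReal 15 (var 12) (.add (.get 15 (var 12))
            (.sub (.get 5 (var 13)) (.ofNat (.lit 1)))))))))

/-- The contribution of the point `q` to `upperCount` of the point `p`. -/
noncomputable def upperTerm (c w : ℕ → ℝ) (p q : ℕ) : ℝ :=
  if w q < w p then 2 * c q - 1 else if w p < w q then 0 else c q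

/-- The contribution of the point `q` to `lowerCount` of the point `p`. -/
noncomputable def lowerTerm (c w : ℕ → ℝ) (p q : ℕ) : ℝ :=
  if w q < w p then 2 * c q - 1 else if w p < w q then 0 else c q - 1

/-- The number of blue points in the closed half-plane below the point `p` minus the number of
red points in the open one. -/
noncomputable def upperCount (N : ℕ) (c w : ℕ → ℝ) (p : ℕ) : ℝ := ∑ q ∈ range N, upperTerm c w p q

/-- The number of blue points in the open half-plane below the point `p` minus the number of
red points in the closed one. -/
noncomputable def lowerCount (N : ℕ) (c w : ℕ → ℝ) (p : ℕ) : ℝ := ∑ q ∈ range N, lowerTerm c w p q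

theorem stripVal_eq_sub {N : ℕ} {c w : ℕ → ℝ} {p q : ℕ} (h : w p < w q) :
    stripVal N c w (w p) (w q) = upperCount N c w q - lowerCount N c w p := by
  rw [stripVal, upperCount, lowerCount, ← sum_sub_distrib]
  refine sum_congr rfl fun i _ => ?_
  rw [upperTerm, lowerTerm]
  rcases lt_trichotomy (w i) (w p) with h1 | h1 | h1
  · rw [if_neg (by simp [h1]), if_neg (by simp [h1.le]), if_pos (h1.trans h), if_pos h1]; ring
  · rw [if_pos (by simp [h1, h.le]), if_neg (by simp [h1]), if_pos (by rwa [h1]),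
      if_neg (by simp [h1]), if_neg (by simp [h1])]; ring
  · rw [if_neg h1.not_gt, if_pos h1]
    rcases lt_trichotomy (w i) (w q) with h2 | h2 | h2
    · rw [if_pos ⟨h1.le, h2.le⟩, if_pos ⟨h1, h2⟩, if_pos h2]; ring
    · rw [if_pos (by simp [h2, h.le]), if_neg (by simp [h2]), if_neg (by simp [h2]),
        if_neg (by simp [h2])]
    · rw [if_neg (by simp [h2]), if_neg (by simp [h2.le]), if_neg h2.not_gt, if_pos h2]

theorem sum_range_mul_self_ite {N p : ℕ} (hp : p < N) (f : ℕ → ℝ) :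
    (∑ e ∈ range (N * N), if e / N = p then f (e % N) else 0) = ∑ q ∈ range N, f q := by
  rw [← sum_filter]
  refine sum_nbij' (fun e => e % N) (fun q => p * N + q) ?_ ?_ ?_ ?_ (fun _ _ => rfl)
  · intro e _
    exact mem_range.2 (Nat.mod_lt _ (by omega))
  · intro q hq
    have hq := mem_range.1 hq
    refine mem_filter.2 ⟨mem_range.2 ?_, ((mul_add_eq_iff hq).1 rfl).1.symm⟩
    calc p * N + q < p * N + N := by omega
      _ = (p + 1) * N := by ring
      _ ≤ N * N := Nat.mul_le_mul_right _ hp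
  · intro e he
    rw [mul_add_eq_iff (Nat.mod_lt _ (by omega))]
    exact ⟨(mem_filter.1 he).2.symm, rfl⟩
  · intro q hq
    exact ((mul_add_eq_iff (mem_range.1 hq)).1 rfl).2.symm

section Final

variable {W N M : ℕ} {x y c : ℕ → ℝ} {m : ℝ} {s : Mem}

theorem heightExp_eval (hs : Base N M x y c s) (hm : s.real 12 0 = m) (p : NExp) :
    (heightExp p).eval s = lineHeight x y m (p.eval s) := by
  simp [RExp.eval, NExp.eval, hs.x, hs.y, hm, lineHeight]

theorem runs_countCmd (hs : Base N M x y c s) (hW : N * N ≤ W) (hm : s.real 12 0 = m)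
    (h14 : s.real 14 = fun _ => 0) (h15 : s.real 15 = fun _ => 0) :
    Runs W countCmd s (N * N * 150 + 20) (fun s' => ∀ p < N,
      s'.real 14 p = upperCount N c (lineHeight x y m) p ∧
      s'.real 15 p = lowerCount N c (lineHeight x y m) p) := by
  set w := lineHeight x y m with hw
  refine (Runs.forTo (n := N * N) (D := 120) (fun k s => (Base N M x y c s ∧ s.real 12 0 = m) ∧
    s.real 14 = (fun p => ∑ e ∈ range k, if e / N = p then upperTerm c w p (e % N) else 0) ∧
    s.real 15 = (fun p => ∑ e ∈ range k, if e / N = p then lowerTerm c w p (e % N) else 0))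
    hW rfl ⟨⟨hs, hm⟩, by simpa using h14, by simpa using h15⟩ ?_ ?_ ?_).mono
    (by simp only [NExp.cost]; omega) (fun s' h p hp => ?_)
  · rintro k s v ⟨⟨h, h'⟩, h''⟩
    exact ⟨⟨h.setNat _ _, h'⟩, h''⟩
  · rintro k s - ⟨⟨h, -⟩, -⟩
    simp [NExp.eval, h.size]
  · rintro k s hk ⟨⟨h, hm⟩, hU, hL⟩ h3
    refine ((runs_decodeCmd h.size h3 (by omega)).seq (T₂ := 103) ?_).withFrame.mono
      (by omega) (Q := fun s' =>
      (s'.real 14 = (fun p => ∑ e ∈ range (k + 1),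
        if e / N = p then upperTerm c w p (e % N) else 0) ∧
      s'.real 15 = (fun p => ∑ e ∈ range (k + 1),
        if e / N = p then lowerTerm c w p (e % N) else 0)) ∧ Frame _ s s')
      (fun s' h' => ⟨⟨h.of_frame h'.2, by rw [h'.2.real 12 rfl, hm]⟩, h'.1⟩)
    rintro _ rfl -
    set s₁ := (s.setNat 12 0 (k / N)).setNat 13 0 (k % N) with hs₁
    have hb₁ : Base N M x y c s₁ := (h.setNat _ _).setNat _ _
    have hm₁ : s₁.real 12 0 = m := hm
    have h12 : s₁.nat 12 0 = k / N := by simp [hs₁]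
    have h13 : s₁.nat 13 0 = k % N := by simp [hs₁]
    have hU₁ := hU
    have hL₁ := hL
    rw [show s.real 14 = s₁.real 14 from rfl] at hU₁
    rw [show s.real 15 = s₁.real 15 from rfl] at hL₁
    have step : ∀ (f : ℕ → ℕ → ℝ) (A : ℕ → ℝ),
        A = (fun p => ∑ e ∈ range k, if e / N = p then f p (e % N) else 0) →
        (fun p => ∑ e ∈ range (k + 1), if e / N = p then f p (e % N) else 0) =
          Function.update A (k / N) (A (k / N) + f (k / N) (k % N)) := by
      rintro f A rfl
      funext p
      rw [sum_range_succ, Function.update_apply]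
      by_cases hp : p = k / N
      · subst hp; simp
      · rw [if_neg hp, if_neg (Ne.symm hp), add_zero]
    rw [step _ _ hU₁, step _ _ hL₁]
    refine Runs.straight ?_ (by decide) ?_
    · exact ⟨fun _ => ⟨trivial, trivial⟩, fun _ => ⟨fun _ => trivial, fun _ => ⟨trivial, trivial⟩⟩⟩
    · by_cases h1 : w (k % N) < w (k / N)
      · rw [Cmd.post_ite_pos (by
          simpa only [BExp.Holds, heightExp_eval hb₁ hm₁, NExp.eval, h12, h13] using h1)]
        simp [Cmd.post, NExp.eval, RExp.eval, h12, h13, upperTerm, lowerTerm, h1, hb₁.colour,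
          two_mul]
      · rw [Cmd.post_ite_neg (by
          simpa only [BExp.Holds, heightExp_eval hb₁ hm₁, NExp.eval, h12, h13] using h1)]
        by_cases h2 : w (k / N) < w (k % N)
        · rw [Cmd.post_ite_pos (by
            simpa only [BExp.Holds, heightExp_eval hb₁ hm₁, NExp.eval, h12, h13] using h2)]
          simp [Cmd.post, upperTerm, lowerTerm, h1, h2]
        · rw [Cmd.post_ite_neg (by
            simpa only [BExp.Holds, heightExp_eval hb₁ hm₁, NExp.eval, h12, h13] using h2)]
          simp [Cmd.post, NExp.eval, RExp.eval, h12, h13, upperTerm, lowerTerm, h1, h2, hb₁.colour]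
  · obtain ⟨-, hU, hL⟩ := h
    rw [hU, hL]
    exact ⟨sum_range_mul_self_ite hp _, sum_range_mul_self_ite hp _⟩

/-- The program that finds the best pair of points on the two boundary lines of a strip, and
outputs the strip. -/
def pickCmd : Cmd :=
  .seq (.setReal 16 (.lit 0) (.sub (.ofNat (.lit 0)) (.ofNat (.lit 1))))
    (forTo (.mul (var 1) (var 1)) (.seq decodeCmd
      (.ite (.conj (.rlt (heightExp (var 12)) (heightExp (var 13)))
          (.rlt (.get 16 (.lit 0)) (.sub (.get 14 (var 13)) (.get 15 (var 12)))))
        (.seq (.setReal 16 (.lit 0) (.sub (.get 14 (var 13)) (.get 15 (var 12))))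
        (.seq (.setReal 4 (.lit 0) (.sub (.ofNat (.lit 0)) (.get 12 (.lit 0))))
        (.seq (.setReal 4 (.lit 1) (.ofNat (.lit 1)))
        (.seq (.setReal 4 (.lit 2) (heightExp (var 12)))
          (.setReal 4 (.lit 3) (heightExp (var 13)))))))
        .skip)))

theorem runs_pickCmd (hP : IsPointSet N x y c) (hs : Base N M x y c s) (hW : N * N ≤ W)
    (hm : s.real 12 0 = m)
    (hU : ∀ p < N, s.real 14 p = upperCount N c (lineHeight x y m) p)
    (hL : ∀ p < N, s.real 15 p = lowerCount N c (lineHeight x y m) p) :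
    Runs W pickCmd s (N * N * 140 + 30) (fun s' => ∃ c₁ c₂, c₁ < c₂ ∧
      s'.real 4 0 = -m ∧ s'.real 4 1 = 1 ∧ s'.real 4 2 = c₁ ∧ s'.real 4 3 = c₂ ∧
      ∀ d₁ d₂, stripVal N c (lineHeight x y m) d₁ d₂ ≤ stripVal N c (lineHeight x y m) c₁ c₂) := by
  set w := lineHeight x y m with hw
  refine (Runs.seq (T₁ := 10) (T₂ := N * N * (5 + 120 + 10) + (5 + 10))
    (Q := fun s' => s' = s.setReal 16 0 (-1))
    (Runs.straight (by exact trivial) (by decide) ?_) ?_).mono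
    (by omega) (fun _ => id)
  · simp [Cmd.post, NExp.eval, RExp.eval]
  rintro _ rfl -
  refine (Runs.forTo (n := N * N) (D := 120) (fun k s => (Base N M x y c s ∧ s.real 12 0 = m ∧
      (∀ p < N, s.real 14 p = upperCount N c w p) ∧
      (∀ p < N, s.real 15 p = lowerCount N c w p)) ∧
    (∀ e < k, w (e / N) < w (e % N) →
      stripVal N c w (w (e / N)) (w (e % N)) ≤ s.real 16 0) ∧
    (s.real 16 0 = -1 ∨ ∃ c₁ c₂, c₁ < c₂ ∧ s.real 4 0 = -m ∧ s.real 4 1 = 1 ∧ s.real 4 2 = c₁ ∧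
      s.real 4 3 = c₂ ∧ s.real 16 0 = stripVal N c w c₁ c₂)) hW rfl ?_ ?_ ?_ ?_).mono
    le_rfl (fun s' h => ?_)
  · exact ⟨⟨⟨hs.size, hs.leaves, by simpa using hs.x, by simpa using hs.y,
      by simpa using hs.colour⟩, by simpa using hm, by simpa using hU, by simpa using hL⟩,
      by simp, .inl (by simp)⟩
  · rintro k s v ⟨⟨h, h'⟩, h''⟩
    exact ⟨⟨h.setNat _ _, h'⟩, h''⟩
  · rintro k s - ⟨⟨h, -⟩, -⟩
    simp [NExp.eval, h.size]
  · rintro k s hk ⟨⟨h, hm, hU, hL⟩, hmax, hout⟩ h3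
    have hN : 0 < N := Nat.pos_of_ne_zero (by rintro rfl; simp at hk)
    have hpN : k / N < N := Nat.div_lt_of_lt_mul hk
    have hqN : k % N < N := Nat.mod_lt _ hN
    refine ((runs_decodeCmd h.size h3 (by omega)).seq (T₂ := 103) ?_).withFrame.mono
      (by omega) (Q := fun s' =>
      ((∀ e < k + 1, w (e / N) < w (e % N) →
        stripVal N c w (w (e / N)) (w (e % N)) ≤ s'.real 16 0) ∧
      (s'.real 16 0 = -1 ∨ ∃ c₁ c₂, c₁ < c₂ ∧ s'.real 4 0 = -m ∧ s'.real 4 1 = 1 ∧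
        s'.real 4 2 = c₁ ∧ s'.real 4 3 = c₂ ∧ s'.real 16 0 = stripVal N c w c₁ c₂)) ∧
        Frame _ s s')
      (fun s' h' => ⟨⟨h.of_frame h'.2, by rw [h'.2.real 12 rfl, hm],
        by rw [h'.2.real 14 rfl]; exact hU, by rw [h'.2.real 15 rfl]; exact hL⟩, h'.1⟩)
    rintro _ rfl -
    set s₁ := (s.setNat 12 0 (k / N)).setNat 13 0 (k % N) with hs₁
    have hb₁ : Base N M x y c s₁ := (h.setNat _ _).setNat _ _
    have hm₁ : s₁.real 12 0 = m := hm
    have h12 : s₁.nat 12 0 = k / N := by simp [hs₁]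
    have h13 : s₁.nat 13 0 = k % N := by simp [hs₁]
    have hval : w (k / N) < w (k % N) →
        stripVal N c w (w (k / N)) (w (k % N)) = s₁.real 14 (k % N) - s₁.real 15 (k / N) := by
      intro hlt
      rw [stripVal_eq_sub hlt, ← hU _ hqN, ← hL _ hpN]
      rfl
    have hcond : (BExp.conj (.rlt (heightExp (var 12)) (heightExp (var 13)))
        (.rlt (.get 16 (.lit 0)) (.sub (.get 14 (var 13)) (.get 15 (var 12))))).Holds s₁ ↔
        w (k / N) < w (k % N) ∧ s₁.real 16 0 < s₁.real 14 (k % N) - s₁.real 15 (k / N) := by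
      rw [BExp.Holds, BExp.Holds, heightExp_eval hb₁ hm₁, heightExp_eval hb₁ hm₁]
      simp only [BExp.Holds, NExp.eval, RExp.eval, h12, h13, hw]
    refine Runs.straight ?_ (by decide) ?_
    · exact ⟨fun _ => ⟨trivial, trivial, trivial, trivial, trivial⟩, fun _ => trivial⟩
    · by_cases hlt : w (k / N) < w (k % N) ∧
          s₁.real 16 0 < s₁.real 14 (k % N) - s₁.real 15 (k / N)
      · rw [Cmd.post_ite_pos (hcond.2 hlt)]
        have hv := hval hlt.1
        refine ⟨fun e he hwe => ?_, .inr ⟨w (k / N), w (k % N), hlt.1, ?_⟩⟩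
        · have : stripVal N c w (w (e / N)) (w (e % N)) ≤
              s₁.real 14 (k % N) - s₁.real 15 (k / N) := by
            rcases Nat.lt_succ_iff_lt_or_eq.1 he with he | rfl
            · exact (hmax e he hwe).trans hlt.2.le
            · exact hv.le
          simpa [Cmd.post, NExp.eval, RExp.eval, h12, h13] using this
        · simp [Cmd.post, NExp.eval, RExp.eval, h12, h13, hm₁, hb₁.x, hb₁.y, hw, lineHeight]
          exact hv.symm
      · rw [Cmd.post_ite_neg (fun h => hlt (hcond.1 h))]
        refine ⟨fun e he hwe => ?_, hout⟩
        rcases Nat.lt_succ_iff_lt_or_eq.1 he with he | rfl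
        · exact hmax e he hwe
        · rw [hval hwe]
          exact not_lt.1 fun h => hlt ⟨hwe, h⟩
  · obtain ⟨-, hmax, hout⟩ := h
    have hall : ∀ d₁ d₂, stripVal N c w d₁ d₂ ≤ s'.real 16 0 := by
      intro d₁ d₂
      obtain ⟨p, hp, q, hq, hpq, hle⟩ := exists_stripVal_le_of_pair hP.colour (hP.not_line m) d₁ d₂
      obtain ⟨e1, e2⟩ := (mul_add_eq_iff (q := p) hq).1 rfl
      refine hle.trans ?_
      have := hmax (p * N + q) (by
        calc p * N + q < p * N + N := by omega
          _ = (p + 1) * N := by ring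
          _ ≤ N * N := Nat.mul_le_mul_right _ hp)
      rw [← e1, ← e2] at this
      exact this hpq
    rcases hout with hneg | ⟨c₁, c₂, hc, h0, h1, h2, h3, h16⟩
    · -- Some pair has been chosen, since the maximal value of a strip is not negative.
      have := hall 1 0
      rw [stripVal_one_zero, hneg] at this
      norm_num at this
    · exact ⟨c₁, c₂, hc, h0, h1, h2, h3, fun d₁ d₂ => (hall d₁ d₂).trans h16.le⟩

end Final

/-! ### The whole program -/

/-- The program that computes an optimal strip. -/
def stripCmd : Cmd :=
  .seq joinCmd (.seq doubleCmd (.seq slopesCmd (.seq eventsCmd (.seq sortCmd (.seq insertCmd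
    (.seq sweepCmd (.seq countCmd pickCmd)))))))

/-- The value of a strip of any direction is bounded by one of a critical direction, hence by the
best value of the sweep, hence by the value of the strip that is output. -/
theorem runs_stripCmd {W N K : ℕ} {r b : List (ℝ × ℝ)} (hN : N = r.length + b.length)
    (hN0 : 0 < N) (hK : K = Nat.clog 2 (N * N)) (hW : 2 * 2 ^ K ≤ W) {x y c : ℕ → ℝ}
    (hx : x = fun i => ((r ++ b).getD i 0).1) (hy : y = fun i => ((r ++ b).getD i 0).2)
    (hc : c = colours r.length b.length) (hP : IsPointSet N x y c) :
    Runs W stripCmd (inputMem r b) (4000 * (N * N * (K + 1))) (fun s => ∃ m c₁ c₂, c₁ < c₂ ∧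
      s.real 4 0 = -m ∧ s.real 4 1 = 1 ∧ s.real 4 2 = c₁ ∧ s.real 4 3 = c₂ ∧
      ∀ a b' d₁ d₂, a ≠ 0 ∨ b' ≠ 0 → stripVal N c (fun k => a * x k + b' * y k) d₁ d₂ ≤
        stripVal N c (lineHeight x y m) c₁ c₂) := by
  have hNM : N * N ≤ 2 ^ K := by rw [hK]; exact Nat.le_pow_clog (by norm_num) _
  have hNN : N ≤ N * N := Nat.le_mul_self N
  set E := #(events N x) with hE
  have hEN : E ≤ N * N := by
    rw [hE]; exact (card_le_card (filter_subset _ _)).trans_eq (card_range _)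
  have hbN : b.length ≤ N := by omega
  refine Runs.mono (T₁ := (b.length * 40 + 40) + ((K * 20 + 20) + ((N * N * 50 + 20) +
    ((N * N * (K * 100 + 70) + 20) + ((E * (K * 100 + 100) + 100) +
    ((N * (K * 180 + 130) + 20) + ((2 * E * (K * 360 + 330) + 10) +
    ((N * N * 150 + 20) + (N * N * 140 + 30)))))))))
    (Runs.seq (runs_joinCmd (by omega)) ?_) ?_ (fun _ => id)
  swap
  · have h1 : E * K ≤ N * N * K := Nat.mul_le_mul_right _ hEN
    have h2 : N * K ≤ N * N * K := Nat.mul_le_mul_right _ hNN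
    have h3 : 1 * K ≤ N * N * K := Nat.mul_le_mul_right _ (by omega)
    have e1 : N * N * (K * 100 + 70) = 100 * (N * N * K) + 70 * (N * N) := by ring
    have e2 : E * (K * 100 + 100) = 100 * (E * K) + 100 * E := by ring
    have e3 : N * (K * 180 + 130) = 180 * (N * K) + 130 * N := by ring
    have e4 : 2 * E * (K * 360 + 330) = 720 * (E * K) + 660 * E := by ring
    have e5 : 4000 * (N * N * (K + 1)) = 4000 * (N * N * K) + 4000 * (N * N) := by ring
    rw [e1, e2, e3, e4, e5]
    omega
  rintro s₁ ⟨h1N, h1x, h1y, h1c⟩ hf₁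
  refine (runs_doubleCmd hK (by omega) (h1N.trans hN.symm)).seq fun s₂ h2M hf₂ => ?_
  have hb₂ : Base N (2 ^ K) x y c s₂ := by
    refine ⟨?_, h2M, ?_, ?_, ?_⟩
    · rw [hf₂.nat 1 rfl, h1N, hN]
    · rw [hf₂.real 0 rfl, h1x, hx]
    · rw [hf₂.real 1 rfl, h1y, hy]
    · rw [hf₂.real 5 rfl, h1c, hc]
  refine (runs_slopesCmd hb₂ (by omega)).seq fun s₃ hσ hf₃ => ?_
  have hb₃ := hb₂.of_frame hf₃
  obtain ⟨σ, hσdef⟩ : ∃ σ, σ = s₃.real 6 := ⟨_, rfl⟩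
  rw [← hσdef] at hσ
  refine (runs_eventsCmd (σ := σ) hb₃ rfl hNM hW hσdef.symm
    (by rw [hf₃.nat 4 rfl, hf₂.nat 4 rfl, hf₁.nat 4 rfl]; funext i; simp [inputMem])
    (by rw [hf₃.nat 5 rfl, hf₂.nat 5 rfl, hf₁.nat 5 rfl]; funext i; simp [inputMem])).seq
    fun s₄ h₄ hf₄ => ?_
  obtain ⟨hT₄, hslot₄⟩ := h₄
  have hb₄ := hb₃.of_frame hf₄
  have hσ₄ : s₄.real 6 = σ := by rw [hf₄.real 6 rfl, hσdef]
  refine (runs_sortCmd rfl hW hσ₄ hb₄.leaves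
    (fun e he => (mem_events.1 he).1.trans_le hNM) hT₄
    (by rw [hf₄.nat 7 rfl, hf₃.nat 7 rfl, hf₂.nat 7 rfl, hf₁.nat 7 rfl]; simp [inputMem])).seq
    fun s₅ h₅ hf₅ => ?_
  obtain ⟨hE₅, hord⟩ := h₅
  have hb₅ := hb₄.of_frame hf₅
  have hslot₅ : ∀ p < N, s₅.nat 5 p = sweepSlot N x ∅ ∅ p := by
    intro p hp; rw [hf₅.nat 5 rfl, hslot₄ p hp]
  have z : ∀ a, joinCmd.writesReal a = false → doubleCmd.writesReal a = false →
      slopesCmd.writesReal a = false → eventsCmd.writesReal a = false →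
      sortCmd.writesReal a = false → 4 < a → s₅.real a = fun _ => 0 := by
    intro a h1 h2 h3 h4 h5 ha
    rw [hf₅.real a h5, hf₄.real a h4, hf₃.real a h3, hf₂.real a h2, hf₁.real a h1]
    funext i
    obtain ⟨a, rfl⟩ := Nat.exists_eq_add_of_lt ha
    rw [show 4 + a + 1 = a + 5 by ring]
    rfl
  have zn : ∀ a, joinCmd.writesNat a = false → doubleCmd.writesNat a = false →
      slopesCmd.writesNat a = false → eventsCmd.writesNat a = false →
      sortCmd.writesNat a = false → 0 < a → s₅.nat a = fun _ => 0 := by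
    intro a h1 h2 h3 h4 h5 ha
    rw [hf₅.nat a h5, hf₄.nat a h4, hf₃.nat a h3, hf₂.nat a h2, hf₁.nat a h1]
    funext i
    obtain ⟨a, rfl⟩ := Nat.exists_eq_add_of_lt ha
    rw [show 0 + a + 1 = a + 1 by ring]
    rfl
  refine (runs_insertCmd rfl hW (by omega) hb₅
    (fun p hp => by
      rw [hslot₅ p hp]; exact (sweepSlot_lt hp).trans_le (by omega))
    (z 7 rfl rfl rfl rfl rfl (by norm_num)) (z 8 rfl rfl rfl rfl rfl (by norm_num))
    (z 9 rfl rfl rfl rfl rfl (by norm_num)) (z 10 rfl rfl rfl rfl rfl (by norm_num))).seq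
    fun s₆ hT₆ hf₆ => ?_
  have hb₆ := hb₅.of_frame hf₆
  have h5₆ : s₆.nat 5 = s₅.nat 5 := hf₆.nat 5 rfl
  have hS : SweepState N (2 ^ K) x y c σ E (s₅.nat 6) 0 0 s₆ := by
    refine ⟨hb₆, ?_, hf₆.nat 6 rfl, ?_, ?_, ?_, le_rfl, Nat.zero_le _, ?_, ?_, by simp⟩
    · rw [hf₆.real 6 rfl, hf₅.real 6 rfl, hσ₄]
    · rw [hf₆.nat 7 rfl, hE₅]
    · rw [hf₆.nat 9 rfl, zn 9 rfl rfl rfl rfl rfl (by norm_num)]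
    · rw [hf₆.nat 10 rfl, zn 10 rfl rfl rfl rfl rfl (by norm_num)]
    · intro p hp
      rw [h5₆, hslot₅ p hp]
      simp
    · rw [h5₆]; exact hT₆
  refine (runs_sweepCmd rfl hW hNM hP hσ hord hS
    (by rw [hf₆.nat 11 rfl, zn 11 rfl rfl rfl rfl rfl (by norm_num)])
    (by rw [hf₆.real 11 rfl, z 11 rfl rfl rfl rfl rfl (by norm_num)])).seq fun s₇ h₇ hf₇ => ?_
  obtain ⟨hsound, hcov⟩ := h₇
  have hb₇ := hb₆.of_frame hf₇
  refine (runs_countCmd (m := s₇.real 12 0) hb₇ (by omega) rfl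
    (by rw [hf₇.real 14 rfl, hf₆.real 14 rfl, z 14 rfl rfl rfl rfl rfl (by norm_num)])
    (by rw [hf₇.real 15 rfl, hf₆.real 15 rfl, z 15 rfl rfl rfl rfl rfl (by norm_num)])).seq
    fun s₈ h₈ hf₈ => ?_
  refine (runs_pickCmd (m := s₇.real 12 0) hP (hb₇.of_frame hf₈) (by omega)
    (by rw [hf₈.real 12 rfl]) (fun p hp => (h₈ p hp).1) (fun p hp => (h₈ p hp).2)).mono le_rfl ?_
  rintro s₉ ⟨c₁, c₂, hlt, h0, h1, h2, h3, hmax⟩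
  refine ⟨_, c₁, c₂, hlt, h0, h1, h2, h3, fun a b' d₁ d₂ hab => ?_⟩
  obtain ⟨i₀, hi₀, j₀, hj₀, hij₀⟩ := hP.not_line 0
  have hx' : ∃ i < N, ∃ j < N, x i < x j := by
    rcases lt_trichotomy (x i₀) (x j₀) with h | h | h
    · exact ⟨i₀, hi₀, j₀, hj₀, h⟩
    · rw [lineHeight, lineHeight, h, hP.eq_of_eq i₀ hi₀ j₀ hj₀ h] at hij₀
      exact absurd hij₀ (lt_irrefl _)
    · exact ⟨j₀, hj₀, i₀, hi₀, h⟩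
  obtain ⟨i, hi, j, hj, hij, e₁, e₂, hle⟩ :=
    exists_stripVal_le_of_slope hP.colour hP.eq_of_eq hx' hab d₁ d₂
  have hev := (mul_add_mem_events hj hi).2 hij
  have hcov' := hcov _ hev e₁ e₂
  obtain ⟨q1, q2⟩ := (mul_add_eq_iff (q := i) hj).1 rfl
  rw [← q1, ← q2] at hcov'
  exact hle.trans (hcov'.trans (hsound _ hmax))

/-! ### Strips in the plane and values of strips -/

/-- The linear function of which a strip bounds the values. -/
noncomputable def linForm (a b : ℝ) : (ℝ × ℝ) →L[ℝ] ℝ :=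
  a • ContinuousLinearMap.fst ℝ ℝ ℝ + b • ContinuousLinearMap.snd ℝ ℝ ℝ

theorem linForm_apply (a b : ℝ) (p : ℝ × ℝ) : linForm a b p = a * p.1 + b * p.2 := by
  simp [linForm]

theorem stripRegion_eq_preimage (a b c₁ c₂ : ℝ) :
    stripRegion a b c₁ c₂ = linForm a b ⁻¹' Set.Icc c₁ c₂ := by
  ext p; simp [stripRegion, linForm_apply]

theorem interior_stripRegion {a b : ℝ} (hab : a ≠ 0 ∨ b ≠ 0) (c₁ c₂ : ℝ) :
    interior (stripRegion a b c₁ c₂) = {p | c₁ < a * p.1 + b * p.2 ∧ a * p.1 + b * p.2 < c₂} := by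
  have hsurj : Function.Surjective (linForm a b) := by
    intro z
    rcases hab with h | h
    · exact ⟨(z / a, 0), by rw [linForm_apply]; field_simp; ring⟩
    · exact ⟨(0, z / b), by rw [linForm_apply]; field_simp; ring⟩
  rw [stripRegion_eq_preimage,
    ← ((linForm a b).isOpenMap hsurj).preimage_interior_eq_interior_preimage
      (linForm a b).continuous, interior_Icc]
  ext p; simp [linForm_apply]

theorem interior_compl_stripRegion (a b c₁ c₂ : ℝ) :
    interior (stripRegion a b c₁ c₂)ᶜ = (stripRegion a b c₁ c₂)ᶜ := by
  refine IsOpen.interior_eq (IsClosed.isOpen_compl (self := ?_))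
  rw [stripRegion_eq_preimage]
  exact isClosed_Icc.preimage (linForm a b).continuous

theorem sum_range_getD {l : List (ℝ × ℝ)} {S : Finset (ℝ × ℝ)} (hl : l.Nodup)
    (hS : ∀ p, p ∈ l ↔ p ∈ S) (g : ℝ × ℝ → ℝ) :
    ∑ i ∈ range l.length, g (l.getD i 0) = ∑ p ∈ S, g p := by
  classical
  have hST : S = l.toFinset := by ext p; simp [hS]
  rw [hST, List.sum_toFinset g hl]
  clear hl hS hST
  induction l with
  | nil => simp
  | cons p l ih =>
    simp only [List.length_cons, sum_range_succ', List.getD_cons_succ, List.getD_cons_zero, ih,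
      List.map_cons, List.sum_cons]
    ring

/-- The number of outliers of a strip is the number of blue points minus the value of the strip. -/
theorem numOutliers_stripRegion {r b : List (ℝ × ℝ)} {R B : Finset (ℝ × ℝ)} (hr : r.Nodup)
    (hR : ∀ p, p ∈ r ↔ p ∈ R) (hb : b.Nodup) (hB : ∀ p, p ∈ b ↔ p ∈ B) {a b' : ℝ}
    (hab : a ≠ 0 ∨ b' ≠ 0) (c₁ c₂ : ℝ) :
    (numOutliers ↑R ↑B (stripRegion a b' c₁ c₂) : ℝ) = #B -
      stripVal (r.length + b.length) (colours r.length b.length)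
        (fun i => a * ((r ++ b).getD i 0).1 + b' * ((r ++ b).getD i 0).2) c₁ c₂ := by
  classical
  set f : ℝ × ℝ → ℝ := fun p => a * p.1 + b' * p.2 with hf
  have hRcard : ((↑R ∩ interior (stripRegion a b' c₁ c₂)).ncard : ℝ) =
      ∑ p ∈ R, if c₁ < f p ∧ f p < c₂ then (1 : ℝ) else 0 := by
    rw [interior_stripRegion hab, sum_boole, ← Set.ncard_coe_finset]
    congr 2
    ext p; simp [hf]
  have hBcard : ((↑B ∩ interior (stripRegion a b' c₁ c₂)ᶜ).ncard : ℝ) =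
      #B - ∑ p ∈ B, if c₁ ≤ f p ∧ f p ≤ c₂ then (1 : ℝ) else 0 := by
    rw [interior_compl_stripRegion, sum_boole, eq_sub_iff_add_eq, ← Nat.cast_add,
      ← card_filter_add_card_filter_not (s := B) (fun p => c₁ ≤ f p ∧ f p ≤ c₂), add_comm,
      ← Set.ncard_coe_finset {p ∈ B | ¬ (c₁ ≤ f p ∧ f p ≤ c₂)}]
    congr 3
    ext p
    simp only [Set.mem_inter_iff, mem_coe, Set.mem_compl_iff, stripRegion, Set.mem_ofPred_eq,
      coe_filter, hf]
  rw [numOutliers, Nat.cast_add, hRcard, hBcard, stripVal, sum_range_add]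
  have h1 : ∀ i ∈ range r.length,
      ((if c₁ ≤ f ((r ++ b).getD i 0) ∧ f ((r ++ b).getD i 0) ≤ c₂ then
        colours r.length b.length i else 0) -
      (if c₁ < f ((r ++ b).getD i 0) ∧ f ((r ++ b).getD i 0) < c₂ then
        1 - colours r.length b.length i else 0)) =
      - (if c₁ < f (r.getD i 0) ∧ f (r.getD i 0) < c₂ then (1 : ℝ) else 0) := by
    intro i hi
    have hi := mem_range.1 hi
    rw [List.getD_append _ _ _ _ hi, colours, if_neg (c := r.length ≤ i ∧ _) (by omega)]
    simp
  have h2 : ∀ i ∈ range b.length,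
      ((if c₁ ≤ f ((r ++ b).getD (r.length + i) 0) ∧ f ((r ++ b).getD (r.length + i) 0) ≤ c₂ then
        colours r.length b.length (r.length + i) else 0) -
      (if c₁ < f ((r ++ b).getD (r.length + i) 0) ∧ f ((r ++ b).getD (r.length + i) 0) < c₂ then
        1 - colours r.length b.length (r.length + i) else 0)) =
      (if c₁ ≤ f (b.getD i 0) ∧ f (b.getD i 0) ≤ c₂ then (1 : ℝ) else 0) := by
    intro i hi
    have hi := mem_range.1 hi
    rw [List.getD_append_right _ _ _ _ (by omega), Nat.add_sub_cancel_left, colours,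
      if_pos (c := r.length ≤ r.length + i ∧ _) (by omega)]
    simp
  rw [sum_congr rfl h1, sum_congr rfl h2, sum_neg_distrib,
    sum_range_getD hr hR (fun p => if c₁ < f p ∧ f p < c₂ then (1 : ℝ) else 0),
    sum_range_getD hb hB (fun p => if c₁ ≤ f p ∧ f p ≤ c₂ then (1 : ℝ) else 0)]
  ring

theorem collinear_of_lineHeight_eq {m k : ℝ} {p q r : ℝ × ℝ} (hp : p.2 - m * p.1 = k)
    (hq : q.2 - m * q.1 = k) (hr : r.2 - m * r.1 = k) : Collinear ℝ ({p, q, r} : Set (ℝ × ℝ)) := by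
  rw [collinear_iff_of_mem (p₀ := p) (by simp)]
  refine ⟨(1, m), ?_⟩
  have key : ∀ z : ℝ × ℝ, z.2 - m * z.1 = k → ∃ t : ℝ, z = t • ((1 : ℝ), m) +ᵥ p := by
    intro z hz
    refine ⟨z.1 - p.1, Prod.ext ?_ ?_⟩
    · simp
    · simp only [vadd_eq_add, Prod.snd_add, Prod.smul_snd, smul_eq_mul]
      linarith
  rintro z (rfl | rfl | rfl)
  · exact key _ hp
  · exact key _ hq
  · exact key _ hr

theorem isPointSet_of_inGeneralPosition {r b : List (ℝ × ℝ)} {R B : Finset (ℝ × ℝ)}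
    (hR : ∀ p, p ∈ r ↔ p ∈ R) (hB : ∀ p, p ∈ b ↔ p ∈ B) (hcard : 3 ≤ #(R ∪ B))
    (hgp : InGeneralPosition (↑R ∪ ↑B)) :
    IsPointSet (r.length + b.length) (fun i => ((r ++ b).getD i 0).1)
      (fun i => ((r ++ b).getD i 0).2) (colours r.length b.length) := by
  have mem : ∀ i < r.length + b.length, (r ++ b).getD i 0 ∈ (↑R ∪ ↑B : Set (ℝ × ℝ)) := by
    intro i hi
    rw [List.getD_eq_getElem _ _ (by simpa using hi)]
    have := List.getElem_mem (l := r ++ b) (n := i) (by simpa using hi)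
    rw [List.mem_append, hR, hB] at this
    simpa only [Set.mem_union, mem_coe] using this
  refine ⟨fun i => ?_, fun i hi j hj hij => ?_, fun m => ?_⟩
  · rw [colours]; split_ifs <;> norm_num
  · by_contra hne
    exact (hgp.1 _ (mem i hi) _ (mem j hj) (fun h => hne (by rw [h]))).1 hij
  · by_contra! hall
    obtain ⟨p, hp, q, hq, s, hs, hpq, hps, hqs⟩ := two_lt_card.1 (show 2 < #(R ∪ B) by omega)
    have idx : ∀ p ∈ R ∪ B, ∃ i < r.length + b.length, (r ++ b).getD i 0 = p := by
      intro p hp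
      have : p ∈ r ++ b := by simpa only [List.mem_append, hR, hB, mem_union] using hp
      obtain ⟨i, hi, rfl⟩ := List.getElem_of_mem this
      exact ⟨i, by simpa using hi, List.getD_eq_getElem _ _ hi⟩
    obtain ⟨i, hi, hip⟩ := idx p hp
    obtain ⟨j, hj, hjq⟩ := idx q hq
    obtain ⟨k, hk, hks⟩ := idx s hs
    have e1 := le_antisymm (hall i hi j hj) (hall j hj i hi)
    have e2 := le_antisymm (hall i hi k hk) (hall k hk i hi)
    simp only [lineHeight, hip, hjq, hks] at e1 e2
    refine hgp.2 p ?_ q ?_ s ?_ hpq hps hqs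
      (collinear_of_lineHeight_eq (m := m) rfl e1 e2)
    · simpa using hp
    · simpa using hq
    · simpa using hs

/-! ### The time bound -/

/-- The height of the trees is `O(log n)`; as `n ≥ 2`, the additive constants are absorbed. -/
theorem clog_mul_self_le {n N : ℕ} (hn : 2 ≤ n) (hN : N ≤ 2 * n) :
    ((Nat.clog 2 (N * N) : ℝ) + 1) ≤ 9 * Real.log n := by
  have hlog2 := Real.log_two_gt_d9
  have hn' : (2 : ℝ) ≤ n := by exact_mod_cast hn
  have hlogn : Real.log 2 ≤ Real.log n := Real.log_le_log (by norm_num) hn'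
  have hpow : (2 : ℝ) ^ Nat.clog 2 (N * N) ≤ 2 ^ 3 * (n : ℝ) ^ 2 := by
    have h : 2 ^ Nat.clog 2 (N * N) ≤ 2 ^ 3 * n ^ 2 := by
      rcases Nat.eq_zero_or_pos (Nat.clog 2 (N * N)) with h0 | h0
      · rw [h0]; nlinarith
      · have h1 : 2 ^ (Nat.clog 2 (N * N) - 1) < N * N :=
          (Nat.lt_clog_iff_pow_lt (by norm_num)).1 (by omega)
        have h2 : 2 ^ Nat.clog 2 (N * N) = 2 * 2 ^ (Nat.clog 2 (N * N) - 1) := by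
          rw [← pow_succ']; congr 1; omega
        have h3 : N * N ≤ 2 * n * (2 * n) := Nat.mul_le_mul hN hN
        rw [h2]; nlinarith
    exact_mod_cast h
  have hlog := Real.log_le_log (by positivity) hpow
  rw [Real.log_pow, Real.log_mul (by norm_num) (by positivity), Real.log_pow, Real.log_pow] at hlog
  push_cast at hlog
  nlinarith

end RealRAM

open RealRAM in
theorem mainTheorem6 :
    ∃ (P : RealRAM.Cmd) (K : ℕ) (C : ℝ),
      ∀ (n : ℕ) (R B : Finset (ℝ × ℝ)), R.card ≤ n → B.card ≤ n →
        3 ≤ (R ∪ B).card → InGeneralPosition (↑R ∪ ↑B) →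
        ∀ r b : List (ℝ × ℝ), (r.Nodup ∧ ∀ p, p ∈ r ↔ p ∈ R) → (b.Nodup ∧ ∀ p, p ∈ b ↔ p ∈ B) →
          ∃ (t : ℕ) (s : RealRAM.Mem) (W : Set (ℝ × ℝ)),
            RealRAM.Exec (n ^ K) P (RealRAM.inputMem r b) t s ∧
            (t : ℝ) ≤ C * ((n : ℝ) ^ 2 * Real.log n) ∧
            RealRAM.OutputsStrip s W ∧
            IsOptimalStrip ↑R ↑B W := by
  refine ⟨stripCmd, 6, 4000 * (4 * 9), ?_⟩
  rintro n R B hRn hBn hcard hgp r b ⟨hr, hR⟩ ⟨hb, hB⟩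
  have hrl : r.length = R.card := by
    rw [← List.toFinset_card_of_nodup hr]; congr 1; ext p; simp [hR]
  have hbl : b.length = B.card := by
    rw [← List.toFinset_card_of_nodup hb]; congr 1; ext p; simp [hB]
  have hunion := Finset.card_union_le R B
  obtain ⟨N, hN⟩ : ∃ N, N = r.length + b.length := ⟨_, rfl⟩
  have hN2 : N ≤ 2 * n := by omega
  have hn : 2 ≤ n := by omega
  obtain ⟨K, hK⟩ : ∃ K, K = Nat.clog 2 (N * N) := ⟨_, rfl⟩
  have hNN : 3 * 3 ≤ N * N := Nat.mul_le_mul (by omega) (by omega)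
  -- The largest word stored is the number of a tree node, which is less than `2 * 2 ^ K`, and
  -- `2 ^ K < 2 * N ^ 2 ≤ 8 * n ^ 2`.
  have hW : 2 * 2 ^ K ≤ n ^ 6 := by
    have h0 : 0 < K := by rw [hK]; exact Nat.clog_pos (by norm_num) (by omega)
    have h1 : 2 ^ (K - 1) < N * N := (Nat.lt_clog_iff_pow_lt (by norm_num)).1 (by omega)
    have h2 : 2 ^ K = 2 * 2 ^ (K - 1) := by rw [← pow_succ']; congr 1; omega
    have h3 : N * N ≤ 2 * n * (2 * n) := Nat.mul_le_mul hN2 hN2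
    have h4 : 2 ^ 4 ≤ n ^ 4 := Nat.pow_le_pow_left hn 4
    calc 2 * 2 ^ K ≤ 2 ^ 4 * n ^ 2 := by rw [h2]; nlinarith
      _ ≤ n ^ 4 * n ^ 2 := Nat.mul_le_mul_right _ h4
      _ = n ^ 6 := by ring
  have hP := isPointSet_of_inGeneralPosition hR hB hcard hgp
  rw [← hN] at hP
  obtain ⟨t, s, hexec, ht, m, c₁, c₂, hlt, h0, h1, h2, h3, hmax⟩ :=
    runs_stripCmd (r := r) (b := b) hN (by omega) hK hW rfl rfl rfl hP
  refine ⟨t, s, stripRegion (-m) 1 c₁ c₂, hexec, ?_, ?_, ?_, ?_⟩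
  · have h4 : (t : ℝ) ≤ 4000 * ((N : ℝ) * N * ((K : ℝ) + 1)) := by exact_mod_cast ht
    have h5 : ((K : ℝ) + 1) ≤ 9 * Real.log n := by rw [hK]; exact clog_mul_self_le hn hN2
    have h6 : (N : ℝ) ≤ 2 * n := by exact_mod_cast hN2
    have h7 : (N : ℝ) * N ≤ (2 * n) * (2 * n) := mul_le_mul h6 h6 (by positivity) (by positivity)
    have h8 := mul_le_mul h7 h5 (by positivity) (by positivity)
    calc (t : ℝ) ≤ 4000 * ((N : ℝ) * N * ((K : ℝ) + 1)) := h4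
      _ ≤ 4000 * ((2 * n) * (2 * n) * (9 * Real.log n)) := by linarith
      _ = 4000 * (4 * 9) * ((n : ℝ) ^ 2 * Real.log n) := by ring
  · refine ⟨by simp [h0, h1], by rw [h2, h3]; exact hlt, by rw [h0, h1, h2, h3]⟩
  · exact ⟨-m, 1, c₁, c₂, by simp, hlt, rfl⟩
  · rintro _ ⟨a, b', d₁, d₂, hab, -, rfl⟩
    have hab' : a ≠ 0 ∨ b' ≠ 0 := by
      by_contra! h
      exact hab (by rw [h.1, h.2])
    have key := hmax a b' d₁ d₂ hab'
    have e1 := numOutliers_stripRegion hr hR hb hB hab' d₁ d₂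
    have e2 := numOutliers_stripRegion hr hR hb hB (a := -m) (b' := 1) (by simp) c₁ c₂
    rw [← hN] at e1 e2
    have e3 : lineHeight (fun i => ((r ++ b).getD i 0).1) (fun i => ((r ++ b).getD i 0).2) m =
        fun i => -m * ((r ++ b).getD i 0).1 + 1 * ((r ++ b).getD i 0).2 := by
      funext i; rw [lineHeight]; ring
    rw [e3] at key
    have : (numOutliers ↑R ↑B (stripRegion (-m) 1 c₁ c₂) : ℝ) ≤
        numOutliers ↑R ↑B (stripRegion a b' d₁ d₂) := by
      rw [e1, e2]; linarith
    exact_mod_cast this
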